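/- Let $M$ be a smooth manifold (Hausdorff, second countable, without boundary, not necessarily compact or orientable) of dimension $2n$, and let $\pi\in\Gamma(\wedge^2TM)$ be a log symplectic structure: $\pi$ is a Poisson structure, i.e. $[\pi,\pi]=0$ for the Schouten bracket, and the section $\wedge^n\pi$ of the line bundle $\wedge^{2n}TM$ is transverse to the zero section. Let $Z=(\wedge^n\pi)^{-1}(0)$ be its singular locus. Let $H^k_\pi(M)$ be the Poisson cohomology, i.e. the cohomology of the complex of multivector fields $\mathfrak X^\bullet(M)=\Gamma(\wedge^\bullet TM)$ with the differential $d_\pi=[\pi,\cdot]$. Let $T_ZM$ be the b-tangent bundle, whose sections are the vector fields on $M$ that are tangent to $Z$ along $Z$, and let $H^k_Z(M)$ be the b-de Rham cohomology, i.e. the cohomology of the complex of b-forms $\Omega^\bullet_Z(M)=\Gamma(\wedge^\bullet T_Z^*M)$ (alternating $C^\infty(M)$-multilinear forms on $\Gamma(T_ZM)$) with the exterior differential. Then for every $k\ge 0$ there is an isomorphism of real vector spaces $$H^k_Z(M)\;\cong\;H^k_\pi(M).$$ More precisely, for every $f\in C^\infty(M)$ the Hamiltonian vector field $X_f=\{f,\cdot\}=\pi(df,\cdot)$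 is tangent to $Z$, and the isomorphism can be chosen so that the class of a closed b-form $\alpha\in\Omega^k_Z(M)$ is sent to the class of the multivector field $w\in\mathfrak X^k(M)$ given by $w(df_1,\dots,df_k)=\alpha(X_{f_1},\dots,X_{f_k})$ for all $f_1,\dots,f_k\in C^\infty(M)$, which is a smooth $d_\pi$-cocycle. -/

import Mathlib

open scoped Manifold ContDiff

noncomputable section

namespace LogSymplectic

/-- Cocycles modulo coboundaries: the quotient of `C` by `C ⊓ B`. -/
def Cohomology {X : Type*} [AddCommGroup X] [Module ℝ X] (C B : Submodule ℝ X) : Type _ :=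
  C ⧸ B.submoduleOf C

instance {X : Type*} [AddCommGroup X] [Module ℝ X] (C B : Submodule ℝ X) :
    AddCommGroup (Cohomology C B) :=
  inferInstanceAs (AddCommGroup (C ⧸ B.submoduleOf C))

instance {X : Type*} [AddCommGroup X] [Module ℝ X] (C B : Submodule ℝ X) :
    Module ℝ (Cohomology C B) :=
  inferInstanceAs (Module ℝ (C ⧸ B.submoduleOf C))

/-- The cohomology class of a cocycle. -/
def Cohomology.mk {X : Type*} [AddCommGroup X] [Module ℝ X] (C B : Submodule ℝ X) :
    C →ₗ[ℝ] Cohomology C B :=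
  (B.submoduleOf C).mkQ

section Basic

variable (d : ℕ) (M : Type*) [TopologicalSpace M]
  [ChartedSpace (EuclideanSpace ℝ (Fin d)) M] [IsManifold (𝓡 d) ∞ M]

/-- The algebra `C^∞(M)` of smooth real functions on the `d`-dimensional manifold `M`. -/
abbrev SmoothFun := C^∞⟮𝓡 d, M; 𝓘(ℝ, ℝ), ℝ⟯

/-- Smooth vector fields on `M`. -/
abbrev VecField :=
  ContMDiffSection (𝓡 d) (EuclideanSpace ℝ (Fin d)) ∞ (TangentSpace (𝓡 d) : M → Type _)

end Basic

section Fields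

variable {d : ℕ} {M : Type*} [TopologicalSpace M]
  [ChartedSpace (EuclideanSpace ℝ (Fin d)) M] [IsManifold (𝓡 d) ∞ M]

/-- Pointwise multiplication of a vector field by a smooth function. -/
instance : SMul (SmoothFun d M) (VecField d M) where
  smul f V := ⟨fun x => f x • V x, f.contMDiff.smul_section V.contMDiff⟩

theorem smul_vecField_apply (f : SmoothFun d M) (V : VecField d M) (x : M) :
    (f • V) x = f x • V x := rfl

instance : Module (SmoothFun d M) (VecField d M) where
  one_smul V := by ext x; simp [smul_vecField_apply]
  mul_smul f g V := by ext x; simp [smul_vecField_apply, mul_smul]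
  smul_zero f := by ext x; simp [smul_vecField_apply]
  smul_add f V W := by ext x; simp [smul_vecField_apply]
  add_smul f g V := by ext x; simp [smul_vecField_apply, add_smul]
  zero_smul V := by ext x; simp [smul_vecField_apply]

/-- The derivative `V(f) = df(V)` of a smooth function along a vector field. -/
def lieDeriv (V : VecField d M) (f : SmoothFun d M) : SmoothFun d M :=
  ⟨fun x => mvfderiv (𝓡 d) f x (V x), by
    have h := (f.contMDiff.contMDiff_tangentMap (m := ∞) (by simp)).comp V.contMDiff
    intro x
    exact ((Bundle.contMDiffAt_totalSpace).1 (h x)).2.congr_of_eventuallyEq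
      (by filter_upwards with y; simp [mvfderiv, tangentMap]; rfl)⟩

/-- The derivative of a function along a vector field, computed in a chart. -/
theorem fderiv_comp_extChartAt_symm (V : VecField d M) (g : SmoothFun d M) (x : M)
    (y : EuclideanSpace ℝ (Fin d)) (hy : y ∈ (extChartAt (𝓡 d) x).target) :
    fderiv ℝ (fun z => g ((extChartAt (𝓡 d) x).symm z)) y
      (VectorField.mpullbackWithin 𝓘(ℝ, EuclideanSpace ℝ (Fin d)) (𝓡 d)
        (extChartAt (𝓡 d) x).symm (fun y => V y) (Set.range (𝓡 d)) y) =
      lieDeriv V g ((extChartAt (𝓡 d) x).symm y) := by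
  have h1 := isInvertible_mfderivWithin_extChartAt_symm (I := 𝓡 d) hy
  have hg : MDifferentiableAt (𝓡 d) 𝓘(ℝ, ℝ) g ((extChartAt (𝓡 d) x).symm y) :=
    (g.contMDiff _).mdifferentiableAt (by simp)
  have hs := mdifferentiableWithinAt_extChartAt_symm (I := 𝓡 d) hy
  have hr : Set.range (𝓡 d) = Set.univ := (𝓡 d).range_eq_univ
  have h3 : mfderivWithin 𝓘(ℝ, EuclideanSpace ℝ (Fin d)) (𝓡 d) (extChartAt (𝓡 d) x).symm
      (Set.range (𝓡 d)) y =
      mfderiv 𝓘(ℝ, EuclideanSpace ℝ (Fin d)) (𝓡 d) (extChartAt (𝓡 d) x).symm y := by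
    rw [hr, mfderivWithin_univ]
  rw [hr, mdifferentiableWithinAt_univ] at hs
  have h2 := mfderiv_comp y hg hs
  rw [mfderiv_eq_fderiv] at h2
  change fderiv ℝ (g ∘ (extChartAt (𝓡 d) x).symm) y _ = _
  rw [h2]
  simp only [VectorField.mpullbackWithin_apply]
  rw [h3] at h1 ⊢
  have h4 := h1.self_apply_inverse (V ((extChartAt (𝓡 d) x).symm y))
  change mfderiv (𝓡 d) 𝓘(ℝ, ℝ) g ((extChartAt (𝓡 d) x).symm y)
    (mfderiv 𝓘(ℝ, EuclideanSpace ℝ (Fin d)) (𝓡 d) (extChartAt (𝓡 d) x).symm y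
      (ContinuousLinearMap.inverse _ _)) = _
  rw [h4]
  rfl

theorem differentiableAt_mpullbackWithin (V : VecField d M) (x : M) :
    DifferentiableAt ℝ (VectorField.mpullbackWithin 𝓘(ℝ, EuclideanSpace ℝ (Fin d)) (𝓡 d)
        (extChartAt (𝓡 d) x).symm (fun y => V y) (Set.range (𝓡 d)))
      (extChartAt (𝓡 d) x x) := by
  have h := VectorField.contMDiffWithinAt_mpullbackWithin_extChartAt_symm (I := 𝓡 d) (m := 1)
    (n := ∞) (s := Set.univ) (V := fun y => V y) (x := x)
    ((V.contMDiff x).of_le (by simp)).contMDiffWithinAt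
    uniqueMDiffOn_univ (Set.mem_univ _) (by norm_cast)
  rw [contMDiffWithinAt_vectorSpace_iff_contDiffWithinAt] at h
  have h' := h.contDiffAt (by
    simpa using extChartAt_target_mem_nhds (I := 𝓡 d) x)
  exact h'.differentiableAt (by simp)

/-- `[V, W](f) = V(W(f)) - W(V(f))`. -/
theorem mvfderiv_mlieBracket (V W : VecField d M) (f : SmoothFun d M) (x : M) :
    mvfderiv (𝓡 d) f x (VectorField.mlieBracket (𝓡 d) (fun y => V y) (fun y => W y) x) =
      lieDeriv V (lieDeriv W f) x - lieDeriv W (lieDeriv V f) x := by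
  have hr : Set.range (𝓡 d) = Set.univ := (𝓡 d).range_eq_univ
  have hfx : ContMDiffAt (𝓡 d) 𝓘(ℝ, ℝ) ∞ f ((extChartAt (𝓡 d) x).symm (extChartAt (𝓡 d) x x)) :=
    f.contMDiff _
  have hsym : ContMDiffAt 𝓘(ℝ, EuclideanSpace ℝ (Fin d)) (𝓡 d) ∞ (extChartAt (𝓡 d) x).symm
      (extChartAt (𝓡 d) x x) := by
    have := contMDiffWithinAt_extChartAt_symm_range_self (I := 𝓡 d) (n := ∞) x
    rwa [hr, contMDiffWithinAt_univ] at this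
  have hF : ContDiffAt ℝ ∞ (fun z => f ((extChartAt (𝓡 d) x).symm z)) (extChartAt (𝓡 d) x x) :=
    (hfx.comp _ hsym).contDiffAt
  have key := VectorField.fderiv_apply_lieBracket hF (by
      simp only [minSmoothness_of_isRCLikeNormedField]; norm_cast)
    (differentiableAt_mpullbackWithin W x) (differentiableAt_mpullbackWithin V x)
  have hev : ∀ U : VecField d M, (fun y => fderiv ℝ (fun z => f ((extChartAt (𝓡 d) x).symm z)) y
      (VectorField.mpullbackWithin 𝓘(ℝ, EuclideanSpace ℝ (Fin d)) (𝓡 d)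
        (extChartAt (𝓡 d) x).symm (fun y => U y) (Set.range (𝓡 d)) y))
      =ᶠ[nhds (extChartAt (𝓡 d) x x)] fun y => lieDeriv U f ((extChartAt (𝓡 d) x).symm y) := by
    intro U
    filter_upwards [extChartAt_target_mem_nhds (I := 𝓡 d) x] with y hy
    exact fderiv_comp_extChartAt_symm U f x y hy
  rw [(hev V).fderiv_eq, (hev W).fderiv_eq,
    fderiv_comp_extChartAt_symm V _ x _ (mem_extChartAt_target x),
    fderiv_comp_extChartAt_symm W _ x _ (mem_extChartAt_target x), extChartAt_to_inv] at key
  rw [← key]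
  have hφ : MDifferentiableAt (𝓡 d) 𝓘(ℝ, EuclideanSpace ℝ (Fin d)) (extChartAt (𝓡 d) x) x :=
    mdifferentiableAt_extChartAt (mem_chart_source _ x)
  have hinv := isInvertible_mfderiv_extChartAt (I := 𝓡 d) (mem_extChartAt_source (I := 𝓡 d) x)
  have hc : (f : M → ℝ) =ᶠ[nhds x]
      (fun z => f ((extChartAt (𝓡 d) x).symm z)) ∘ extChartAt (𝓡 d) x := by
    filter_upwards [extChartAt_source_mem_nhds (I := 𝓡 d) x] with y hy
    simp only [Function.comp]
    rw [(extChartAt (𝓡 d) x).left_inv hy]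
  have hd : mfderiv (𝓡 d) 𝓘(ℝ, ℝ) f x =
      (fderiv ℝ (fun z => f ((extChartAt (𝓡 d) x).symm z)) (extChartAt (𝓡 d) x x)).comp
        (mfderiv (𝓡 d) 𝓘(ℝ, EuclideanSpace ℝ (Fin d)) (extChartAt (𝓡 d) x) x) := by
    rw [← mfderiv_eq_fderiv, hc.mfderiv_eq]
    exact mfderiv_comp x (hF.differentiableAt (by simp)).mdifferentiableAt hφ
  rw [← VectorField.mlieBracketWithin_univ, VectorField.mlieBracketWithin_apply]
  change mfderiv (𝓡 d) 𝓘(ℝ, ℝ) f x _ = _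
  rw [hd]
  refine congrArg (fderiv ℝ (fun z => f ((extChartAt (𝓡 d) x).symm z))
    (extChartAt (𝓡 d) x x)) ((hinv.self_apply_inverse _).trans ?_)
  rw [Set.preimage_univ, Set.univ_inter, hr]
  exact congrFun (VectorField.lieBracketWithin_univ (𝕜 := ℝ) (E := EuclideanSpace ℝ (Fin d))) _

/-- The Lie bracket of vector fields. -/
def lieBracket (V W : VecField d M) : VecField d M :=
  ⟨fun x => VectorField.mlieBracket (𝓡 d) (fun y => V y) (fun y => W y) x, by
    have : IsManifold (𝓡 d) (minSmoothness ℝ 2) M := by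
      simp only [minSmoothness_of_isRCLikeNormedField]
      exact IsManifold.of_le (n := ∞) (by norm_cast)
    have : IsManifold (𝓡 d) ((⊤ : ℕ∞) + 1) M := by simpa
    intro x
    exact ContMDiffAt.mlieBracket_vectorField (m := ⊤) (n := ⊤) (V.contMDiff x) (W.contMDiff x)
      (by simp)⟩

theorem lieDeriv_add (V : VecField d M) (f g : SmoothFun d M) :
    lieDeriv V (f + g) = lieDeriv V f + lieDeriv V g := by
  ext x
  have hf : MDifferentiableAt (𝓡 d) 𝓘(ℝ, ℝ) f x := (f.contMDiff x).mdifferentiableAt (by simp)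
  have hg : MDifferentiableAt (𝓡 d) 𝓘(ℝ, ℝ) g x := (g.contMDiff x).mdifferentiableAt (by simp)
  exact DFunLike.congr_fun (mvfderiv_add hf hg) (V x)

theorem lieDeriv_const_smul (V : VecField d M) (c : ℝ) (f : SmoothFun d M) :
    lieDeriv V (c • f) = c • lieDeriv V f := by
  ext x
  have hf : MDifferentiableAt (𝓡 d) 𝓘(ℝ, ℝ) f x := (f.contMDiff x).mdifferentiableAt (by simp)
  have hc : MDifferentiableAt (𝓡 d) 𝓘(ℝ, ℝ) (fun _ : M => c) x := mdifferentiableAt_const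
  have h := DFunLike.congr_fun (mvfderiv_smul hc hf) (V x)
  rw [mvfderiv_const] at h
  refine h.trans ?_
  simp only [add_apply, smul_apply, ContinuousLinearMap.smulRight_apply, zero_apply, zero_smul, add_zero]
  rfl

end Fields

/-! ### b-geometry of a pair `(M, Z)` -/

section BGeometry

variable {d : ℕ} {M : Type*} [TopologicalSpace M]
  [ChartedSpace (EuclideanSpace ℝ (Fin d)) M] [IsManifold (𝓡 d) ∞ M]

/-- The tangent vectors at `x` that are tangent to `Z`: those annihilated by the differentials of
all smooth functions vanishing on `Z`. For `x ∈ Z` and `Z` a closed embedded submanifold this is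
`T_x Z`. -/
def tangentTo (Z : Set M) (x : M) : Submodule ℝ (TangentSpace (𝓡 d) x) where
  carrier := {v | ∀ f : SmoothFun d M, (∀ z ∈ Z, f z = 0) → mvfderiv (𝓡 d) f x v = 0}
  zero_mem' f _ := map_zero _
  add_mem' hv hw f hf := by rw [map_add, hv f hf, hw f hf, add_zero]
  smul_mem' c v hv f hf := by rw [map_smul, hv f hf, smul_zero]

/-- The `C^∞(M)`-module `Γ(T_Z M)` of b-vector fields: the vector fields on `M` that are tangent
to `Z` along `Z`. -/
def bVecField (Z : Set M) : Submodule (SmoothFun d M) (VecField d M) where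
  carrier := {V | ∀ z ∈ Z, V z ∈ tangentTo Z z}
  zero_mem' _ _ := Submodule.zero_mem _
  add_mem' hV hW _ hz := Submodule.add_mem _ (hV _ hz) (hW _ hz)
  smul_mem' f _ hV z hz := Submodule.smul_mem _ (f z) (hV z hz)

/-- The Lie bracket of b-vector fields. -/
def bLieBracket {Z : Set M} (V W : bVecField (d := d) Z) : bVecField (d := d) Z :=
  ⟨lieBracket V.1 W.1, fun z hz f hf => by
    change mvfderiv (𝓡 d) f z
      (VectorField.mlieBracket (𝓡 d) (fun y => V.1 y) (fun y => W.1 y) z) = 0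
    rw [mvfderiv_mlieBracket]
    have hW : lieDeriv V.1 (lieDeriv W.1 f) z = 0 :=
      V.2 z hz (lieDeriv W.1 f) fun y hy => W.2 y hy f hf
    have hV : lieDeriv W.1 (lieDeriv V.1 f) z = 0 :=
      W.2 z hz (lieDeriv V.1 f) fun y hy => V.2 y hy f hf
    rw [hW, hV, sub_zero]⟩

/-- b-differential forms `Ω^k_Z(M) = Γ(⋀^k T_Z^* M)`: alternating `C^∞(M)`-multilinear forms on
the module of sections of `T_Z M`. -/
def BForm (d : ℕ) {M : Type*} [TopologicalSpace M]
    [ChartedSpace (EuclideanSpace ℝ (Fin d)) M] [IsManifold (𝓡 d) ∞ M] (Z : Set M) (k : ℕ) :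
    Type _ :=
  bVecField (d := d) Z [⋀^Fin k]→ₗ[SmoothFun d M] SmoothFun d M

instance (Z : Set M) (k : ℕ) : AddCommGroup (BForm d Z k) :=
  inferInstanceAs (AddCommGroup (bVecField (d := d) Z [⋀^Fin k]→ₗ[SmoothFun d M] SmoothFun d M))

instance (Z : Set M) (k : ℕ) : Module ℝ (BForm d Z k) :=
  inferInstanceAs (Module ℝ (bVecField (d := d) Z [⋀^Fin k]→ₗ[SmoothFun d M] SmoothFun d M))

instance (Z : Set M) (k : ℕ) :
    FunLike (BForm d Z k) (Fin k → bVecField (d := d) Z) (SmoothFun d M) :=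
  inferInstanceAs (FunLike (bVecField (d := d) Z [⋀^Fin k]→ₗ[SmoothFun d M] SmoothFun d M) _ _)

theorem BForm.add_apply {Z : Set M} {k : ℕ} (α β : BForm d Z k) (V : Fin k → bVecField (d := d) Z) :
    (α + β) V = α V + β V := rfl

theorem BForm.smul_apply {Z : Set M} {k : ℕ} (c : ℝ) (α : BForm d Z k)
    (V : Fin k → bVecField (d := d) Z) : (c • α) V = c • α V := rfl

theorem BForm.zero_apply {Z : Set M} {k : ℕ} (V : Fin k → bVecField (d := d) Z) :
    (0 : BForm d Z k) V = 0 := rfl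

/-- The exterior differential of b-forms, evaluated on b-vector fields:
`dα(V₀,…,V_k) = ∑ᵢ (-1)^i Vᵢ(α(V₀,…,V̂ᵢ,…,V_k))
  + ∑_{i<j} (-1)^j α(V₀,…,[Vᵢ,Vⱼ],…,V̂ⱼ,…,V_k)`,
with `[Vᵢ,Vⱼ]` in the place of `Vᵢ`. -/
def bDifferential (Z : Set M) (k : ℕ) :
    BForm d Z k →ₗ[ℝ] ((Fin (k + 1) → bVecField (d := d) Z) → SmoothFun d M) where
  toFun α V :=
    (∑ i : Fin (k + 1), (-1 : ℝ) ^ (i : ℕ) • lieDeriv (V i).1 (α (V ∘ i.succAbove))) +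
    ∑ j : Fin (k + 1), ∑ i ∈ Finset.univ.filter (· < j), (-1 : ℝ) ^ (j : ℕ) •
      α (Function.update V i (bLieBracket (V i) (V j)) ∘ j.succAbove)
  map_add' α β := by
    funext V
    simp only [BForm.add_apply, lieDeriv_add, smul_add, Finset.sum_add_distrib,
      Pi.add_apply]
    abel
  map_smul' c α := by
    funext V
    simp only [BForm.smul_apply, lieDeriv_const_smul, Pi.smul_apply, RingHom.id_apply,
      smul_add, Finset.smul_sum, smul_comm c]

/-- Closed b-forms. -/
def bClosed (d : ℕ) {M : Type*} [TopologicalSpace M]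
    [ChartedSpace (EuclideanSpace ℝ (Fin d)) M] [IsManifold (𝓡 d) ∞ M] (Z : Set M) (k : ℕ) :
    Submodule ℝ (BForm d Z k) :=
  LinearMap.ker (bDifferential Z k)

/-- Exact b-forms. -/
def bExact (d : ℕ) {M : Type*} [TopologicalSpace M]
    [ChartedSpace (EuclideanSpace ℝ (Fin d)) M] [IsManifold (𝓡 d) ∞ M] (Z : Set M) :
    (k : ℕ) → Submodule ℝ (BForm d Z k)
  | 0 => ⊥
  | k + 1 =>
    { carrier := {α | ∃ β : BForm d Z k, ∀ V, bDifferential Z k β V = α V}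
      zero_mem' := ⟨0, fun V => by simp [BForm.zero_apply]⟩
      add_mem' := by
        rintro α α' ⟨β, hβ⟩ ⟨β', hβ'⟩
        exact ⟨β + β', fun V => by simp [BForm.add_apply, hβ, hβ']⟩
      smul_mem' := by
        rintro c α ⟨β, hβ⟩
        exact ⟨c • β, fun V => by simp [BForm.smul_apply, hβ]⟩ }

/-- The b-de Rham cohomology `H^k_Z(M)`: closed b-forms modulo exact ones. -/
abbrev BCohomology (d : ℕ) {M : Type*} [TopologicalSpace M]
    [ChartedSpace (EuclideanSpace ℝ (Fin d)) M] [IsManifold (𝓡 d) ∞ M] (Z : Set M) (k : ℕ) :=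
  Cohomology (bClosed d Z k) (bExact d Z k)

end BGeometry

/-! ### Multivector fields and Poisson cohomology -/

section Poisson

variable {d : ℕ} {M : Type*} [TopologicalSpace M]
  [ChartedSpace (EuclideanSpace ℝ (Fin d)) M] [IsManifold (𝓡 d) ∞ M]

/-- The value of a `k`-vector at `x` on `k` covectors; on `v₁ ∧ … ∧ v_k` it is `det (aⱼ(vᵢ))`. -/
def evalCovec {x : M} {k : ℕ} (a : Fin k → (TangentSpace (𝓡 d) x →L[ℝ] ℝ)) :
    (⋀[ℝ]^k (TangentSpace (𝓡 d) x)) →ₗ[ℝ] ℝ :=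
  exteriorPower.alternatingMapToDual ℝ (TangentSpace (𝓡 d) x) k
    fun i => (a i : TangentSpace (𝓡 d) x →ₗ[ℝ] ℝ)

/-- A section `w` of `⋀^k TM` is smooth if `w(df₁,…,df_k)` is smooth at every point for all
functions `f₁,…,f_k` smooth at that point; taking coordinate functions, this says that the
coefficients of `w` in charts are smooth. -/
def smoothSections (d : ℕ) (M : Type*) [TopologicalSpace M]
    [ChartedSpace (EuclideanSpace ℝ (Fin d)) M] [IsManifold (𝓡 d) ∞ M] (k : ℕ) :
    Submodule ℝ ((x : M) → ⋀[ℝ]^k (TangentSpace (𝓡 d) x)) where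
  carrier := {w | ∀ (x₀ : M) (f : Fin k → M → ℝ),
    (∀ i, ContMDiffAt (𝓡 d) 𝓘(ℝ, ℝ) ∞ (f i) x₀) →
      ContMDiffAt (𝓡 d) 𝓘(ℝ, ℝ) ∞
        (fun x => evalCovec (fun i => mvfderiv (𝓡 d) (f i) x) (w x)) x₀}
  zero_mem' x₀ f _ := by simpa using contMDiffAt_const
  add_mem' hv hw x₀ f hf := by
    simpa [Pi.add_def] using (hv x₀ f hf).add (hw x₀ f hf)
  smul_mem' c w hw x₀ f hf := by
    simpa [Pi.mul_def] using (contMDiffAt_const (c := c)).mul (hw x₀ f hf)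

/-- The space `𝔛^k(M) = Γ(⋀^k TM)` of smooth `k`-vector fields. -/
def MultiVec (d : ℕ) (M : Type*) [TopologicalSpace M]
    [ChartedSpace (EuclideanSpace ℝ (Fin d)) M] [IsManifold (𝓡 d) ∞ M] (k : ℕ) : Type _ :=
  smoothSections d M k

instance (k : ℕ) : AddCommGroup (MultiVec d M k) :=
  inferInstanceAs (AddCommGroup (smoothSections d M k))

instance (k : ℕ) : Module ℝ (MultiVec d M k) :=
  inferInstanceAs (Module ℝ (smoothSections d M k))

/-- The smooth function `w(df₁,…,df_k)`, linear in the multivector field `w`. -/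
def evalFun {k : ℕ} (f : Fin k → SmoothFun d M) : MultiVec d M k →ₗ[ℝ] SmoothFun d M where
  toFun w := ⟨fun x => evalCovec (fun i => mvfderiv (𝓡 d) (f i) x) (w.1 x),
    fun x => w.2 x (fun i => f i) fun i => (f i).contMDiff x⟩
  map_add' v w := by ext x; exact (evalCovec fun i => mvfderiv (𝓡 d) (f i) x).map_add _ _
  map_smul' c w := by ext x; exact (evalCovec fun i => mvfderiv (𝓡 d) (f i) x).map_smul c _

/-- The bracket `{f, g} = π(df, dg)` of a bivector field `π`. -/
def bracket (π : MultiVec d M 2) (f g : SmoothFun d M) : SmoothFun d M :=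
  evalFun ![f, g] π

theorem bracket_add (π : MultiVec d M 2) (f g h : SmoothFun d M) :
    bracket π f (g + h) = bracket π f g + bracket π f h := by
  ext x
  have hg : MDifferentiableAt (𝓡 d) 𝓘(ℝ, ℝ) g x := (g.contMDiff x).mdifferentiableAt (by simp)
  have hh : MDifferentiableAt (𝓡 d) 𝓘(ℝ, ℝ) h x := (h.contMDiff x).mdifferentiableAt (by simp)
  have e : ∀ u : SmoothFun d M, bracket π f u x =
      exteriorPower.alternatingMapToDual ℝ (TangentSpace (𝓡 d) x) 2
        (Function.update ![(mvfderiv (𝓡 d) f x : TangentSpace (𝓡 d) x →ₗ[ℝ] ℝ), 0] 1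
          (mvfderiv (𝓡 d) u x : TangentSpace (𝓡 d) x →ₗ[ℝ] ℝ)) (π.1 x) := by
    intro u
    change exteriorPower.alternatingMapToDual ℝ (TangentSpace (𝓡 d) x) 2 _ (π.1 x) = _
    congr 2
    funext i
    fin_cases i <;> simp
  change _ = bracket π f g x + bracket π f h x
  rw [e, e, e]
  have hd : (mvfderiv (𝓡 d) (g + h : SmoothFun d M) x : TangentSpace (𝓡 d) x →ₗ[ℝ] ℝ) =
      (mvfderiv (𝓡 d) g x : TangentSpace (𝓡 d) x →ₗ[ℝ] ℝ) + mvfderiv (𝓡 d) h x := by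
    ext v
    exact DFunLike.congr_fun (mvfderiv_add hg hh) v
  rw [hd, AlternatingMap.map_update_add]
  rfl

theorem bracket_smul (π : MultiVec d M 2) (f g : SmoothFun d M) (c : ℝ) :
    bracket π f (c • g) = c • bracket π f g := by
  ext x
  have hg : MDifferentiableAt (𝓡 d) 𝓘(ℝ, ℝ) g x := (g.contMDiff x).mdifferentiableAt (by simp)
  have e : ∀ u : SmoothFun d M, bracket π f u x =
      exteriorPower.alternatingMapToDual ℝ (TangentSpace (𝓡 d) x) 2
        (Function.update ![(mvfderiv (𝓡 d) f x : TangentSpace (𝓡 d) x →ₗ[ℝ] ℝ), 0] 1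
          (mvfderiv (𝓡 d) u x : TangentSpace (𝓡 d) x →ₗ[ℝ] ℝ)) (π.1 x) := by
    intro u
    change exteriorPower.alternatingMapToDual ℝ (TangentSpace (𝓡 d) x) 2 _ (π.1 x) = _
    congr 2
    funext i
    fin_cases i <;> simp
  change _ = c * bracket π f g x
  rw [e, e]
  have hc : MDifferentiableAt (𝓡 d) 𝓘(ℝ, ℝ) (fun _ : M => c) x := mdifferentiableAt_const
  have hd : (mvfderiv (𝓡 d) (c • g : SmoothFun d M) x : TangentSpace (𝓡 d) x →ₗ[ℝ] ℝ) =
      c • (mvfderiv (𝓡 d) g x : TangentSpace (𝓡 d) x →ₗ[ℝ] ℝ) := by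
    ext v
    have h := DFunLike.congr_fun (mvfderiv_smul hc hg) v
    rw [mvfderiv_const] at h
    refine h.trans ?_
    simp
  rw [hd, AlternatingMap.map_update_smul]
  rfl

/-- The Schouten bracket `[π, w]` of a bivector field with a `k`-vector field, evaluated on
functions (a multivector field is determined by its values on differentials of functions):
`[π,w](f₀,…,f_k) = ∑ᵢ (-1)^i {fᵢ, w(f₀,…,f̂ᵢ,…,f_k)}
  + ∑_{i<j} (-1)^j w(f₀,…,{fᵢ,fⱼ},…,f̂ⱼ,…,f_k)`,
with `{fᵢ,fⱼ}` in the place of `fᵢ`. The sign conventions for the Schouten bracket in use change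
this at most by a sign depending on `k` only. -/
def schouten (π : MultiVec d M 2) (k : ℕ) :
    MultiVec d M k →ₗ[ℝ] ((Fin (k + 1) → SmoothFun d M) → SmoothFun d M) where
  toFun w f :=
    (∑ i : Fin (k + 1), (-1 : ℝ) ^ (i : ℕ) • bracket π (f i) (evalFun (f ∘ i.succAbove) w)) +
    ∑ j : Fin (k + 1), ∑ i ∈ Finset.univ.filter (· < j), (-1 : ℝ) ^ (j : ℕ) •
      evalFun (Function.update f i (bracket π (f i) (f j)) ∘ j.succAbove) w
  map_add' v w := by
    funext f
    simp only [map_add, bracket_add, smul_add, Finset.sum_add_distrib, Pi.add_apply]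
    abel
  map_smul' c w := by
    funext f
    simp only [map_smul, bracket_smul, Pi.smul_apply, RingHom.id_apply,
      smul_add, Finset.smul_sum, smul_comm c]

/-- `π` is a Poisson structure: `[π, π] = 0`. -/
def IsPoisson (π : MultiVec d M 2) : Prop := schouten π 2 π = 0

/-- Cocycles of the Poisson complex `(𝔛^•(M), d_π = [π, ·])`. -/
def poissonCocycles (π : MultiVec d M 2) (k : ℕ) : Submodule ℝ (MultiVec d M k) :=
  LinearMap.ker (schouten π k)

/-- Coboundaries of the Poisson complex: `w = d_π u`. -/
def poissonCoboundaries (π : MultiVec d M 2) : (k : ℕ) → Submodule ℝ (MultiVec d M k)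
  | 0 => ⊥
  | k + 1 =>
    { carrier := {w | ∃ u : MultiVec d M k, ∀ f, schouten π k u f = evalFun f w}
      zero_mem' := ⟨0, fun f => by simp⟩
      add_mem' := by
        rintro w w' ⟨u, hu⟩ ⟨u', hu'⟩
        exact ⟨u + u', fun f => by simp [hu, hu']⟩
      smul_mem' := by
        rintro c w ⟨u, hu⟩
        exact ⟨c • u, fun f => by simp [hu]⟩ }

/-- The Poisson cohomology `H^k_π(M)`. -/
abbrev PoissonCohomology (π : MultiVec d M 2) (k : ℕ) :=
  Cohomology (poissonCocycles π k) (poissonCoboundaries π k)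

/-- `V` is the Hamiltonian vector field `π^♯(df) = {f, ·}` of `f`. -/
def IsHamiltonian (π : MultiVec d M 2) (f : SmoothFun d M) (V : VecField d M) : Prop :=
  ∀ g : SmoothFun d M, lieDeriv V g = bracket π f g

/-- `w` is the image of the b-form `α` under `∧^k π^♯` (regarded as a multivector field on `M`,
and up to the sign `(-1)^k` by which conventions for `π^♯` differ):
the Hamiltonian vector fields of all functions are tangent to `Z`, and
`w(df₁,…,df_k) = α(π^♯(df₁),…,π^♯(df_k))`. -/
def IsSharp (π : MultiVec d M 2) {Z : Set M} {k : ℕ} (α : BForm d Z k) (w : MultiVec d M k) :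
    Prop :=
  ∀ f : Fin k → SmoothFun d M, ∃ V : Fin k → bVecField (d := d) Z,
    (∀ i, IsHamiltonian π (f i) (V i).1) ∧ evalFun f w = α V

end Poisson

/-! ### Log symplectic structures -/

section LogSymplectic

variable {n : ℕ} {M : Type*} [TopologicalSpace M]
  [ChartedSpace (EuclideanSpace ℝ (Fin (2 * n))) M] [IsManifold (𝓡 (2 * n)) ∞ M]

/-- The section `∧ⁿ π` of the line bundle `⋀^{2n} TM`, as a power in the exterior algebra. -/
def topPower (π : MultiVec (2 * n) M 2) (x : M) :
    ⋀[ℝ]^(2 * n) (TangentSpace (𝓡 (2 * n)) x) :=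
  ⟨(π.1 x : ExteriorAlgebra ℝ (TangentSpace (𝓡 (2 * n)) x)) ^ n, by
    change _ ∈ LinearMap.range (ExteriorAlgebra.ι ℝ) ^ (2 * n)
    rw [pow_mul]; exact Submodule.pow_mem_pow _ (π.1 x).2 n⟩

/-- The singular locus `Z = (∧ⁿ π)⁻¹(0)`. -/
def singularLocus (π : MultiVec (2 * n) M 2) : Set M := {x | topPower π x = 0}

/-- The `i`-th coordinate function of the preferred chart at `x₀`. -/
def coord (x₀ : M) (i : Fin (2 * n)) (x : M) : ℝ :=
  chartAt (EuclideanSpace ℝ (Fin (2 * n))) x₀ x i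

/-- The section `∧ⁿ π` read in the trivialization of `⋀^{2n} TM` given by the chart at `x₀`: the
coefficient of `∂₁ ∧ … ∧ ∂_{2n}`. -/
def topCoeff (π : MultiVec (2 * n) M 2) (x₀ x : M) : ℝ :=
  evalCovec (fun i => mvfderiv (𝓡 (2 * n)) (coord x₀ i) x) (topPower π x)

/-- `π` is a log symplectic structure: it is Poisson, and the section `∧ⁿ π` of the line bundle
`⋀^{2n} TM` is transverse to the zero section, i.e. at each of its zeros its local
representative has nonzero (equivalently, surjective) differential. -/
structure IsLogSymplectic (π : MultiVec (2 * n) M 2) : Prop where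
  isPoisson : IsPoisson π
  transverse : ∀ x₀ ∈ singularLocus π, mvfderiv (𝓡 (2 * n)) (topCoeff π x₀) x₀ ≠ 0

end LogSymplectic

end LogSymplectic

end

/-! The map `sharp` sends a b-form `α` to the multivector field `(f₁, …, f_k) ↦ α(X_{f₁}, …,
X_{f_k})`. Since `X_f` acts on functions as `{f, ·}` and `[X_f, X_g] = X_{{f,g}}`, the two
differentials agree term by term and `sharp` is a chain map (`schouten_sharp`). It is injective,
because off `Z` the Hamiltonian vector fields span the tangent spaces and the complement of `Z` is
dense (`bForm_ext_hamB`). It remains to see that the quotient complex is acyclic.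

Local structure. In coordinates `y` the section `∧ⁿπ` is, up to a constant, the Pfaffian `x` of the
matrix `{y_i, y_j}`. The Jacobi identity makes `{f, x}` a multiple of `x` at each point
(`IsPoisson.brL_pfaff`), so Hamiltonian vector fields are tangent to `Z = {x = 0}`. By
transversality `x` can serve as a coordinate near a point of `Z`; the brackets `{x, y_j}` are
divisible by `x`, and `π` becomes a nondegenerate bivector of the b-tangent bundle (`BFrame`,
`IsLogSymplectic.exists_bFrame`). The image of `sharp` consists of the multivector fields that
vanish at points of `Z` as soon as one argument vanishes on `Z` (`IsB`; see `isB_sharpAlt` and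
`IsB.exists_bForm`).

Acyclicity. There is a global one-form `Θ = ∑ a_s df_s` such that `E = π^♯Θ` vanishes on `Z` and has
linear part `-1` on the functions vanishing there, so that locally `E` looks like `-x ∂_x`
(`BFrame.exists_isEulerAt`; the condition survives a partition of unity,
`IsLogSymplectic.exists_euler`). Cartan's formula expresses `d_π i_Θ + i_Θ d_π` through `E` and the
Koszul brackets `[Θ, dh]`. On the quotient, which only sees components with a factor `∂_x` along
`Z`, this operator is the identity: the argument that vanishes on `Z` contributes `1`, and every
other argument contributes `0`, although `Θ` need not be closed (`IsEulerAt.sum_pointDer_eq_zero`,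
`IsEulerAt.ceSum_eq`). Hence, if `d_π w` is in the image of `sharp`, so is `w - d_π(i_Θ w)`
(`IsLogSymplectic.exists_isB_sub`). With `d_π w = 0` this gives surjectivity in cohomology, with
`d_π w = sharp α` it gives injectivity.

Multivector fields are handled as alternating multiderivations of `C^∞(M)` (`exists_multiVec`), so
that both complexes are instances of the Chevalley–Eilenberg formula `ceSum`. -/

noncomputable section

namespace LogSymplectic

/-! ### The Chevalley–Eilenberg differential -/

section ChevalleyEilenberg

variable {L A : Type*} [AddCommGroup L] [Module ℝ L] [AddCommGroup A] [Module ℝ A]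

/-- Bringing the `j`-th argument to the front is a cycle of sign `(-1)^j`. This explains the signs
in the second sum of `ceSum`, and lets statements about any argument be reduced to the first one. -/
theorem map_update_eq_neg_one_pow {k : ℕ} (w : L [⋀^Fin (k + 1)]→ₗ[ℝ] A) (v : Fin (k + 1) → L)
    (j : Fin (k + 1)) (y : L) :
    w (Function.update v j y) = (-1 : ℝ) ^ (j : ℕ) • w (Fin.cons y (v ∘ j.succAbove)) := by
  have h := w.map_insertNth j y (v ∘ j.succAbove)
  have e : (j.insertNth y (v ∘ j.succAbove) : Fin (k + 1) → L) = Function.update v j y := by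
    refine (Fin.eq_insertNth_iff.2 ⟨by simp, ?_⟩).symm
    funext i; simp [Fin.removeNth]
  rw [← e, h]
  change _ = (-1 : ℝ) ^ (j : ℕ) • w (Matrix.vecCons y (v ∘ j.succAbove))
  rcases neg_one_pow_eq_or ℤ (j : ℕ) with h1 | h1 <;>
  rcases Nat.even_or_odd (j : ℕ) with h2 | h2 <;> simp [h2.neg_one_pow]

theorem alternatingMap_ext_cons {k : ℕ} {w w' : L [⋀^Fin (k + 1)]→ₗ[ℝ] A}
    (h : ∀ x, w.curryLeft x = w'.curryLeft x) : w = w' := by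
  ext v
  have := DFunLike.congr_fun (h (v 0)) (Fin.tail v)
  change w (Fin.cons (v 0) (Fin.tail v)) = w' (Fin.cons (v 0) (Fin.tail v)) at this
  simpa [Fin.cons_self_tail] using this

variable (br : L →ₗ[ℝ] L →ₗ[ℝ] L) (ρ : L →ₗ[ℝ] A →ₗ[ℝ] A)

/-- The Chevalley–Eilenberg differential, as a function of tuples. -/
def ceSum {k : ℕ} (w : (Fin k → L) → A) (v : Fin (k + 1) → L) : A :=
  (∑ i : Fin (k + 1), (-1 : ℝ) ^ (i : ℕ) • ρ (v i) (w (v ∘ i.succAbove))) +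
    ∑ j : Fin (k + 1), ∑ i ∈ Finset.univ.filter (· < j), (-1 : ℝ) ^ (j : ℕ) •
      w (Function.update v i (br (v i) (v j)) ∘ j.succAbove)

/-- The Lie derivative of an alternating map along `x`. -/
def ceLie {k : ℕ} (x : L) (w : L [⋀^Fin k]→ₗ[ℝ] A) : L [⋀^Fin k]→ₗ[ℝ] A where
  toFun v := ρ x (w v) - ∑ j, w (Function.update v j (br x (v j)))
  map_update_add' {_} v i a b := by
    -- Each summand is `w` precomposed with `br x` in the single slot `j`; in this form its
    -- multilinearity is that of a composite.
    have e : ∀ (c : L) (j : Fin k), w (Function.update (Function.update v i c) j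
        (br x (Function.update v i c j))) =
        (w.toMultilinearMap.compLinearMap fun l => if l = j then br x else LinearMap.id)
          (Function.update v i c) := by
      intro c j
      simp only [MultilinearMap.compLinearMap_apply, AlternatingMap.coe_multilinearMap]
      congr 1; funext l
      by_cases h : l = j
      · subst h; simp
      · simp [h]
    have hd : ∀ (i : DecidableEq (Fin k)), i = instDecidableEqFin k := fun i =>
      Subsingleton.elim _ _
    cases hd ‹_›
    simp only [e, MultilinearMap.map_update_add, AlternatingMap.map_update_add, map_add,
      Finset.sum_add_distrib]
    abel
  map_update_smul' {_} v i c a := by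
    have e : ∀ (c : L) (j : Fin k), w (Function.update (Function.update v i c) j
        (br x (Function.update v i c j))) =
        (w.toMultilinearMap.compLinearMap fun l => if l = j then br x else LinearMap.id)
          (Function.update v i c) := by
      intro c j
      simp only [MultilinearMap.compLinearMap_apply, AlternatingMap.coe_multilinearMap]
      congr 1; funext l
      by_cases h : l = j
      · subst h; simp
      · simp [h]
    have hd : ∀ (i : DecidableEq (Fin k)), i = instDecidableEqFin k := fun i =>
      Subsingleton.elim _ _
    cases hd ‹_›
    simp only [e, MultilinearMap.map_update_smul, AlternatingMap.map_update_smul, map_smul,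
      smul_sub, Finset.smul_sum]
  map_eq_zero_of_eq' v i j hv hij := by
    rw [w.map_eq_zero_of_eq v hv hij, map_zero, zero_sub, neg_eq_zero]
    -- Only the summands `i` and `j` survive, since the others still have two equal arguments; these
    -- two differ by a transposition and cancel.
    rw [← Finset.add_sum_erase _ _ (Finset.mem_univ i),
      ← Finset.add_sum_erase _ _ (Finset.mem_erase.2 ⟨hij.symm, Finset.mem_univ j⟩)]
    rw [Finset.sum_eq_zero, add_zero]
    · have : Function.update v j (br x (v j)) =
          Function.update v i (br x (v i)) ∘ Equiv.swap i j := by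
        funext l
        by_cases h1 : l = i
        · subst h1; simp [hij, hij.symm, hv]
        · by_cases h2 : l = j
          · subst h2; simp [hv]
          · simp [h1, h2, Equiv.swap_apply_of_ne_of_ne]
      rw [this, w.map_swap _ hij, add_neg_cancel]
    · intro l hl
      simp only [Finset.mem_erase, Finset.mem_univ, and_true] at hl
      exact w.map_eq_zero_of_eq _ (by simp [hl.1.symm, hl.2.symm, hv]) hij

theorem ceLie_apply {k : ℕ} (x : L) (w : L [⋀^Fin k]→ₗ[ℝ] A) (v : Fin k → L) :
    ceLie br ρ x w v = ρ x (w v) - ∑ j, w (Function.update v j (br x (v j))) := rfl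

/-- The commutation rule `[L_x, i_y] = i_{[x,y]}`: the term of index `0` in the Lie derivative is
the contraction with the bracket. -/
theorem ceLie_curryLeft {k : ℕ} (x y : L) (w : L [⋀^Fin (k + 1)]→ₗ[ℝ] A) :
    (ceLie br ρ x w).curryLeft y = ceLie br ρ x (w.curryLeft y) - w.curryLeft (br x y) := by
  ext v
  change ceLie br ρ x w (Fin.cons y v) = ceLie br ρ x (w.curryLeft y) v - w (Fin.cons (br x y) v)
  rw [ceLie_apply, ceLie_apply, Fin.sum_univ_succ]
  simp only [Fin.cons_zero, Fin.update_cons_zero, Fin.cons_succ, ← Fin.cons_update]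
  change ρ x (w (Fin.cons y v)) - _ = ρ x (w (Fin.cons y v)) -
    ∑ j, w (Fin.cons y (Function.update v j (br x (v j)))) - _
  abel

theorem ceSum_zero {w : L [⋀^Fin 0]→ₗ[ℝ] A} (v : Fin 1 → L) :
    ceSum br ρ w v = ρ (v 0) (w ![]) := by
  simp [ceSum, Subsingleton.elim (v ∘ Fin.succ) ![], Finset.filter_false_of_mem]

/-- Cartan's formula `i_x d = L_x - d i_x`. The terms in which index `0` is active form the Lie
derivative, and the rest is the differential of the contraction with shifted signs. All later
properties of the differential follow from this recursion by induction on the degree. -/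
theorem ceSum_cons {k : ℕ} (w : L [⋀^Fin (k + 1)]→ₗ[ℝ] A) (x : L) (v : Fin (k + 1) → L) :
    ceSum br ρ w (Fin.cons x v) = ceLie br ρ x w v - ceSum br ρ (w.curryLeft x) v := by
  have hc : ∀ u : Fin k → L, w.curryLeft x u = w (Fin.cons x u) := fun u => rfl
  have e1 : ∀ (y : L) (i : Fin (k + 1)) (v : Fin (k + 1) → L), (Fin.cons y v : Fin (k + 2) → L) ∘
      i.succ.succAbove = Fin.cons y (v ∘ i.succAbove) := by
    intro y i v; funext l
    refine Fin.cases ?_ (fun l => ?_) l <;> simp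
  unfold ceSum
  rw [ceLie_apply]
  simp only [hc, Finset.sum_filter]
  rw [Fin.sum_univ_succ, Fin.sum_univ_succ (n := k + 1) (f := fun j => ∑ i, _)]
  simp only [Fin.not_lt_zero, if_false, Finset.sum_const_zero, zero_add]
  simp_rw [Fin.sum_univ_succ (n := k + 1)]
  simp only [Fin.succ_pos, if_true, Fin.cons_zero, Fin.cons_succ, Fin.update_cons_zero,
    ← Fin.cons_update, e1, Fin.succ_lt_succ_iff, Fin.val_succ, pow_succ, mul_neg, mul_one,
    neg_smul, Fin.val_zero, pow_zero, one_smul, Finset.sum_neg_distrib, Finset.sum_add_distrib,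
    map_update_eq_neg_one_pow w v]
  have e3 : (Fin.cons x v : Fin (k + 2) → L) ∘ Fin.succAbove 0 = v := by
    funext l; simp
  rw [e3]
  have e4 : ∀ j : Fin (k + 1), (∑ i : Fin (k + 1), if i < j then -((-1 : ℝ) ^ (j : ℕ) •
      w (Fin.cons x (Function.update v i (br (v i) (v j)) ∘ j.succAbove))) else 0) =
      -∑ i : Fin (k + 1), if i < j then ((-1 : ℝ) ^ (j : ℕ) •
      w (Fin.cons x (Function.update v i (br (v i) (v j)) ∘ j.succAbove))) else 0 := by
    intro j
    rw [← Finset.sum_neg_distrib]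
    exact Finset.sum_congr rfl fun i _ => by split_ifs <;> simp
  simp only [e4, Finset.sum_neg_distrib]
  abel

theorem ceSum_add {k : ℕ} (w w' : (Fin k → L) → A) (v : Fin (k + 1) → L) :
    ceSum br ρ (w + w') v = ceSum br ρ w v + ceSum br ρ w' v := by
  simp only [ceSum, Pi.add_apply, map_add, smul_add, Finset.sum_add_distrib]
  abel

theorem ceSum_smul {k : ℕ} (c : ℝ) (w : (Fin k → L) → A) (v : Fin (k + 1) → L) :
    ceSum br ρ (c • w) v = c • ceSum br ρ w v := by
  simp only [ceSum, Pi.smul_apply, map_smul, smul_add, Finset.smul_sum, smul_comm c]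

theorem ceSum_coe_add {k : ℕ} (w w' : L [⋀^Fin k]→ₗ[ℝ] A) (v : Fin (k + 1) → L) :
    ceSum br ρ (w + w' : L [⋀^Fin k]→ₗ[ℝ] A) v = ceSum br ρ w v + ceSum br ρ w' v :=
  ceSum_add br ρ w w' v

theorem ceSum_coe_smul {k : ℕ} (c : ℝ) (w : L [⋀^Fin k]→ₗ[ℝ] A) (v : Fin (k + 1) → L) :
    ceSum br ρ (c • w : L [⋀^Fin k]→ₗ[ℝ] A) v = c • ceSum br ρ w v :=
  ceSum_smul br ρ c w v

theorem ceSum_coe_zero {k : ℕ} (v : Fin (k + 1) → L) :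
    ceSum br ρ (0 : L [⋀^Fin k]→ₗ[ℝ] A) v = 0 := by
  simp [ceSum]

theorem ceLie_add_left {k : ℕ} (x y : L) (w : L [⋀^Fin k]→ₗ[ℝ] A) (v : Fin k → L) :
    ceLie br ρ (x + y) w v = ceLie br ρ x w v + ceLie br ρ y w v := by
  simp only [ceLie_apply, map_add, LinearMap.add_apply, AlternatingMap.map_update_add,
    Finset.sum_add_distrib]
  abel

theorem ceLie_smul_left {k : ℕ} (c : ℝ) (x : L) (w : L [⋀^Fin k]→ₗ[ℝ] A) (v : Fin k → L) :
    ceLie br ρ (c • x) w v = c • ceLie br ρ x w v := by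
  simp only [ceLie_apply, map_smul, LinearMap.smul_apply, AlternatingMap.map_update_smul,
    smul_sub, Finset.smul_sum]

theorem ceLie_sub_right {k : ℕ} (x : L) (w w' : L [⋀^Fin k]→ₗ[ℝ] A) :
    ceLie br ρ x (w - w') = ceLie br ρ x w - ceLie br ρ x w' := by
  ext v
  simp only [ceLie_apply, AlternatingMap.sub_apply, map_sub, Finset.sum_sub_distrib]
  abel

theorem ceSum_update_add {k : ℕ} (w : L [⋀^Fin k]→ₗ[ℝ] A) (v : Fin (k + 1) → L)
    (i : Fin (k + 1)) (a b : L) :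
    ceSum br ρ w (Function.update v i (a + b)) =
      ceSum br ρ w (Function.update v i a) + ceSum br ρ w (Function.update v i b) := by
  induction k with
  | zero =>
    obtain rfl : i = 0 := Fin.fin_one_eq_zero i
    simp [ceSum_zero]
  | succ k ih =>
    obtain ⟨x, v, rfl⟩ : ∃ x u, v = Fin.cons x u := ⟨v 0, Fin.tail v, (Fin.cons_self_tail v).symm⟩
    refine Fin.cases ?_ (fun i => ?_) i
    · simp only [Fin.update_cons_zero, ceSum_cons, ceLie_add_left, map_add, ceSum_coe_add]
      abel
    · simp only [← Fin.cons_update, ceSum_cons, AlternatingMap.map_update_add, ih]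
      abel

theorem ceSum_update_smul {k : ℕ} (w : L [⋀^Fin k]→ₗ[ℝ] A) (v : Fin (k + 1) → L)
    (i : Fin (k + 1)) (c : ℝ) (a : L) :
    ceSum br ρ w (Function.update v i (c • a)) = c • ceSum br ρ w (Function.update v i a) := by
  induction k with
  | zero =>
    obtain rfl : i = 0 := Fin.fin_one_eq_zero i
    simp [ceSum_zero]
  | succ k ih =>
    obtain ⟨x, v, rfl⟩ : ∃ x u, v = Fin.cons x u := ⟨v 0, Fin.tail v, (Fin.cons_self_tail v).symm⟩
    refine Fin.cases ?_ (fun i => ?_) i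
    · simp only [Fin.update_cons_zero, ceSum_cons, ceLie_smul_left, map_smul, ceSum_coe_smul,
        smul_sub]
    · simp only [← Fin.cons_update, ceSum_cons, AlternatingMap.map_update_smul, ih, smul_sub]

/-- A multilinear map that is alternating in its last variables, and vanishes when the first two
variables agree, is alternating. -/
theorem eq_zero_of_cons {k : ℕ} (F : (Fin (k + 2) → L) → A)
    (G : L → L [⋀^Fin (k + 1)]→ₗ[ℝ] A) (hG : ∀ x v, F (Fin.cons x v) = G x v)
    (h : ∀ x v, F (Fin.cons x (Fin.cons x v)) = 0) (v : Fin (k + 2) → L) (i j : Fin (k + 2))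
    (hv : v i = v j) (hij : i ≠ j) : F v = 0 := by
  obtain ⟨x, v, rfl⟩ : ∃ x u, v = Fin.cons x u := ⟨v 0, Fin.tail v, (Fin.cons_self_tail v).symm⟩
  have key : ∀ j : Fin (k + 1), x = v j → F (Fin.cons x v) = 0 := by
    intro j hx
    have : v = Function.update v j x := by rw [hx, Function.update_eq_self]
    rw [hG, this, map_update_eq_neg_one_pow, ← hG, h, smul_zero]
  rcases Fin.eq_zero_or_eq_succ i with rfl | ⟨i, rfl⟩ <;>
  rcases Fin.eq_zero_or_eq_succ j with rfl | ⟨j, rfl⟩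
  · exact absurd rfl hij
  · exact key j (by simpa using hv)
  · exact key i (by simpa using hv.symm)
  · rw [hG]
    exact (G x).map_eq_zero_of_eq v (by simpa using hv) (fun h => hij (by rw [h]))

variable (hbr : ∀ x, br x x = 0)

include hbr in
-- By Cartan's formula and induction `dw` is alternating in all arguments but the first, so it is
-- enough that `i_x i_x d w = 0`. Here `i_x L_x = L_x i_x` because `[x, x] = 0`, so the two terms
-- `L_x i_x w` cancel and what is left is `d i_x i_x w = 0`.
theorem ceSum_eq_zero_of_eq {k : ℕ} (w : L [⋀^Fin k]→ₗ[ℝ] A) (v : Fin (k + 1) → L)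
    (i j : Fin (k + 1)) (hv : v i = v j) (hij : i ≠ j) : ceSum br ρ w v = 0 := by
  induction k with
  | zero => exact absurd ((Fin.fin_one_eq_zero i).trans (Fin.fin_one_eq_zero j).symm) hij
  | succ k ih =>
    let D : ∀ w : L [⋀^Fin k]→ₗ[ℝ] A, L [⋀^Fin (k + 1)]→ₗ[ℝ] A := fun w =>
      { toFun := ceSum br ρ w
        map_update_add' := fun {_} v i a b => by
          convert ceSum_update_add br ρ w v i a b
        map_update_smul' := fun {_} v i a b => by
          convert ceSum_update_smul br ρ w v i a b
        map_eq_zero_of_eq' := fun v i j hv hij => ih w v i j hv hij }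
    refine eq_zero_of_cons _ (fun x => ceLie br ρ x w - D (w.curryLeft x))
      (fun x v => ceSum_cons br ρ w x v) (fun x v => ?_) v i j hv hij
    rw [ceSum_cons]
    have h1 := DFunLike.congr_fun (ceLie_curryLeft br ρ x x w) v
    rw [hbr, map_zero, sub_zero] at h1
    change ceLie br ρ x w (Fin.cons x v) = _ at h1
    rw [h1]
    cases k with
    | zero => simp [ceSum_zero, ceLie_apply, Subsingleton.elim v ![]]
    | succ k => rw [ceSum_cons, AlternatingMap.curryLeft_same, ceSum_coe_zero, sub_zero, sub_self]

/-- The Chevalley–Eilenberg differential of an alternating map. -/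
def ceD {k : ℕ} (w : L [⋀^Fin k]→ₗ[ℝ] A) : L [⋀^Fin (k + 1)]→ₗ[ℝ] A where
  toFun := ceSum br ρ w
  map_update_add' := fun {_} v i a b => by convert ceSum_update_add br ρ w v i a b
  map_update_smul' := fun {_} v i a b => by convert ceSum_update_smul br ρ w v i a b
  map_eq_zero_of_eq' := fun v i j hv hij => ceSum_eq_zero_of_eq br ρ hbr w v i j hv hij

theorem ceD_apply {k : ℕ} (w : L [⋀^Fin k]→ₗ[ℝ] A) (v : Fin (k + 1) → L) :
    ceD br ρ hbr w v = ceSum br ρ w v := rfl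

theorem ceD_curryLeft {k : ℕ} (w : L [⋀^Fin (k + 1)]→ₗ[ℝ] A) (x : L) :
    (ceD br ρ hbr w).curryLeft x = ceLie br ρ x w - ceD br ρ hbr (w.curryLeft x) := by
  ext v
  exact ceSum_cons br ρ w x v

theorem ceD_curryLeft_zero (w : L [⋀^Fin 0]→ₗ[ℝ] A) (x : L) :
    (ceD br ρ hbr w).curryLeft x = ceLie br ρ x w := by
  ext v
  change ceSum br ρ w (Fin.cons x v) = _
  simp [ceSum_zero, ceLie_apply, Subsingleton.elim v ![]]

theorem ceD_sub {k : ℕ} (w w' : L [⋀^Fin k]→ₗ[ℝ] A) :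
    ceD br ρ hbr (w - w') = ceD br ρ hbr w - ceD br ρ hbr w' := by
  ext v
  have := ceSum_coe_add br ρ (w - w') w' v
  rw [sub_add_cancel] at this
  simp only [ceD_apply, AlternatingMap.sub_apply, this]
  abel

variable (hρ : ∀ x y a, ρ (br x y) a = ρ x (ρ y a) - ρ y (ρ x a))
  (hjac : ∀ x y z, br x (br y z) = br (br x y) z + br y (br x z))

include hρ hjac in
-- Contracting both sides with `z` reduces the degree; in degree zero this is the representation
-- property of `ρ`, and the contraction terms match by the Jacobi identity.
theorem ceLie_bracket {k : ℕ} (x y : L) (w : L [⋀^Fin k]→ₗ[ℝ] A) :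
    ceLie br ρ (br x y) w =
      ceLie br ρ x (ceLie br ρ y w) - ceLie br ρ y (ceLie br ρ x w) := by
  induction k with
  | zero => ext v; simp [ceLie_apply, hρ]
  | succ k ih =>
    refine alternatingMap_ext_cons fun z => ?_
    have hs : ∀ u u' : L [⋀^Fin (k + 1)]→ₗ[ℝ] A,
      (u - u').curryLeft z = u.curryLeft z - u'.curryLeft z := fun _ _ => rfl
    rw [hs]
    simp only [ceLie_curryLeft, ih, ceLie_sub_right]
    have : br (br x y) z = br x (br y z) - br y (br x z) := by rw [hjac x y z]; abel
    rw [this, map_sub]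
    abel

include hρ hjac in
-- Contracted with `y`, the claim follows from Cartan's formula, `[L_x, i_y] = i_{[x,y]}`, `[L_x,
-- L_y] = L_{[x,y]}` and the same claim for `i_y w`.
theorem ceLie_ceD {k : ℕ} (x : L) (w : L [⋀^Fin k]→ₗ[ℝ] A) :
    ceLie br ρ x (ceD br ρ hbr w) = ceD br ρ hbr (ceLie br ρ x w) := by
  induction k with
  | zero =>
    refine alternatingMap_ext_cons fun y => ?_
    rw [ceLie_curryLeft, ceD_curryLeft_zero, ceD_curryLeft_zero, ceD_curryLeft_zero,
      ceLie_bracket br ρ hρ hjac]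
    abel
  | succ k ih =>
    refine alternatingMap_ext_cons fun y => ?_
    rw [ceLie_curryLeft, ceD_curryLeft, ceD_curryLeft, ceD_curryLeft, ceLie_curryLeft,
      ceLie_bracket br ρ hρ hjac, ceLie_sub_right, ih, ceD_sub]
    abel

include hρ hjac in
-- By Cartan's formula `i_y d d w = L_y d w - d L_y w + d d i_y w`; the first two terms cancel and
-- the last is zero by induction. No sum over triples of indices has to be rearranged.
theorem ceD_ceD {k : ℕ} (w : L [⋀^Fin k]→ₗ[ℝ] A) :
    ceD br ρ hbr (ceD br ρ hbr w) = 0 := by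
  induction k with
  | zero =>
    refine alternatingMap_ext_cons fun y => ?_
    rw [ceD_curryLeft, ceD_curryLeft_zero, ceLie_ceD br ρ hbr hρ hjac, sub_self]; rfl
  | succ k ih =>
    refine alternatingMap_ext_cons fun y => ?_
    rw [ceD_curryLeft, ceD_curryLeft, ceLie_ceD br ρ hbr hρ hjac, ceD_sub, ih, sub_zero, sub_self]
    rfl

end ChevalleyEilenberg

/-! ### Compatibility of the differential with multiplication of functions -/

section Tensoriality

variable {L C : Type*} [AddCommGroup L] [Module ℝ L] [CommRing C] [Algebra ℝ C]

/-- An alternating map on a commutative algebra that is a derivation in each variable. -/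
def IsMultiDer {k : ℕ} (w : C [⋀^Fin k]→ₗ[ℝ] C) : Prop :=
  ∀ (v : Fin k → C) (i : Fin k) (f g : C),
    w (Function.update v i (f * g)) = f * w (Function.update v i g) + g * w (Function.update v i f)

theorem isMultiDer_of_cons {k : ℕ} {w : C [⋀^Fin (k + 1)]→ₗ[ℝ] C}
    (h : ∀ (f g : C) (v : Fin k → C),
      w (Fin.cons (f * g) v) = f * w (Fin.cons g v) + g * w (Fin.cons f v)) : IsMultiDer w := by
  intro v i f g
  simp only [map_update_eq_neg_one_pow w v i, h, smul_add, mul_smul_comm]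

theorem IsMultiDer.cons {k : ℕ} {w : C [⋀^Fin (k + 1)]→ₗ[ℝ] C} (h : IsMultiDer w)
    (f g : C) (v : Fin k → C) :
    w (Fin.cons (f * g) v) = f * w (Fin.cons g v) + g * w (Fin.cons f v) := by
  have := h (Fin.cons 0 v) 0 f g
  simpa only [Fin.update_cons_zero] using this

/-- The formula `d(f w) = f dw + df ∧ w`: the bracket terms are linear over functions, so the
correction comes only from the derivations `ρ`. -/
theorem ceSum_mul (br : L →ₗ[ℝ] L →ₗ[ℝ] L) (ρ : L →ₗ[ℝ] C →ₗ[ℝ] C)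
    (hder : ∀ x f g, ρ x (f * g) = f * ρ x g + g * ρ x f) {k : ℕ} (f : C)
    (w : (Fin k → L) → C) (v : Fin (k + 1) → L) :
    ceSum br ρ (fun u => f * w u) v = f * ceSum br ρ w v +
      ∑ i : Fin (k + 1), (-1 : ℝ) ^ (i : ℕ) • (ρ (v i) f * w (v ∘ i.succAbove)) := by
  simp only [ceSum, hder, smul_add, Finset.sum_add_distrib, mul_add, Finset.mul_sum,
    mul_smul_comm, mul_comm (w _) _]
  abel

/-- Ensures that `d_π` of a multivector field is again one. In the first argument, neither `L_{fg}
w` nor `d(i_{fg} w)` obeys the Leibniz rule; their defects are sums of `{f, v_i} w(…, g, …)` and of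
`{v_i, f} w(…, g, …)`, together with the same terms for `f` and `g` exchanged, and cancel by
skewness. -/
theorem isMultiDer_ceD (br : C →ₗ[ℝ] C →ₗ[ℝ] C) (hbr : ∀ x, br x x = 0)
    (hder : ∀ x f g, br x (f * g) = f * br x g + g * br x f) {k : ℕ}
    {w : C [⋀^Fin k]→ₗ[ℝ] C} (hw : IsMultiDer w) : IsMultiDer (ceD br br hbr w) := by
  have hskew : ∀ x y, br x y = -br y x := by
    intro x y
    have h := hbr (x + y)
    simp only [map_add, LinearMap.add_apply, hbr] at h
    rw [zero_add, add_zero] at h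
    exact eq_neg_of_add_eq_zero_right h
  have hder' : ∀ f g x, br (f * g) x = f * br g x + g * br f x := by
    intro f g x
    rw [hskew (f * g), hder, hskew x g, hskew x f]; ring
  refine isMultiDer_of_cons fun f g v => ?_
  rw [ceD_apply, ceD_apply, ceD_apply]
  cases k with
  | zero => simp [ceSum_zero, hder']
  | succ k =>
    have e1 : ⇑(w.curryLeft (f * g)) = (fun u => f * w.curryLeft g u) +
        fun u => g * w.curryLeft f u := by
      funext u; exact hw.cons f g u
    have e2 : ∀ (f g : C) (i : Fin (k + 1)), (-1 : ℝ) ^ (i : ℕ) •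
        (br (v i) f * w.curryLeft g (v ∘ i.succAbove)) =
        br (v i) f * w (Function.update v i g) := by
      intro f g i
      rw [map_update_eq_neg_one_pow, mul_smul_comm]; rfl
    rw [ceSum_cons, ceSum_cons, ceSum_cons, e1, ceSum_add, ceSum_mul br br hder,
      ceSum_mul br br hder]
    simp only [e2, ceLie_apply, hder', AlternatingMap.map_update_add, hw v _ _ _,
      Finset.sum_add_distrib, ← Finset.mul_sum, hskew _ (v _)]
    simp only [neg_mul, Finset.sum_neg_distrib]
    ring

variable [Module C L] [IsScalarTower ℝ C L]

/-- Restriction of scalars for alternating maps on modules over a real algebra. -/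
def restrictReal {k : ℕ} (w : L [⋀^Fin k]→ₗ[C] C) : L [⋀^Fin k]→ₗ[ℝ] C where
  toMultilinearMap := w.toMultilinearMap.restrictScalars ℝ
  map_eq_zero_of_eq' := w.map_eq_zero_of_eq'

theorem restrictReal_apply {k : ℕ} (w : L [⋀^Fin k]→ₗ[C] C) (v : Fin k → L) :
    restrictReal w v = w v := rfl

/-- In Cartan's formula the term `-ρ(y)(f) x` of the bracket `[f x, y]` cancels against the `df ∧ w`
correction of the differential of `f i_x w`. -/
theorem ceSum_cons_smul (br : L →ₗ[ℝ] L →ₗ[ℝ] L) (ρ : L →ₗ[ℝ] C →ₗ[ℝ] C)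
    (hder : ∀ x f g, ρ x (f * g) = f * ρ x g + g * ρ x f)
    (hρ : ∀ (f : C) x g, ρ (f • x) g = f * ρ x g)
    (hbr : ∀ (f : C) x y, br (f • x) y = f • br x y - ρ y f • x) {k : ℕ}
    (w : L [⋀^Fin k]→ₗ[C] C) (f : C) (x : L) (v : Fin k → L) :
    ceSum br ρ w (Fin.cons (f • x) v) = f * ceSum br ρ w (Fin.cons x v) := by
  change ceSum br ρ (restrictReal w) _ = f * ceSum br ρ (restrictReal w) _
  cases k with
  | zero => simp [ceSum_zero, hρ]
  | succ k =>
    have e1 : ⇑((restrictReal w).curryLeft (f • x)) =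
        fun u => f * (restrictReal w).curryLeft x u := by
      funext u
      have h := w.map_update_smul (Fin.cons 0 u) 0 f x
      simp only [Fin.update_cons_zero] at h
      exact h
    have e2 : ∀ i : Fin (k + 1), (-1 : ℝ) ^ (i : ℕ) •
        (ρ (v i) f * (restrictReal w).curryLeft x (v ∘ i.succAbove)) =
        ρ (v i) f * w (Function.update v i x) := by
      intro i
      rw [← restrictReal_apply, map_update_eq_neg_one_pow, mul_smul_comm]; rfl
    rw [ceSum_cons, ceSum_cons, e1, ceSum_mul br ρ hder]
    simp only [e2, ceLie_apply, hρ, hbr, restrictReal_apply, AlternatingMap.map_update_sub,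
      AlternatingMap.map_update_smul, smul_eq_mul, Finset.sum_sub_distrib, ← Finset.mul_sum]
    ring

/-- The Chevalley–Eilenberg differential of a Lie–Rinehart algebra. -/
def rinehartD (br : L →ₗ[ℝ] L →ₗ[ℝ] L) (ρ : L →ₗ[ℝ] C →ₗ[ℝ] C)
    (hder : ∀ x f g, ρ x (f * g) = f * ρ x g + g * ρ x f)
    (hρ : ∀ (f : C) x g, ρ (f • x) g = f * ρ x g)
    (hbr : ∀ (f : C) x y, br (f • x) y = f • br x y - ρ y f • x) (hbr0 : ∀ x, br x x = 0)
    {k : ℕ} (w : L [⋀^Fin k]→ₗ[C] C) : L [⋀^Fin (k + 1)]→ₗ[C] C where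
  toFun := ceSum br ρ w
  map_update_add' := fun {_} v i a b => by
    convert ceSum_update_add br ρ (restrictReal w) v i a b <;> rfl
  map_update_smul' := fun {_} v i f a => by
    have hd : ∀ (i : DecidableEq (Fin (k + 1))), i = instDecidableEqFin (k + 1) := fun i =>
      Subsingleton.elim _ _
    cases hd ‹_›
    change ceD br ρ hbr0 (restrictReal w) _ = f • ceD br ρ hbr0 (restrictReal w) _
    rw [map_update_eq_neg_one_pow, map_update_eq_neg_one_pow, smul_eq_mul, mul_smul_comm]
    exact congrArg _ (ceSum_cons_smul br ρ hder hρ hbr w f a _)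
  map_eq_zero_of_eq' := fun v i j hv hij =>
    ceSum_eq_zero_of_eq br ρ hbr0 (restrictReal w) v i j hv hij

end Tensoriality

/-! ### The Pfaffian polynomial -/

section Pfaffian

open Matrix Equiv

variable {n : ℕ} {R S : Type*} [CommRing R] [CommRing S]

/-- The indices `0, …, 2n - 1` in consecutive pairs. -/
def pairIdx (n : ℕ) : Fin n × Fin 2 ≃ Fin (2 * n) :=
  finProdFinEquiv.trans (finCongr (mul_comm n 2))

theorem prod_pairIdx {N : Type*} [CommMonoid N] (g : Fin (2 * n) → N) :
    ∏ j, g j = ∏ i, (g (pairIdx n (i, 0)) * g (pairIdx n (i, 1))) := by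
  rw [← (pairIdx n).prod_comp g, Fintype.prod_prod_type]
  simp only [Fin.prod_univ_two]

/-- The sum `∑_σ sgn(σ) B_{σ(0)σ(1)} B_{σ(2)σ(3)} ⋯`, a multiple of the Pfaffian of `B`. -/
def pfaff (B : Matrix (Fin (2 * n)) (Fin (2 * n)) R) : R :=
  ∑ σ : Perm (Fin (2 * n)), ((Perm.sign σ : ℤ) : R) *
    ∏ i : Fin n, B (σ (pairIdx n (i, 0))) (σ (pairIdx n (i, 1)))

theorem map_pfaff (φ : R →+* S) (B : Matrix (Fin (2 * n)) (Fin (2 * n)) R) :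
    φ (pfaff B) = pfaff (B.map φ) := by
  simp [pfaff, map_sum, map_prod, Matrix.map_apply]

/-- Tuples of length `2n` as tuples of pairs. -/
def tuplePairs (n : ℕ) (X : Type*) : (Fin n → Fin 2 → X) ≃ (Fin (2 * n) → X) :=
  (Equiv.curry (Fin n) (Fin 2) X).symm.trans ((pairIdx n).arrowCongr (Equiv.refl X))

theorem tuplePairs_apply {X : Type*} (p : Fin n → Fin 2 → X) (i : Fin n) (b : Fin 2) :
    tuplePairs n X p (pairIdx n (i, b)) = p i b := by
  simp [tuplePairs, Equiv.arrowCongr]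

/-- If `κ` repeats a value, the submatrix has two equal columns; if `κ` is a permutation, its sign
comes out of the determinant. The identity serves both for the behaviour under congruence and, with
`T = 1`, for evaluating powers of a bivector. -/
theorem sum_det_submatrix (T B : Matrix (Fin (2 * n)) (Fin (2 * n)) R) :
    ∑ κ : Fin (2 * n) → Fin (2 * n), (T.submatrix id κ).det *
      ∏ i : Fin n, B (κ (pairIdx n (i, 0))) (κ (pairIdx n (i, 1))) = T.det * pfaff B := by
  rw [pfaff, Finset.mul_sum]
  rw [← Finset.sum_subset (Finset.subset_univ (Finset.univ.map
    ⟨fun σ : Perm (Fin (2 * n)) => (σ : Fin (2 * n) → Fin (2 * n)), DFunLike.coe_injective⟩))]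
  · rw [Finset.sum_map]
    refine Finset.sum_congr rfl fun σ _ => ?_
    simp only [Function.Embedding.coeFn_mk]
    rw [Matrix.det_permute']
    ring
  · intro κ _ hκ
    have : ¬ Function.Injective κ := by
      intro hi
      exact hκ (Finset.mem_map.2 ⟨Equiv.ofBijective κ (Finite.injective_iff_bijective.1 hi),
        Finset.mem_univ _, rfl⟩)
    simp only [Function.Injective, not_forall] at this
    obtain ⟨i, j, hij, hne⟩ := this
    rw [Matrix.det_zero_of_column_eq hne (by intro l; simp [hij]), zero_mul]

/-- After expansion of all entries of `T B Tᵀ`, summing over `σ` first produces determinants of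
column selections of `T`. -/
theorem pfaff_conj (T B : Matrix (Fin (2 * n)) (Fin (2 * n)) R) :
    pfaff (T * B * Tᵀ) = T.det * pfaff B := by
  have h1 : ∀ k l, (T * B * Tᵀ) k l = ∑ q : Fin 2 → Fin (2 * n),
      T k (q 0) * B (q 0) (q 1) * T l (q 1) := by
    intro k l
    rw [← (finTwoArrowEquiv _).symm.sum_comp, Fintype.sum_prod_type, Finset.sum_comm]
    simp [Matrix.mul_apply, Finset.sum_mul, finTwoArrowEquiv]
  have h2 : ∀ σ : Perm (Fin (2 * n)), ∏ i : Fin n,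
      (T * B * Tᵀ) (σ (pairIdx n (i, 0))) (σ (pairIdx n (i, 1))) =
      ∑ κ : Fin (2 * n) → Fin (2 * n), (∏ j, T (σ j) (κ j)) *
        ∏ i : Fin n, B (κ (pairIdx n (i, 0))) (κ (pairIdx n (i, 1))) := by
    intro σ
    simp only [h1]
    rw [Finset.prod_univ_sum, ← (tuplePairs n _).sum_comp]
    simp only [Fintype.piFinset_univ]
    refine Finset.sum_congr rfl fun p _ => ?_
    rw [prod_pairIdx, ← Finset.prod_mul_distrib]
    simp only [tuplePairs_apply]
    exact Finset.prod_congr rfl fun i _ => by ring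
  have h3 : ∀ κ : Fin (2 * n) → Fin (2 * n),
      ∑ σ : Perm (Fin (2 * n)), ((Perm.sign σ : ℤ) : R) * ∏ j, T (σ j) (κ j) =
      (T.submatrix id κ).det := by
    intro κ
    rw [Matrix.det_apply']
    simp
  rw [← sum_det_submatrix]
  simp only [pfaff, h2, Finset.mul_sum]
  rw [Finset.sum_comm]
  simp only [← mul_assoc, ← Finset.sum_mul, h3]

theorem det_one_updateRow {m : ℕ} (i : Fin m) (a : Fin m → R) :
    ((1 : Matrix (Fin m) (Fin m) R).updateRow i a).det = a i := by
  have := Matrix.det_updateRow_sum (1 : Matrix (Fin m) (Fin m) R) i a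
  rw [Matrix.det_one, smul_eq_mul, mul_one] at this
  have ea : ∑ k, a k • (1 : Matrix (Fin m) (Fin m) R) k = a := by
    funext j
    simp [Finset.sum_apply, Matrix.one_apply]
  rwa [ea] at this

/-- A kernel vector `a` with `a i ≠ 0` can replace the `i`-th basis vector, a change of basis `T` of
determinant `a i`. In the new basis the row and column `i` of the form vanish, so it equals the
congruence of `B` by the singular projection `D`, whence `a i * pfaff B = 0`. The relation between
the determinant and the square of the Pfaffian is not needed. -/
theorem det_ne_zero_of_pfaff_ne_zero {K : Type*} [Field K]
    {B : Matrix (Fin (2 * n)) (Fin (2 * n)) K} (hB : Bᵀ = -B) (h : pfaff B ≠ 0) :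
    B.det ≠ 0 := by
  intro hd
  obtain ⟨a, ha, hab⟩ := Matrix.exists_vecMul_eq_zero_iff.2 hd
  obtain ⟨i, hi⟩ := Function.ne_iff.1 ha
  have hba : B *ᵥ a = 0 := by
    have : a ᵥ* Bᵀ = 0 := by rw [hB, Matrix.vecMul_neg, hab, neg_zero]
    rwa [Matrix.vecMul_transpose] at this
  set T := (1 : Matrix (Fin (2 * n)) (Fin (2 * n)) K).updateRow i a
  have hT : T.det = a i := det_one_updateRow i a
  let D : Matrix (Fin (2 * n)) (Fin (2 * n)) K := diagonal fun j => if j = i then 0 else 1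
  have hD : D.det = 0 := by
    rw [Matrix.det_diagonal]
    exact Finset.prod_eq_zero (Finset.mem_univ i) (by simp)
  have key : T * B * Tᵀ = D * B * Dᵀ := by
    ext k l
    have e : ∀ k l, (T * B * Tᵀ) k l = T.row k ⬝ᵥ (B *ᵥ T.row l) := by
      intro k l
      rw [Matrix.mul_assoc, Matrix.mul_apply]
      simp [dotProduct, Matrix.mul_apply, mulVec]
    rw [e]
    have hr : ∀ k, T.row k = if k = i then a else Pi.single k 1 := by
      intro k; funext l
      by_cases hk : k = i
      · subst hk; simp [T, Matrix.row]
      · simp [T, Matrix.row, hk, Matrix.one_apply, Pi.single_apply, eq_comm]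
    simp only [D, diagonal_transpose, mul_diagonal, diagonal_mul, hr]
    by_cases hl : l = i
    · simp [hl, hba]
    · by_cases hk : k = i
      · simp only [hk, if_true, dotProduct_mulVec, hab]; simp
      · simp [hk, hl]
  have := pfaff_conj T B
  rw [key, pfaff_conj, hD, hT, zero_mul] at this
  exact (mul_ne_zero hi h) this.symm

/-- The derivative of `pfaff` in the direction `A P + P Aᵀ` is `tr(A) pfaff P`. -/
theorem snd_pfaff (φ : R →+* DualNumber ℝ) (P : Matrix (Fin (2 * n)) (Fin (2 * n)) R)
    (A P₀ : Matrix (Fin (2 * n)) (Fin (2 * n)) ℝ)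
    (h₀ : ∀ i j, TrivSqZeroExt.fst (φ (P i j)) = P₀ i j)
    (h₁ : ∀ i j, TrivSqZeroExt.snd (φ (P i j)) = (A * P₀ + P₀ * Aᵀ) i j) :
    TrivSqZeroExt.snd (φ (pfaff P)) = A.trace * pfaff P₀ := by
  let ι : ℝ →+* DualNumber ℝ := TrivSqZeroExt.inlHom ℝ ℝ
  have hε : (DualNumber.eps : DualNumber ℝ) * DualNumber.eps = 0 := DualNumber.eps_mul_eps
  -- Since `ε² = 0`, the matrix `P₀ + ε (A P₀ + P₀ Aᵀ)` is the congruence of `P₀` by `1 + ε A`,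
  -- whose determinant is `1 + ε tr A`.
  let T : Matrix (Fin (2 * n)) (Fin (2 * n)) (DualNumber ℝ) :=
    1 + (DualNumber.eps : DualNumber ℝ) • A.map ι
  have hT : T * P₀.map ι * Tᵀ = P₀.map ι +
      (DualNumber.eps : DualNumber ℝ) • (A * P₀ + P₀ * Aᵀ).map ι := by
    have e1 : (A * P₀ + P₀ * Aᵀ).map ι = A.map ι * P₀.map ι + P₀.map ι * (A.map ι)ᵀ := by
      rw [Matrix.map_add _ (map_add ι), Matrix.map_mul, Matrix.map_mul, Matrix.transpose_map]
    rw [e1]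
    simp only [T, Matrix.transpose_add, Matrix.transpose_one, Matrix.transpose_smul, add_mul,
      mul_add, one_mul, mul_one, Matrix.smul_mul, Matrix.mul_smul, smul_smul, hε, zero_smul,
      smul_add, add_zero]
    abel
  have hP : P.map φ = T * P₀.map ι * Tᵀ := by
    rw [hT]
    ext i j
    · simp [h₀, ι]
    · simp [h₁, ι]
  rw [map_pfaff, hP, pfaff_conj, ← map_pfaff]
  have hd : T.det = 1 + ι A.trace * DualNumber.eps := by
    rw [Matrix.det_one_add_smul, pow_two, hε, mul_zero, add_zero]
    congr 2
    exact (AddMonoidHom.map_trace ι.toAddMonoidHom A).symm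
  rw [hd]
  simp [ι]

end Pfaffian

/-! ### Hadamard's lemma -/

section Hadamard

/-- Differentiation under the integral sign, with a bound from compactness of a closed ball times
`[0, 1]`. The target space is quantified inside the induction because the derivative takes values in
`E →L[ℝ] F`. -/
theorem contDiff_parametric_integral_nat {E : Type} [NormedAddCommGroup E] [NormedSpace ℝ E]
    [FiniteDimensional ℝ E] (m : ℕ) : ∀ {F : Type} [NormedAddCommGroup F] [NormedSpace ℝ F]
    [CompleteSpace F] {G : E × ℝ → F}, ContDiff ℝ m G →
    ContDiff ℝ m (fun x => ∫ t in (0 : ℝ)..1, G (x, t)) := by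
  induction m with
  | zero =>
    intro F _ _ _ G hG
    exact contDiff_zero.2 (intervalIntegral.continuous_parametric_intervalIntegral_of_continuous'
      (f := fun x t => G (x, t)) hG.continuous 0 1)
  | succ m ih =>
    intro F _ _ _ G hG
    have hd : Differentiable ℝ G := hG.differentiable (by simp)
    have hG' : ContDiff ℝ m (fderiv ℝ G) := hG.fderiv_right (by norm_cast)
    let G' : E × ℝ → E →L[ℝ] F := fun p => (fderiv ℝ G p).comp (ContinuousLinearMap.inl ℝ E ℝ)
    have hG'' : ContDiff ℝ m G' := hG'.clm_comp contDiff_const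
    have hder : ∀ x t, HasFDerivAt (fun x => G (x, t)) (G' (x, t)) x := fun x t =>
      (hd (x, t)).hasFDerivAt.comp x (hasFDerivAt_prodMk_left x t)
    push_cast
    refine contDiff_succ_iff_hasFDerivAt.2 ⟨fun x => ∫ t in (0 : ℝ)..1, G' (x, t), ih hG'', ?_⟩
    intro x
    obtain ⟨b, hb⟩ := ((isCompact_closedBall x 1).prod
      (isCompact_Icc (a := (0 : ℝ)) (b := 1))).exists_bound_of_continuousOn
      hG''.continuous.continuousOn
    refine intervalIntegral.hasFDerivAt_integral_of_dominated_of_fderiv_le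
      (F := fun x t => G (x, t)) (F' := fun x t => G' (x, t)) (bound := fun _ => b)
      (Metric.closedBall_mem_nhds x one_pos) ?_ ?_ ?_ ?_ ?_ ?_
    · refine Filter.Eventually.of_forall fun y => ?_
      exact (hG.continuous.comp (by fun_prop : Continuous fun t : ℝ => (y, t))).aestronglyMeasurable
    · exact (hG.continuous.comp
        (by fun_prop : Continuous fun t : ℝ => (x, t))).intervalIntegrable _ _
    · exact (hG''.continuous.comp
        (by fun_prop : Continuous fun t : ℝ => (x, t))).aestronglyMeasurable
    · refine Filter.Eventually.of_forall fun t ht y hy => hb (y, t) ⟨hy, ?_⟩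
      rw [Set.uIoc_of_le zero_le_one] at ht
      exact ⟨ht.1.le, ht.2⟩
    · exact intervalIntegrable_const
    · exact Filter.Eventually.of_forall fun t _ y _ => hder y t

theorem contDiff_parametric_integral {E F : Type} [NormedAddCommGroup E] [NormedSpace ℝ E]
    [FiniteDimensional ℝ E] [NormedAddCommGroup F] [NormedSpace ℝ F] [CompleteSpace F]
    {G : E × ℝ → F} (hG : ContDiff ℝ ∞ G) :
    ContDiff ℝ ∞ (fun x => ∫ t in (0 : ℝ)..1, G (x, t)) :=
  contDiff_infty.2 fun m => contDiff_parametric_integral_nat m (contDiff_infty.1 hG m)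

/-- Hadamard's lemma along the fibers of a linear map `A`. -/
theorem hadamard {E : Type} [NormedAddCommGroup E] [NormedSpace ℝ E] [FiniteDimensional ℝ E]
    {f : E → ℝ} (hf : ContDiff ℝ ∞ f) (A : E →L[ℝ] E) :
    ∃ c : E → E →L[ℝ] ℝ, ContDiff ℝ ∞ c ∧ ∀ x, f x = f (A x) + c x (x - A x) := by
  have hf' : ContDiff ℝ ∞ (fderiv ℝ f) := hf.fderiv_right (by simp)
  have hG : ContDiff ℝ ∞ (fun p : E × ℝ => fderiv ℝ f (A p.1 + p.2 • (p.1 - A p.1))) :=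
    hf'.comp (by fun_prop)
  -- The derivative is averaged over the segment from `A x` to `x`. Later `A = 0` gives the
  -- expansion at a point, and the projection along a coordinate axis gives divisibility by that
  -- coordinate.
  refine ⟨fun x => ∫ t in (0 : ℝ)..1, fderiv ℝ f (A x + t • (x - A x)),
    contDiff_parametric_integral hG, fun x => ?_⟩
  have hcont : Continuous fun t : ℝ => fderiv ℝ f (A x + t • (x - A x)) :=
    hG.continuous.comp (by fun_prop : Continuous fun t : ℝ => (x, t))
  rw [ContinuousLinearMap.intervalIntegral_apply (hcont.intervalIntegrable _ _)]
  have hder : ∀ t ∈ Set.uIcc (0 : ℝ) 1, HasDerivAt (fun t : ℝ => f (A x + t • (x - A x)))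
      (fderiv ℝ f (A x + t • (x - A x)) (x - A x)) t := by
    intro t _
    refine ((hf.differentiable (by simp)) _).hasFDerivAt.comp_hasDerivAt t ?_
    simpa using ((hasDerivAt_id t).smul_const (x - A x)).const_add (A x)
  have hFTC := intervalIntegral.integral_eq_sub_of_hasDerivAt hder
    ((hcont.clm_apply continuous_const).intervalIntegrable _ _)
  rw [hFTC]
  simp

end Hadamard

/-! ### Extension of germs to global smooth functions -/

section Extension

variable {d : ℕ} {M : Type*} [TopologicalSpace M] [T2Space M]
  [ChartedSpace (EuclideanSpace ℝ (Fin d)) M] [IsManifold (𝓡 d) ∞ M]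

/-- A smooth function near a point agrees near the point with a global smooth function. -/
theorem exists_smoothFun_eventuallyEq {p : M} {f : M → ℝ}
    (hf : ∀ᶠ q in nhds p, ContMDiffAt (𝓡 d) 𝓘(ℝ, ℝ) ∞ f q) :
    ∃ F : SmoothFun d M, F =ᶠ[nhds p] f := by
  obtain ⟨χ, -, hχ⟩ := (SmoothBumpFunction.nhds_basis_tsupport (I := 𝓡 d) p).mem_iff.1 hf
  refine ⟨⟨fun q => χ q * f q, ?_⟩, ?_⟩
  · refine contMDiff_of_tsupport fun x hx => ?_
    have : x ∈ tsupport χ := tsupport_smul_subset_left χ f hx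
    exact χ.contMDiffAt.mul (hχ this)
  · filter_upwards [χ.eventuallyEq_one] with q hq
    change χ q * f q = f q
    rw [hq, Pi.one_apply, one_mul]

/-- A smooth function that is `1` near `p` and vanishes outside a given neighborhood. -/
theorem exists_bump {p : M} {U : Set M} (hU : U ∈ nhds p) :
    ∃ χ : SmoothFun d M, (∀ᶠ q in nhds p, χ q = 1) ∧ (∀ q, χ q ≠ 0 → q ∈ U) ∧
      tsupport χ ⊆ U := by
  obtain ⟨χ, -, hχ⟩ := (SmoothBumpFunction.nhds_basis_tsupport (I := 𝓡 d) p).mem_iff.1 hU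
  exact ⟨⟨χ, χ.contMDiff⟩, χ.eventuallyEq_one, fun q hq => hχ (subset_tsupport _ hq), hχ⟩

theorem exists_contDiff_eventuallyEq {p : EuclideanSpace ℝ (Fin d)}
    {f : EuclideanSpace ℝ (Fin d) → ℝ} (hf : ∀ᶠ q in nhds p, ContDiffAt ℝ ∞ f q) :
    ∃ F : EuclideanSpace ℝ (Fin d) → ℝ, ContDiff ℝ ∞ F ∧ F =ᶠ[nhds p] f := by
  obtain ⟨F, hF⟩ := exists_smoothFun_eventuallyEq (d := d) (p := p) (f := f)
    (hf.mono fun q hq => hq.contMDiffAt)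
  exact ⟨F, F.contMDiff.contDiff, hF⟩

end Extension

/-! ### Local coordinates -/

theorem exists_dual_frame {d : ℕ} {V : Type*} [AddCommGroup V] [Module ℝ V]
    [FiniteDimensional ℝ V] (hV : Module.finrank ℝ V = d) {f : Fin d → Module.Dual ℝ V}
    (hf : LinearIndependent ℝ f) :
    ∃ e : Fin d → V, (∀ i j, f i (e j) = if i = j then 1 else 0) ∧ ∀ v, v = ∑ i, f i v • e i := by
  have hspan : Submodule.span ℝ (Set.range f) = ⊤ :=
    hf.span_eq_top_of_card_eq_finrank' (by rw [Subspace.dual_finrank_eq, hV, Fintype.card_fin])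
  let L : V →ₗ[ℝ] (Fin d → ℝ) := LinearMap.pi f
  have hL : Function.Injective L := by
    rw [← LinearMap.ker_eq_bot, LinearMap.ker_eq_bot']
    intro v hv
    refine (Module.forall_dual_apply_eq_zero_iff ℝ v).1 fun a => ?_
    have ha : a ∈ Submodule.span ℝ (Set.range f) := hspan ▸ Submodule.mem_top
    induction ha using Submodule.span_induction with
    | mem x hx => obtain ⟨i, rfl⟩ := hx; exact congrFun hv i
    | zero => simp
    | add x y _ _ hx hy => simp [hx, hy]
    | smul c x _ hx => simp [hx]
  let e := LinearEquiv.ofInjectiveOfFinrankEq L hL (by simp [hV])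
  have he : ∀ v i, e v i = f i v := fun v i => rfl
  refine ⟨fun j => e.symm (Pi.single j 1), fun i j => ?_, fun v => e.injective ?_⟩
  · rw [← he, e.apply_symm_apply, Pi.single_apply]
  · rw [map_sum]
    funext j
    simp [he v, Finset.sum_apply, Pi.single_apply]

section Coordinates

set_option linter.unusedSectionVars false

variable {d : ℕ} {M : Type*} [TopologicalSpace M]
  [ChartedSpace (EuclideanSpace ℝ (Fin d)) M] [IsManifold (𝓡 d) ∞ M]

local notation "𝔼" => EuclideanSpace ℝ (Fin d)

theorem mdifferentiableAt_smoothFun (f : SmoothFun d M) (x : M) :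
    MDifferentiableAt (𝓡 d) 𝓘(ℝ, ℝ) f x := (f.contMDiff x).mdifferentiableAt (by simp)

/-- The functions `y₁, …, y_d` have independent differentials at `q`. -/
def IsCoord (y : Fin d → SmoothFun d M) (q : M) : Prop :=
  LinearIndependent ℝ fun i => (mvfderiv (𝓡 d) (y i) q : TangentSpace (𝓡 d) q →ₗ[ℝ] ℝ)

instance (q : M) : FiniteDimensional ℝ (TangentSpace (𝓡 d) q) :=
  inferInstanceAs (FiniteDimensional ℝ (EuclideanSpace ℝ (Fin d)))

theorem finrank_tangentSpace (q : M) : Module.finrank ℝ (TangentSpace (𝓡 d) q) = d := by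
  change Module.finrank ℝ (EuclideanSpace ℝ (Fin d)) = d
  simp

theorem IsCoord.exists_frame {y : Fin d → SmoothFun d M} {q : M} (h : IsCoord y q) :
    ∃ e : Fin d → TangentSpace (𝓡 d) q,
      (∀ i j, mvfderiv (𝓡 d) (y i) q (e j) = if i = j then 1 else 0) ∧
      ∀ v, v = ∑ i, mvfderiv (𝓡 d) (y i) q v • e i :=
  exists_dual_frame (finrank_tangentSpace q) h

open Classical in
/-- The coordinate vector fields `∂/∂y_i`. -/
def coordFrame (y : Fin d → SmoothFun d M) (q : M) : Fin d → TangentSpace (𝓡 d) q :=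
  if h : IsCoord y q then h.exists_frame.choose else 0

theorem IsCoord.mvfderiv_coordFrame {y : Fin d → SmoothFun d M} {q : M} (h : IsCoord y q)
    (i j : Fin d) : mvfderiv (𝓡 d) (y i) q (coordFrame y q j) = if i = j then 1 else 0 := by
  rw [coordFrame, dif_pos h]
  exact h.exists_frame.choose_spec.1 i j

theorem IsCoord.eq_sum_coordFrame {y : Fin d → SmoothFun d M} {q : M} (h : IsCoord y q)
    (v : TangentSpace (𝓡 d) q) : v = ∑ i, mvfderiv (𝓡 d) (y i) q v • coordFrame y q i := by
  rw [coordFrame, dif_pos h]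
  exact h.exists_frame.choose_spec.2 v

theorem IsCoord.of_dual {y : Fin d → SmoothFun d M} {q : M} (e : Fin d → TangentSpace (𝓡 d) q)
    (he : ∀ i j, mvfderiv (𝓡 d) (y i) q (e j) = if i = j then 1 else 0) : IsCoord y q := by
  refine Fintype.linearIndependent_iff.2 fun c hc j => ?_
  have := LinearMap.congr_fun hc (e j)
  simpa [LinearMap.sum_apply, he] using this

/-- The partial derivative `∂f/∂y_i`. -/
def pd (y : Fin d → SmoothFun d M) (i : Fin d) (f : M → ℝ) (q : M) : ℝ :=
  mvfderiv (𝓡 d) f q (coordFrame y q i)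

theorem IsCoord.mvfderiv_eq {y : Fin d → SmoothFun d M} {q : M} (h : IsCoord y q) (f : M → ℝ) :
    mvfderiv (𝓡 d) f q = ∑ i, pd y i f q • mvfderiv (𝓡 d) (y i) q := by
  ext v
  have h2 := congrArg (mvfderiv (𝓡 d) f q) (h.eq_sum_coordFrame v)
  rw [map_sum] at h2
  refine h2.trans ?_
  simp only [map_smul, smul_eq_mul, sum_apply, smul_apply,
    pd]
  exact Finset.sum_congr rfl fun i _ => mul_comm _ _

theorem IsCoord.pd_coord {y : Fin d → SmoothFun d M} {q : M} (h : IsCoord y q) (i j : Fin d) :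
    pd y i (y j) q = if j = i then 1 else 0 := h.mvfderiv_coordFrame j i

/-- The map to Euclidean space with components `y₁, …, y_d`. -/
def coordMap (y : Fin d → SmoothFun d M) (q : M) : 𝔼 := WithLp.toLp 2 fun i => y i q

theorem coordMap_apply (y : Fin d → SmoothFun d M) (q : M) (i : Fin d) :
    coordMap y q i = y i q := rfl

theorem contMDiff_coordMap (y : Fin d → SmoothFun d M) :
    ContMDiff (𝓡 d) 𝓘(ℝ, 𝔼) ∞ (coordMap y) := by
  have h : ContMDiff (𝓡 d) 𝓘(ℝ, Fin d → ℝ) ∞ fun q i => y i q :=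
    contMDiff_pi_space.2 fun i => (y i).contMDiff
  exact ((EuclideanSpace.equiv (Fin d) ℝ).symm.contDiff (n := ∞)).contMDiff.comp h

theorem mfderiv_coordMap_apply (y : Fin d → SmoothFun d M) (q : M) (v : TangentSpace (𝓡 d) q)
    (i : Fin d) : WithLp.ofLp (p := 2) (V := Fin d → ℝ) (mfderiv (𝓡 d) 𝓘(ℝ, 𝔼) (coordMap y) q v) i =
      mvfderiv (𝓡 d) (y i) q v := by
  have hc : MDifferentiableAt (𝓡 d) 𝓘(ℝ, 𝔼) (coordMap y) q :=
    ((contMDiff_coordMap y) q).mdifferentiableAt (by simp)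
  have hp : MDifferentiableAt 𝓘(ℝ, 𝔼) 𝓘(ℝ, ℝ) (EuclideanSpace.proj (𝕜 := ℝ) i) (coordMap y q) :=
    (EuclideanSpace.proj (𝕜 := ℝ) i).differentiableAt.mdifferentiableAt
  have h := mfderiv_comp q hp hc
  have e : (EuclideanSpace.proj (𝕜 := ℝ) i : 𝔼 → ℝ) ∘ coordMap y = y i := rfl
  rw [e, mfderiv_eq_fderiv, ContinuousLinearMap.fderiv] at h
  exact (DFunLike.congr_fun h v).symm

/-- The inverse function theorem for `y` read in a chart. Smoothness of the inverse is claimed on a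
neighbourhood, since derivatives at nearby points are compared later. -/
theorem IsCoord.exists_localInverse {y : Fin d → SmoothFun d M} {x₀ : M} (h : IsCoord y x₀) :
    ∃ g : 𝔼 → M, (∀ᶠ q in nhds x₀, g (coordMap y q) = q) ∧
      ∀ᶠ u in nhds (coordMap y x₀), coordMap y (g u) = u ∧
        ContMDiffAt 𝓘(ℝ, 𝔼) (𝓡 d) ∞ g u := by
  set ψ := extChartAt (𝓡 d) x₀ with hψ
  set a := ψ x₀ with ha
  have hr : Set.range (𝓡 d) = Set.univ := (𝓡 d).range_eq_univ
  have hsym : ∀ b ∈ ψ.target, ContMDiffAt 𝓘(ℝ, 𝔼) (𝓡 d) ∞ ψ.symm b := fun b hb =>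
    (contMDiffOn_extChartAt_symm x₀).contMDiffAt (extChartAt_target_mem_nhds' hb)
  let F : 𝔼 → 𝔼 := coordMap y ∘ ψ.symm
  have hF : ∀ b ∈ ψ.target, ContDiffAt ℝ ∞ F b := fun b hb =>
    (((contMDiff_coordMap y) _).comp b (hsym b hb)).contDiffAt
  have hat : a ∈ ψ.target := mem_extChartAt_target x₀
  have hax : ψ.symm a = x₀ := extChartAt_to_inv x₀
  have hinj : Function.Injective (fderiv ℝ F a) := by
    have h1 := isInvertible_mfderivWithin_extChartAt_symm (I := 𝓡 d) hat
    rw [hr, mfderivWithin_univ] at h1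
    have h2 := mfderiv_comp a (((contMDiff_coordMap y) (ψ.symm a)).mdifferentiableAt (by simp))
      ((hsym a hat).mdifferentiableAt (by simp))
    rw [mfderiv_eq_fderiv] at h2
    change Function.Injective (fderiv ℝ (coordMap y ∘ ψ.symm) a)
    rw [h2]
    refine Function.Injective.comp (g := mfderiv (𝓡 d) 𝓘(ℝ, 𝔼) (coordMap y) (ψ.symm a)) ?_
      h1.injective
    rw [← hax] at h
    refine (injective_iff_map_eq_zero _).2 fun v hv => ?_
    rw [h.eq_sum_coordFrame v]
    refine Finset.sum_eq_zero fun i _ => ?_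
    rw [← mfderiv_coordMap_apply, hv]
    exact zero_smul _ _
  let F' : 𝔼 ≃L[ℝ] 𝔼 :=
    (LinearEquiv.ofInjectiveEndo (fderiv ℝ F a : 𝔼 →ₗ[ℝ] 𝔼) hinj).toContinuousLinearEquiv
  have hF' : (F' : 𝔼 →L[ℝ] 𝔼) = fderiv ℝ F a := by ext v; rfl
  have hFd : HasFDerivAt F (F' : 𝔼 →L[ℝ] 𝔼) a := by
    rw [hF']; exact ((hF a hat).differentiableAt (by simp)).hasFDerivAt
  let Φ := (hF a hat).toOpenPartialHomeomorph F hFd (by simp)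
  have hΦs : a ∈ Φ.source := (hF a hat).mem_toOpenPartialHomeomorph_source hFd (by simp)
  have hΦ : ∀ b, Φ b = F b := fun b => rfl
  have hFa : F a = coordMap y x₀ := congrArg (coordMap y) hax
  have hΦt : coordMap y x₀ ∈ Φ.target := by rw [← hFa]; exact Φ.map_source hΦs
  have hΦa : Φ.symm (coordMap y x₀) = a := by rw [← hFa]; exact Φ.left_inv hΦs
  refine ⟨fun u => ψ.symm (Φ.symm u), ?_, ?_⟩
  · have h1 : ∀ᶠ q in nhds x₀, ψ q ∈ Φ.source :=
      (continuousAt_extChartAt x₀).eventually (Φ.open_source.mem_nhds hΦs)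
    filter_upwards [h1, extChartAt_source_mem_nhds (I := 𝓡 d) x₀] with q hq hq'
    have e : coordMap y q = Φ (ψ q) := by
      rw [hΦ]; exact congrArg (coordMap y) (ψ.left_inv hq').symm
    rw [e, Φ.left_inv hq, ψ.left_inv hq']
  · have hc : ContinuousAt Φ.symm (coordMap y x₀) := Φ.continuousAt_symm hΦt
    -- Smoothness of the inverse at nearby points requires an invertible derivative there, which
    -- holds because invertible operators form an open set.
    have hopen : ∀ᶠ b in nhds a, b ∈ ψ.target ∧
        fderiv ℝ F b ∈ Set.range ((↑) : (𝔼 ≃L[ℝ] 𝔼) → 𝔼 →L[ℝ] 𝔼) := by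
      have hcf : ContinuousAt (fderiv ℝ F) a :=
        ((hF a hat).fderiv_right (m := 0) (by simp)).continuousAt
      refine Filter.Eventually.and (extChartAt_target_mem_nhds (I := 𝓡 d) x₀) ?_
      refine hcf.eventually ?_
      rw [← hF']
      exact ContinuousLinearEquiv.nhds F'
    rw [← hΦa] at hopen
    filter_upwards [hc.eventually hopen, Φ.open_target.mem_nhds hΦt] with u hu hut
    refine ⟨?_, ?_⟩
    · exact Φ.right_inv hut
    · obtain ⟨hu1, F'', hF''⟩ := hu
      refine (hsym _ hu1).comp u (ContDiffAt.contMDiffAt ?_)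
      refine Φ.contDiffAt_symm hut (f₀' := F'') ?_ (hF _ hu1)
      rw [hF'']
      exact ((hF _ hu1).differentiableAt (by simp)).hasFDerivAt

/-- Near `x₀` the derivative of the local inverse sends the standard basis to a frame dual to the
differentials of `y`. -/
theorem IsCoord.eventually {y : Fin d → SmoothFun d M} {x₀ : M} (h : IsCoord y x₀) :
    ∀ᶠ q in nhds x₀, IsCoord y q := by
  obtain ⟨g, hg, hg'⟩ := h.exists_localInverse
  have hc : ContinuousAt (coordMap y) x₀ := (contMDiff_coordMap y).continuous.continuousAt
  filter_upwards [hg, hc.eventually hg'.eventually_nhds] with q hq hq'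
  have h1 : MDifferentiableAt 𝓘(ℝ, 𝔼) (𝓡 d) g (coordMap y q) :=
    hq'.self_of_nhds.2.mdifferentiableAt (by simp)
  have h2 := mfderiv_comp (coordMap y q)
    (((contMDiff_coordMap y) (g (coordMap y q))).mdifferentiableAt (by simp)) h1
  have h3 : coordMap y ∘ g =ᶠ[nhds (coordMap y q)] id := hq'.mono fun u hu => hu.1
  rw [h3.mfderiv_eq, mfderiv_id] at h2
  rw [← hq]
  refine IsCoord.of_dual (fun j => mfderiv 𝓘(ℝ, 𝔼) (𝓡 d) g (coordMap y q)
    (EuclideanSpace.single j (1 : ℝ) : 𝔼)) fun i j => ?_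
  rw [← mfderiv_coordMap_apply]
  have h4 : (EuclideanSpace.single j (1 : ℝ) : 𝔼) = _ :=
    DFunLike.congr_fun h2 (EuclideanSpace.single j (1 : ℝ) : 𝔼)
  have h5 : (EuclideanSpace.single j (1 : ℝ) : 𝔼) i = _ := congrArg (fun v : 𝔼 => v i) h4
  refine h5.symm.trans ?_
  simp

/-- The frame `coordFrame` is chosen point by point, so smoothness is not built in. It holds because
`∂f/∂y_i` is an ordinary partial derivative of `f ∘ g`, where `g` is the local inverse, composed
with `y`. -/
theorem IsCoord.contMDiffAt_pd {y : Fin d → SmoothFun d M} {x₀ : M} (h : IsCoord y x₀)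
    {f : M → ℝ} (hf : ContMDiffAt (𝓡 d) 𝓘(ℝ, ℝ) ∞ f x₀) (i : Fin d) :
    ContMDiffAt (𝓡 d) 𝓘(ℝ, ℝ) ∞ (pd y i f) x₀ := by
  obtain ⟨g, hg, hg'⟩ := h.exists_localInverse
  have hx : g (coordMap y x₀) = x₀ := hg.self_of_nhds
  have hc : ContinuousAt (coordMap y) x₀ := (contMDiff_coordMap y).continuous.continuousAt
  have hfg : ContDiffAt ℝ ∞ (f ∘ g) (coordMap y x₀) := by
    refine (ContMDiffAt.comp (coordMap y x₀) ?_ hg'.self_of_nhds.2).contDiffAt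
    rw [hx]; exact hf
  have h1 : ContDiffAt ℝ ∞ (fun u => fderiv ℝ (f ∘ g) u (EuclideanSpace.single i (1 : ℝ)))
      (coordMap y x₀) := (hfg.fderiv_right (m := ∞) (by simp)).clm_apply contDiffAt_const
  refine (h1.contMDiffAt.comp x₀ (contMDiff_coordMap y x₀)).congr_of_eventuallyEq ?_
  -- Finite-order smoothness at a point spreads to a neighbourhood; order one is enough for the
  -- chain rule.
  have hf1 : ∀ᶠ q in nhds x₀, ContMDiffAt (𝓡 d) 𝓘(ℝ, ℝ) 1 f q :=
    (contMDiffAt_iff_contMDiffAt_nhds (by simp)).1 (hf.of_le (by norm_cast))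
  filter_upwards [hg.eventually_nhds, hf1, h.eventually, hc.eventually hg'] with q hq hfq hy hgq
  have e : f =ᶠ[nhds q] (f ∘ g) ∘ coordMap y := hq.mono fun q' hq' => by
    simp only [Function.comp]; rw [hq']
  have hq0 : g (coordMap y q) = q := hq.self_of_nhds
  have hd1 : MDifferentiableAt 𝓘(ℝ, 𝔼) 𝓘(ℝ, ℝ) (f ∘ g) (coordMap y q) := by
    refine MDifferentiableAt.comp (coordMap y q) ?_ (hgq.2.mdifferentiableAt (by simp))
    rw [hq0]; exact hfq.mdifferentiableAt (by simp)
  have h2 := mfderiv_comp q hd1 (((contMDiff_coordMap y) q).mdifferentiableAt (by simp))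
  rw [← e.mfderiv_eq, mfderiv_eq_fderiv] at h2
  have h3 := DFunLike.congr_fun h2 (coordFrame y q i)
  refine h3.trans ?_
  refine congrArg (fderiv ℝ (f ∘ g) (coordMap y q)) ?_
  have : ∀ v w : 𝔼, (∀ j, v j = w j) → v = w := fun v w hvw => by ext j; exact hvw j
  refine this _ _ fun j => ?_
  refine (mfderiv_coordMap_apply y q _ j).trans ?_
  rw [hy.mvfderiv_coordFrame]
  simp

variable [T2Space M]

/-- Functions near a point of a coordinate system, read in the coordinates. -/
theorem IsCoord.exists_contDiff {y : Fin d → SmoothFun d M} {x₀ : M} (h : IsCoord y x₀)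
    (f : SmoothFun d M) : ∃ (F : 𝔼 → ℝ) (g : 𝔼 → M), ContDiff ℝ ∞ F ∧ ContinuousAt g 0 ∧
      g 0 = x₀ ∧ (∀ᶠ q in nhds x₀, f q = F (coordMap y q - coordMap y x₀)) ∧
      ∀ᶠ u in nhds (0 : 𝔼), F u = f (g u) ∧ ∀ i, y i (g u) = u i + y i x₀ := by
  obtain ⟨g, hg, hg'⟩ := h.exists_localInverse
  have ht : Filter.Tendsto (fun u : 𝔼 => u + coordMap y x₀) (nhds 0) (nhds (coordMap y x₀)) := by
    have : ContinuousAt (fun u : 𝔼 => u + coordMap y x₀) 0 := by fun_prop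
    simpa [ContinuousAt] using this
  have hs : ∀ᶠ u in nhds (0 : 𝔼), ContDiffAt ℝ ∞ (fun u => f (g (u + coordMap y x₀))) u := by
    filter_upwards [ht.eventually hg'] with u hu
    have h1 : ContDiffAt ℝ ∞ (f ∘ g) (u + coordMap y x₀) :=
      ((f.contMDiff _).comp _ hu.2).contDiffAt
    exact ContDiffAt.comp (g := f ∘ g) u h1 (by fun_prop)
  obtain ⟨F, hF, hFe⟩ := exists_contDiff_eventuallyEq hs
  refine ⟨F, fun u => g (u + coordMap y x₀), hF, ?_, ?_, ?_, ?_⟩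
  · have hgc : ContinuousAt g (0 + coordMap y x₀) := by
      rw [zero_add]; exact hg'.self_of_nhds.2.continuousAt
    exact ContinuousAt.comp (f := fun u : 𝔼 => u + coordMap y x₀) hgc (by fun_prop)
  · simpa using hg.self_of_nhds
  · have hc : Filter.Tendsto (fun q => coordMap y q - coordMap y x₀) (nhds x₀) (nhds 0) := by
      have h1 : Continuous fun q => coordMap y q - coordMap y x₀ :=
        (contMDiff_coordMap y).continuous.sub continuous_const
      simpa using h1.tendsto x₀
    filter_upwards [hc.eventually hFe, hg] with q hq hq'
    rw [hq, sub_add_cancel, hq']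
  · filter_upwards [hFe, ht.eventually hg'] with u hu hu'
    refine ⟨hu, fun i => ?_⟩
    rw [← coordMap_apply, hu'.1]; rfl

theorem IsCoord.hadamard {y : Fin d → SmoothFun d M} {x₀ : M} (h : IsCoord y x₀)
    (f : SmoothFun d M) : ∃ c : Fin d → SmoothFun d M,
      ∀ᶠ q in nhds x₀, f q = f x₀ + ∑ i, (y i q - y i x₀) * c i q := by
  obtain ⟨F, g, hF, hgc, hg0, hf, hFg⟩ := h.exists_contDiff f
  obtain ⟨c, hc, hFc⟩ := LogSymplectic.hadamard hF 0
  refine ⟨fun i => ⟨fun q => c (coordMap y q - coordMap y x₀) (EuclideanSpace.single i 1), ?_⟩, ?_⟩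
  · have h1 : ContDiff ℝ ∞ fun u : 𝔼 => c (u - coordMap y x₀) (EuclideanSpace.single i (1 : ℝ)) :=
      (hc.comp (by fun_prop)).clm_apply contDiff_const
    exact h1.contMDiff.comp (contMDiff_coordMap y)
  · filter_upwards [hf] with q hq
    rw [hq, hFc]
    have e : ∀ u : 𝔼, u = ∑ i, u i • EuclideanSpace.single i (1 : ℝ) := by
      intro u
      ext j
      simp [Pi.single_apply]
    have e0 : F 0 = f x₀ := by rw [hFg.self_of_nhds.1, hg0]
    simp only [zero_apply, sub_zero, e0]
    congr 1
    refine (congrArg (c (coordMap y q - coordMap y x₀)) (e _)).trans ?_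
    rw [map_sum]
    refine Finset.sum_congr rfl fun i _ => ?_
    rw [map_smul]
    rfl

/-- A function vanishing on `{y_i = 0}` near a point is divisible by `y_i`. -/
theorem IsCoord.exists_eq_mul {y : Fin d → SmoothFun d M} {x₀ : M} (h : IsCoord y x₀)
    (i : Fin d) (hi : y i x₀ = 0) (f : SmoothFun d M)
    (hf0 : ∀ᶠ q in nhds x₀, y i q = 0 → f q = 0) : ∃ c : SmoothFun d M,
      ∀ᶠ q in nhds x₀, f q = y i q * c q := by
  obtain ⟨F, g, hF, hgc, hg0, hf, hFg⟩ := h.exists_contDiff f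
  let A : 𝔼 →L[ℝ] 𝔼 := ContinuousLinearMap.id ℝ 𝔼 -
    (EuclideanSpace.proj (𝕜 := ℝ) i).smulRight (EuclideanSpace.single i (1 : ℝ))
  have hA : ∀ u : 𝔼, u - A u = u i • EuclideanSpace.single i (1 : ℝ) := fun u => by
    simp [A]
  obtain ⟨c, hc, hFc⟩ := LogSymplectic.hadamard hF A
  refine ⟨⟨fun q => c (coordMap y q - coordMap y x₀) (EuclideanSpace.single i 1), ?_⟩, ?_⟩
  · have h1 : ContDiff ℝ ∞ fun u : 𝔼 => c (u - coordMap y x₀) (EuclideanSpace.single i (1 : ℝ)) :=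
      (hc.comp (by fun_prop)).clm_apply contDiff_const
    exact h1.contMDiff.comp (contMDiff_coordMap y)
  · have hct : Filter.Tendsto (fun q => A (coordMap y q - coordMap y x₀)) (nhds x₀) (nhds 0) := by
      have h1 : Continuous fun q => A (coordMap y q - coordMap y x₀) :=
        A.continuous.comp ((contMDiff_coordMap y).continuous.sub continuous_const)
      simpa using h1.tendsto x₀
    have h0 : ∀ᶠ u in nhds (0 : 𝔼), y i (g u) = 0 → f (g u) = 0 := by
      exact hgc.eventually (p := fun q => y i q = 0 → f q = 0) (by rw [hg0]; exact hf0)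
    filter_upwards [hf, hct.eventually hFg, hct.eventually h0] with q hq hq1 hq2
    rw [hq, hFc, hq1.1, hq2, hA, zero_add, map_smul, smul_eq_mul]
    · change (y i q - y i x₀) * _ = _
      rw [hi, sub_zero]; rfl
    · rw [hq1.2, hi]
      simp [A]

variable (d) in
/-- Every point has a coordinate system given by global functions, equal near the point to the
coordinates of the preferred chart. -/
theorem exists_isCoord (x₀ : M) : ∃ y : Fin d → SmoothFun d M, IsCoord y x₀ ∧
    ∀ i, y i =ᶠ[nhds x₀] fun x => chartAt 𝔼 x₀ x i := by
  have hs : ∀ i, ∀ᶠ q in nhds x₀, ContMDiffAt (𝓡 d) 𝓘(ℝ, ℝ) ∞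
      (fun x => chartAt 𝔼 x₀ x i) q := by
    intro i
    filter_upwards [extChartAt_source_mem_nhds (I := 𝓡 d) x₀] with q hq
    have h1 : ContMDiffAt (𝓡 d) 𝓘(ℝ, 𝔼) ∞ (extChartAt (𝓡 d) x₀) q :=
      contMDiffAt_extChartAt' (by simpa using hq)
    exact ((EuclideanSpace.proj (𝕜 := ℝ) i).contDiff (n := ∞)).contMDiff.contMDiffAt.comp q h1
  choose y hy using fun i => exists_smoothFun_eventuallyEq (hs i)
  refine ⟨y, ?_, hy⟩
  have hd : MDifferentiableAt (𝓡 d) 𝓘(ℝ, 𝔼) (extChartAt (𝓡 d) x₀) x₀ :=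
    mdifferentiableAt_extChartAt (mem_chart_source _ x₀)
  have hinv := isInvertible_mfderiv_extChartAt (I := 𝓡 d) (mem_extChartAt_source (I := 𝓡 d) x₀)
  have hψ : coordMap y =ᶠ[nhds x₀] extChartAt (𝓡 d) x₀ := by
    filter_upwards [Filter.eventually_all.2 hy] with q hq
    ext i
    exact hq i
  refine IsCoord.of_dual (fun j => ContinuousLinearMap.inverse
    (mfderiv (𝓡 d) 𝓘(ℝ, 𝔼) (extChartAt (𝓡 d) x₀) x₀) (EuclideanSpace.single j (1 : ℝ) : 𝔼))
    fun i j => ?_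
  rw [← mfderiv_coordMap_apply, hψ.mfderiv_eq]
  have h4 := congrArg (fun v : 𝔼 => v i)
    (hinv.self_apply_inverse (EuclideanSpace.single j (1 : ℝ) : 𝔼))
  refine Eq.trans h4 ?_
  simp

end Coordinates

/-! ### Multiderivations and multivector fields -/

section Multiderivations

set_option linter.unusedSectionVars false

variable {d : ℕ} {M : Type*} [TopologicalSpace M]
  [ChartedSpace (EuclideanSpace ℝ (Fin d)) M] [IsManifold (𝓡 d) ∞ M]

/-- The differential of functions at a point, as a linear map. -/
def dAt (q : M) : SmoothFun d M →ₗ[ℝ] Module.Dual ℝ (TangentSpace (𝓡 d) q) where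
  toFun f := (mvfderiv (𝓡 d) f q : TangentSpace (𝓡 d) q →ₗ[ℝ] ℝ)
  map_add' f g := by
    ext v
    exact DFunLike.congr_fun
      (mvfderiv_add (mdifferentiableAt_smoothFun f q) (mdifferentiableAt_smoothFun g q)) v
  map_smul' c f := by
    ext v
    have hc : MDifferentiableAt (𝓡 d) 𝓘(ℝ, ℝ) (fun _ : M => c) q := mdifferentiableAt_const
    have h := DFunLike.congr_fun (mvfderiv_smul hc (mdifferentiableAt_smoothFun f q)) v
    rw [mvfderiv_const] at h
    refine h.trans ?_
    simp only [add_apply, smul_apply, ContinuousLinearMap.smulRight_apply, zero_apply, zero_smul,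
      add_zero]
    rfl

theorem dAt_apply (q : M) (f : SmoothFun d M) (v : TangentSpace (𝓡 d) q) :
    dAt q f v = mvfderiv (𝓡 d) f q v := rfl

theorem dAt_mul (q : M) (f g : SmoothFun d M) :
    dAt q (f * g) = f q • dAt q g + g q • dAt q f := by
  ext v
  have h := DFunLike.congr_fun
    (mvfderiv_mul (mdifferentiableAt_smoothFun f q) (mdifferentiableAt_smoothFun g q)) v
  exact h

theorem dAt_congr {q : M} {f g : SmoothFun d M} (h : f =ᶠ[nhds q] g) : dAt q f = dAt q g := by
  ext v
  rw [dAt_apply, dAt_apply, mvfderiv, mvfderiv, h.mfderiv_eq, h.self_of_nhds]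

theorem smoothFun_add_apply (f g : SmoothFun d M) (q : M) : (f + g) q = f q + g q := rfl
theorem smoothFun_mul_apply (f g : SmoothFun d M) (q : M) : (f * g) q = f q * g q := rfl
theorem smoothFun_sub_apply (f g : SmoothFun d M) (q : M) : (f - g) q = f q - g q := rfl
theorem smoothFun_neg_apply (f : SmoothFun d M) (q : M) : (-f) q = -f q := rfl
theorem smoothFun_smul_apply (c : ℝ) (f : SmoothFun d M) (q : M) : (c • f) q = c * f q := rfl
theorem smoothFun_zero_apply (q : M) : (0 : SmoothFun d M) q = 0 := rfl
theorem smoothFun_one_apply (q : M) : (1 : SmoothFun d M) q = 1 := rfl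

/-- Evaluation at a point, as a linear map. -/
def evalAt (q : M) : SmoothFun d M →ₗ[ℝ] ℝ where
  toFun f := f q
  map_add' _ _ := rfl
  map_smul' _ _ := rfl

theorem evalAt_apply (q : M) (f : SmoothFun d M) : evalAt q f = f q := rfl

theorem smoothFun_sum_apply {ι : Type*} (s : Finset ι) (f : ι → SmoothFun d M) (q : M) :
    (∑ i ∈ s, f i) q = ∑ i ∈ s, f i q := map_sum (evalAt q) f s

/-- Evaluation at a point, as a ring homomorphism. -/
def evalHom (q : M) : SmoothFun d M →+* ℝ where
  toFun f := f q
  map_add' _ _ := rfl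
  map_mul' _ _ := rfl
  map_zero' := rfl
  map_one' := rfl

theorem evalHom_apply (q : M) (f : SmoothFun d M) : evalHom q f = f q := rfl

section T2

variable [T2Space M]

/-- Point derivations are local. -/
theorem pointDer_congr {q : M} {δ : SmoothFun d M →ₗ[ℝ] ℝ}
    (hδ : ∀ f g, δ (f * g) = f q * δ g + g q * δ f) {f g : SmoothFun d M}
    (h : f =ᶠ[nhds q] g) : δ f = δ g := by
  obtain ⟨χ, hχ1, hχ2, -⟩ := exists_bump (d := d) h
  have h0 : χ * (f - g) = 0 := by
    ext x
    change χ x * (f x - g x) = 0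
    by_cases hx : χ x = 0
    · rw [hx, zero_mul]
    · rw [show f x = g x from hχ2 x hx, sub_self, mul_zero]
  have h1 := hδ χ (f - g)
  rw [h0, map_zero, hχ1.self_of_nhds, one_mul, smoothFun_sub_apply, h.self_of_nhds, sub_self,
    zero_mul, add_zero, map_sub] at h1
  exact (sub_eq_zero.1 h1.symm)

theorem pointDer_const {q : M} {δ : SmoothFun d M →ₗ[ℝ] ℝ}
    (hδ : ∀ f g, δ (f * g) = f q * δ g + g q * δ f) (c : ℝ) :
    δ (algebraMap ℝ (SmoothFun d M) c) = 0 := by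
  have h1 : δ 1 = 0 := by
    have := hδ 1 1
    rw [mul_one, smoothFun_one_apply, one_mul] at this
    exact left_eq_add.1 this
  rw [Algebra.algebraMap_eq_smul_one, map_smul, h1, smul_zero]

/-- Hadamard's lemma writes `f` near `q` as a constant plus `∑ (y_i - y_i(q)) c_i`, so any point
derivation gives `∑ c_i(q) δ(y_i)`. Taking `δ = ∂/∂y_j` identifies `c_j(q)` as the partial
derivative. -/
theorem pointDer_eq_sum {y : Fin d → SmoothFun d M} {q : M} (hy : IsCoord y q)
    {δ : SmoothFun d M →ₗ[ℝ] ℝ} (hδ : ∀ f g, δ (f * g) = f q * δ g + g q * δ f)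
    (f : SmoothFun d M) : δ f = ∑ i, pd y i f q * δ (y i) := by
  obtain ⟨c, hc⟩ := hy.hadamard f
  let f' : SmoothFun d M := algebraMap ℝ _ (f q) +
    ∑ i, (y i - algebraMap ℝ _ (y i q)) * c i
  have hf : f =ᶠ[nhds q] f' := by
    filter_upwards [hc] with x hx
    rw [hx, smoothFun_add_apply, smoothFun_sum_apply]
    rfl
  have key : ∀ δ : SmoothFun d M →ₗ[ℝ] ℝ, (∀ f g, δ (f * g) = f q * δ g + g q * δ f) →
      δ f = ∑ i, c i q * δ (y i) := by
    intro δ hδ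
    rw [pointDer_congr hδ hf, map_add, pointDer_const hδ, zero_add, map_sum]
    refine Finset.sum_congr rfl fun i _ => ?_
    have h0 : (y i - algebraMap ℝ (SmoothFun d M) (y i q)) q = 0 := sub_self _
    rw [hδ, map_sub, pointDer_const hδ, sub_zero, h0, zero_mul, zero_add]
  have hpd : ∀ j, pd y j f q = c j q := by
    intro j
    let δ' : SmoothFun d M →ₗ[ℝ] ℝ :=
      (LinearMap.applyₗ (coordFrame y q j) : Module.Dual ℝ (TangentSpace (𝓡 d) q) →ₗ[ℝ] ℝ) ∘ₗ dAt q
    have h1 := key δ' (fun f g => by simp [δ', dAt_mul])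
    have h2 : ∀ g : SmoothFun d M, δ' g = pd y j g q := fun g => rfl
    simp only [h2, hy.pd_coord] at h1
    rw [h1]; simp
  rw [key δ hδ]
  simp only [hpd]

theorem pointDer_congr_dAt {q : M} {δ : SmoothFun d M →ₗ[ℝ] ℝ}
    (hδ : ∀ f g, δ (f * g) = f q * δ g + g q * δ f) {f g : SmoothFun d M}
    (h : dAt q f = dAt q g) : δ f = δ g := by
  obtain ⟨y, hy, -⟩ := exists_isCoord d q
  rw [pointDer_eq_sum hy hδ, pointDer_eq_sum hy hδ]
  refine Finset.sum_congr rfl fun i _ => ?_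
  rw [show pd y i f q = pd y i g q from LinearMap.congr_fun h (coordFrame y q i)]

variable {k : ℕ}

/-- The value of a multiderivation at a point in one variable is a point derivation. -/
def slotAt (w : SmoothFun d M [⋀^Fin k]→ₗ[ℝ] SmoothFun d M) (v : Fin k → SmoothFun d M)
    (i : Fin k) (q : M) : SmoothFun d M →ₗ[ℝ] ℝ :=
  evalAt q ∘ₗ w.toMultilinearMap.toLinearMap v i

theorem slotAt_apply (w : SmoothFun d M [⋀^Fin k]→ₗ[ℝ] SmoothFun d M) (v : Fin k → SmoothFun d M)
    (i : Fin k) (q : M) (f : SmoothFun d M) :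
    slotAt w v i q f = w (Function.update v i f) q := rfl

theorem IsMultiDer.slotAt_mul {w : SmoothFun d M [⋀^Fin k]→ₗ[ℝ] SmoothFun d M}
    (hw : IsMultiDer w) (v : Fin k → SmoothFun d M) (i : Fin k) (q : M) (f g : SmoothFun d M) :
    slotAt w v i q (f * g) = f q * slotAt w v i q g + g q * slotAt w v i q f := by
  rw [slotAt_apply, hw]; rfl

/-- Each slot is a point derivation and so depends only on the differential at `q`; the arguments
are exchanged one at a time. -/
theorem IsMultiDer.congr_dAt {w : SmoothFun d M [⋀^Fin k]→ₗ[ℝ] SmoothFun d M}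
    (hw : IsMultiDer w) {q : M} {f g : Fin k → SmoothFun d M}
    (h : ∀ i, dAt q (f i) = dAt q (g i)) : w f q = w g q := by
  have key : ∀ s : Finset (Fin k), w (s.piecewise g f) q = w f q := by
    intro s
    induction s using Finset.induction_on with
    | empty => simp
    | insert i s hi ih =>
      rw [Finset.piecewise_insert, ← ih]
      have e : s.piecewise g f = Function.update (s.piecewise g f) i (f i) := by
        funext j
        by_cases hj : j = i
        · subst hj; simp [hi]
        · simp [hj]
      conv_rhs => rw [e]
      exact pointDer_congr_dAt (hw.slotAt_mul _ i q) (h i).symm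
  rw [← key Finset.univ, Finset.piecewise_univ]

theorem IsMultiDer.eq_sum {w : SmoothFun d M [⋀^Fin k]→ₗ[ℝ] SmoothFun d M}
    (hw : IsMultiDer w) {y : Fin d → SmoothFun d M} {q : M} (hy : IsCoord y q)
    (f : Fin k → SmoothFun d M) :
    w f q = ∑ J : Fin k → Fin d, (∏ a, pd y (J a) (f a) q) * w (y ∘ J) q := by
  have h1 : w f q = w (fun a => ∑ j, pd y j (f a) q • y j) q := by
    refine hw.congr_dAt fun a => ?_
    ext v
    rw [map_sum, dAt_apply, hy.mvfderiv_eq]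
    simp [dAt_apply]
  rw [h1]
  have h2 := w.toMultilinearMap.map_sum (fun a j => pd y j (f a) q • y j)
  simp only [AlternatingMap.coe_multilinearMap] at h2
  rw [h2, smoothFun_sum_apply]
  refine Finset.sum_congr rfl fun J _ => ?_
  have h3 := w.toMultilinearMap.map_smul_univ (fun a => pd y (J a) (f a) q) (y ∘ J)
  simp only [AlternatingMap.coe_multilinearMap, Function.comp] at h3
  rw [h3]; rfl

end T2

/-! ### Multivector fields as multiderivations -/

section EvalFun

variable {k : ℕ}

/-- A multivector field as an alternating map on functions. -/
def toAlt (w : MultiVec d M k) : SmoothFun d M [⋀^Fin k]→ₗ[ℝ] SmoothFun d M where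
  toFun f := evalFun f w
  map_update_add' {_} f i a b := by
    ext q
    exact LinearMap.congr_fun (((exteriorPower.alternatingMapToDual ℝ
      (TangentSpace (𝓡 d) q) k).compLinearMap (dAt q)).map_update_add f i a b) (w.1 q)
  map_update_smul' {_} f i c a := by
    ext q
    exact LinearMap.congr_fun (((exteriorPower.alternatingMapToDual ℝ
      (TangentSpace (𝓡 d) q) k).compLinearMap (dAt q)).map_update_smul f i c a) (w.1 q)
  map_eq_zero_of_eq' f i j hf hij := by
    ext q
    exact LinearMap.congr_fun (((exteriorPower.alternatingMapToDual ℝ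
      (TangentSpace (𝓡 d) q) k).compLinearMap (dAt q)).map_eq_zero_of_eq f hf hij) (w.1 q)

theorem toAlt_apply (w : MultiVec d M k) (f : Fin k → SmoothFun d M) :
    toAlt w f = evalFun f w := rfl

theorem toAlt_apply_apply (w : MultiVec d M k) (f : Fin k → SmoothFun d M) (q : M) :
    toAlt w f q = exteriorPower.alternatingMapToDual ℝ (TangentSpace (𝓡 d) q) k
      (fun i => dAt q (f i)) (w.1 q) := rfl

theorem isMultiDer_toAlt (w : MultiVec d M k) : IsMultiDer (toAlt w) := by
  intro v i f g
  ext q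
  rw [smoothFun_add_apply, smoothFun_mul_apply, smoothFun_mul_apply]
  simp only [toAlt_apply_apply]
  have e : ∀ h : SmoothFun d M, (fun j => dAt q (Function.update v i h j)) =
      Function.update (fun j => dAt q (v j)) i (dAt q h) := by
    intro h; funext j
    by_cases hj : j = i
    · subst hj; simp
    · simp [hj]
  simp only [e, dAt_mul, AlternatingMap.map_update_add, AlternatingMap.map_update_smul,
    LinearMap.add_apply, LinearMap.smul_apply, smul_eq_mul]

open Equiv in
/-- Expansion of a `k`-vector in a frame. -/
theorem exteriorPower_eq_sum {V : Type*} [AddCommGroup V] [Module ℝ V] {f : Fin d → Module.Dual ℝ V}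
    {e : Fin d → V} (he : ∀ v, v = ∑ i, f i v • e i) (ξ : ⋀[ℝ]^k V) :
    (k.factorial : ℝ) • ξ = ∑ J : Fin k → Fin d,
      exteriorPower.alternatingMapToDual ℝ V k (f ∘ J) ξ • exteriorPower.ιMulti ℝ k (e ∘ J) := by
  suffices h : (k.factorial : ℝ) • (LinearMap.id : ⋀[ℝ]^k V →ₗ[ℝ] ⋀[ℝ]^k V) =
      ∑ J : Fin k → Fin d, (exteriorPower.alternatingMapToDual ℝ V k (f ∘ J)).smulRight
        (exteriorPower.ιMulti ℝ k (e ∘ J)) by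
    have := LinearMap.congr_fun h ξ
    simpa [LinearMap.sum_apply] using this
  refine exteriorPower.linearMap_ext ?_
  ext1 v
  simp only [LinearMap.compAlternatingMap_apply, LinearMap.smul_apply, LinearMap.id_apply,
    LinearMap.sum_apply, LinearMap.smulRight_apply,
    exteriorPower.alternatingMapToDual_apply_ιMulti, Matrix.det_apply, Matrix.of_apply,
    Finset.sum_smul]
  rw [Finset.sum_comm]
  -- Every permutation in the determinant contributes the same `k`-vector, since its sign is
  -- absorbed by reordering the wedge product. This is the origin of the factor `k!`, the price of
  -- summing over all index tuples and not only the increasing ones.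
  have key : ∀ σ : Perm (Fin k), ∑ J : Fin k → Fin d, (Perm.sign σ •
      ∏ i, (f ∘ J) i (v (σ i))) • exteriorPower.ιMulti ℝ k (e ∘ J) =
      exteriorPower.ιMulti ℝ k v := by
    intro σ
    have h1 : exteriorPower.ιMulti ℝ k (v ∘ σ) = ∑ J : Fin k → Fin d,
        (∏ i, (f ∘ J) i (v (σ i))) • exteriorPower.ιMulti ℝ k (e ∘ J) := by
      have h2 := (exteriorPower.ιMulti ℝ k).toMultilinearMap.map_sum
        (fun i j => f j (v (σ i)) • e j)
      simp only [AlternatingMap.coe_multilinearMap, ← he] at h2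
      refine h2.trans (Finset.sum_congr rfl fun J _ => ?_)
      exact (exteriorPower.ιMulti ℝ k).toMultilinearMap.map_smul_univ
        (fun i => f (J i) (v (σ i))) (e ∘ J)
    rw [AlternatingMap.map_perm] at h1
    simp only [smul_assoc, ← Finset.smul_sum]
    rw [← h1, smul_smul, Int.units_mul_self, one_smul]
  simp only [key]
  rw [Finset.sum_const, Finset.card_univ, Fintype.card_perm, Fintype.card_fin]
  exact Nat.cast_smul_eq_nsmul ℝ _ _

variable [T2Space M]

theorem toAlt_injective : Function.Injective (toAlt : MultiVec d M k → _) := by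
  intro w w' h
  refine Subtype.ext (funext fun q => ?_)
  obtain ⟨y, hy, -⟩ := exists_isCoord d q
  have hk : (k.factorial : ℝ) ≠ 0 := by exact_mod_cast k.factorial_ne_zero
  refine smul_right_injective _ hk ?_
  have he : ∀ v, v = ∑ i, (dAt q (y i)) v • coordFrame y q i := hy.eq_sum_coordFrame
  simp only [exteriorPower_eq_sum he]
  refine Finset.sum_congr rfl fun J _ => ?_
  congr 1
  exact DFunLike.congr_fun (DFunLike.congr_fun h (y ∘ J)) q

open Equiv in
/-- Multiderivations are multivector fields. -/
theorem exists_multiVec {F : SmoothFun d M [⋀^Fin k]→ₗ[ℝ] SmoothFun d M} (hF : IsMultiDer F) :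
    ∃ w : MultiVec d M k, toAlt w = F := by
  have hk : (k.factorial : ℝ) ≠ 0 := by exact_mod_cast k.factorial_ne_zero
  have hpt : ∀ q : M, ∃ ξ : ⋀[ℝ]^k (TangentSpace (𝓡 d) q), ∀ f : Fin k → SmoothFun d M,
      exteriorPower.alternatingMapToDual ℝ (TangentSpace (𝓡 d) q) k (fun i => dAt q (f i)) ξ =
        F f q := by
    intro q
    obtain ⟨y, hy, -⟩ := exists_isCoord d q
    refine ⟨(k.factorial : ℝ)⁻¹ • ∑ J : Fin k → Fin d, F (y ∘ J) q •
      exteriorPower.ιMulti ℝ k (coordFrame y q ∘ J), fun f => ?_⟩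
    rw [map_smul, map_sum, inv_smul_eq_iff₀ hk]
    simp only [map_smul, exteriorPower.alternatingMapToDual_apply_ιMulti]
    have h1 : ∀ J : Fin k → Fin d, F (y ∘ J) q • Matrix.det (n := Fin k)
        (.of fun i j => dAt q (f j) ((coordFrame y q ∘ J) i)) =
        ∑ σ : Perm (Fin k), (Perm.sign σ : ℤ) * ((∏ a, pd y (J a) (f (σ a)) q) * F (y ∘ J) q) := by
      intro J
      rw [← Matrix.det_transpose, Matrix.det_apply', smul_eq_mul, Finset.mul_sum]
      refine Finset.sum_congr rfl fun σ _ => ?_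
      simp only [Matrix.transpose_apply, Matrix.of_apply, Function.comp]
      rw [mul_comm, mul_assoc]
      rfl
    simp only [h1]
    rw [Finset.sum_comm]
    simp only [← Finset.mul_sum]
    have h2 : ∀ σ : Perm (Fin k), ∑ J : Fin k → Fin d,
        (∏ a, pd y (J a) (f (σ a)) q) * F (y ∘ J) q = (Perm.sign σ : ℤ) * F f q := by
      intro σ
      have := hF.eq_sum hy (f ∘ σ)
      rw [AlternatingMap.map_perm] at this
      refine this.symm.trans ?_
      rcases Int.units_eq_one_or (Perm.sign σ) with h | h <;> rw [h]
      · simp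
      · simp [smoothFun_neg_apply]
    simp only [h2, ← mul_assoc, ← Int.cast_mul, ← Units.val_mul, Int.units_mul_self]
    simp [Fintype.card_perm]
  choose ξ hξ using hpt
  refine ⟨⟨ξ, fun x₀ f hf => ?_⟩, ?_⟩
  · obtain ⟨y, hy, -⟩ := exists_isCoord d x₀
    -- The pointwise choice is smooth because its coefficients in the coordinates `y` are the smooth
    -- functions `F (y ∘ J)`.
    have hev : (fun x => evalCovec (fun i => mvfderiv (𝓡 d) (f i) x) (ξ x)) =ᶠ[nhds x₀]
        fun x => ∑ J : Fin k → Fin d, (∏ a, pd y (J a) (f a) x) * F (y ∘ J) x := by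
      filter_upwards [hy.eventually] with x hx
      have h1 : evalCovec (fun i => mvfderiv (𝓡 d) (f i) x) =
          exteriorPower.alternatingMapToDual ℝ (TangentSpace (𝓡 d) x) k
            (fun i => ∑ j, pd y j (f i) x • dAt x (y j)) := by
        unfold evalCovec
        congr 1
        funext i
        ext v
        change mvfderiv (𝓡 d) (f i) x v = _
        rw [hx.mvfderiv_eq]
        simp [dAt_apply]
      have h2 := (exteriorPower.alternatingMapToDual ℝ (TangentSpace (𝓡 d) x) k).toMultilinearMap
        |>.map_sum (fun i j => pd y j (f i) x • dAt x (y j))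
      simp only [AlternatingMap.coe_multilinearMap] at h2
      rw [h1, h2, LinearMap.sum_apply]
      refine Finset.sum_congr rfl fun J _ => ?_
      have h3 := (exteriorPower.alternatingMapToDual ℝ
        (TangentSpace (𝓡 d) x) k).toMultilinearMap.map_smul_univ
        (fun a => pd y (J a) (f a) x) (fun a => dAt x (y (J a)))
      simp only [AlternatingMap.coe_multilinearMap] at h3
      rw [h3, LinearMap.smul_apply, smul_eq_mul, ← hξ x (y ∘ J)]
      rfl
    refine ContMDiffAt.congr_of_eventuallyEq ?_ hev
    refine contMDiffAt_finsetSum fun J _ => ?_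
    refine ContMDiffAt.mul ?_ ((F (y ∘ J)).contMDiff x₀)
    exact contMDiffAt_finsetProd fun a _ => hy.contMDiffAt_pd (hf a) _
  · ext f q
    exact hξ q f

end EvalFun

/-! ### Vector fields as derivations -/

section VectorFields

theorem lieDeriv_apply (V : VecField d M) (f : SmoothFun d M) (q : M) :
    lieDeriv V f q = dAt q f (V q) := rfl

theorem lieDeriv_mul (V : VecField d M) (f g : SmoothFun d M) :
    lieDeriv V (f * g) = f * lieDeriv V g + g * lieDeriv V f := by
  ext q
  rw [lieDeriv_apply, dAt_mul]
  rfl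

theorem lieDeriv_add_left (V W : VecField d M) (f : SmoothFun d M) :
    lieDeriv (V + W) f = lieDeriv V f + lieDeriv W f := by
  ext q; exact map_add (dAt q f) (V q) (W q)

theorem lieDeriv_smul_left (c : ℝ) (V : VecField d M) (f : SmoothFun d M) :
    lieDeriv (c • V) f = c • lieDeriv V f := by
  ext q; exact map_smul (dAt q f) c (V q)

theorem lieDeriv_mul_left (g : SmoothFun d M) (V : VecField d M) (f : SmoothFun d M) :
    lieDeriv (g • V) f = g * lieDeriv V f := by
  ext q; exact map_smul (dAt q f) (g q) (V q)

theorem lieDeriv_lieBracket (V W : VecField d M) (f : SmoothFun d M) :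
    lieDeriv (lieBracket V W) f = lieDeriv V (lieDeriv W f) - lieDeriv W (lieDeriv V f) := by
  ext q; exact mvfderiv_mlieBracket V W f q

variable [T2Space M]

theorem tangent_ext {q : M} {v w : TangentSpace (𝓡 d) q}
    (h : ∀ f : SmoothFun d M, dAt q f v = dAt q f w) : v = w := by
  obtain ⟨y, hy, -⟩ := exists_isCoord d q
  rw [hy.eq_sum_coordFrame v, hy.eq_sum_coordFrame w]
  exact Finset.sum_congr rfl fun i _ => by
    rw [show mvfderiv (𝓡 d) (y i) q v = mvfderiv (𝓡 d) (y i) q w from h (y i)]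

theorem vecField_ext {V W : VecField d M} (h : ∀ f, lieDeriv V f = lieDeriv W f) : V = W := by
  ext q : 1
  exact tangent_ext fun f => DFunLike.congr_fun (h f) q

/-- Derivations are vector fields. -/
theorem exists_vecField {D : SmoothFun d M →ₗ[ℝ] SmoothFun d M}
    (hD : ∀ f g, D (f * g) = f * D g + g * D f) : ∃ V : VecField d M, ∀ f, lieDeriv V f = D f := by
  have hpt : ∀ q : M, ∃ v : TangentSpace (𝓡 d) q, ∀ f : SmoothFun d M, dAt q f v = D f q := by
    intro q
    obtain ⟨y, hy, -⟩ := exists_isCoord d q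
    refine ⟨∑ i, D (y i) q • coordFrame y q i, fun f => ?_⟩
    have h1 := pointDer_eq_sum hy (δ := evalAt q ∘ₗ D) (fun f g => by
      simp only [LinearMap.comp_apply, hD]; rfl) f
    refine Eq.trans ?_ h1.symm
    rw [map_sum]
    refine Finset.sum_congr rfl fun i _ => ?_
    rw [map_smul, smul_eq_mul, mul_comm]
    rfl
  choose v hv using hpt
  refine ⟨⟨v, fun x₀ => ?_⟩, fun f => by ext q; exact hv q f⟩
  obtain ⟨y, hy, hyc⟩ := exists_isCoord d x₀
  rw [Bundle.contMDiffAt_section]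
  -- Near `x₀` the `y_i` are the chart coordinates, so in the trivialization at `x₀` the section has
  -- the smooth components `D (y i)`.
  have hcoord : ContMDiffAt (𝓡 d) 𝓘(ℝ, EuclideanSpace ℝ (Fin d)) ∞
      (coordMap fun i => D (y i)) x₀ := contMDiff_coordMap _ x₀
  refine hcoord.congr_of_eventuallyEq ?_
  have hψ : coordMap y =ᶠ[nhds x₀] extChartAt (𝓡 d) x₀ := by
    filter_upwards [Filter.eventually_all.2 hyc] with q hq
    ext i
    exact hq i
  filter_upwards [hψ.eventually_nhds, (chartAt (EuclideanSpace ℝ (Fin d)) x₀).open_source.mem_nhds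
    (mem_chart_source _ x₀)] with q hq hqs
  have h1 : (trivializationAt (EuclideanSpace ℝ (Fin d)) (TangentSpace (𝓡 d)) x₀ ⟨q, v q⟩).2 =
      mfderiv (𝓡 d) 𝓘(ℝ, EuclideanSpace ℝ (Fin d)) (extChartAt (𝓡 d) x₀) q (v q) := by
    have h0 : (trivializationAt (EuclideanSpace ℝ (Fin d)) (TangentSpace (𝓡 d)) x₀ ⟨q, v q⟩).2 =
        (trivializationAt (EuclideanSpace ℝ (Fin d)) (TangentSpace (𝓡 d)) x₀).continuousLinearMapAt
          ℝ q (v q) := by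
      rw [Bundle.Trivialization.continuousLinearMapAt_apply,
        Bundle.Trivialization.linearMapAt_apply, if_pos (by simpa using hqs)]
    exact h0.trans (DFunLike.congr_fun
      (TangentBundle.continuousLinearMapAt_trivializationAt hqs) (v q))
  rw [h1, ← Filter.EventuallyEq.mfderiv_eq hq]
  have : ∀ v w : EuclideanSpace ℝ (Fin d), (∀ j, v j = w j) → v = w :=
    fun v w hvw => by ext j; exact hvw j
  refine this _ _ fun j => ?_
  exact (mfderiv_coordMap_apply y q (v q) j).trans (hv q (y j))

end VectorFields

end Multiderivations

/-! ### Poisson brackets and Hamiltonian vector fields -/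

section PoissonBracket

set_option linter.unusedSectionVars false

variable {d : ℕ} {M : Type*} [TopologicalSpace M]
  [ChartedSpace (EuclideanSpace ℝ (Fin d)) M] [IsManifold (𝓡 d) ∞ M] (π : MultiVec d M 2)

theorem bracket_eq_toAlt (f g : SmoothFun d M) : bracket π f g = toAlt π ![f, g] := rfl

/-- The bracket of functions as a bilinear map. -/
def brL : SmoothFun d M →ₗ[ℝ] SmoothFun d M →ₗ[ℝ] SmoothFun d M :=
  LinearMap.mk₂ ℝ (bracket π) (fun f f' g => (toAlt π).map_vecCons_add ![g] f f')
    (fun c f g => (toAlt π).map_vecCons_smul ![g] c f) (bracket_add π)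
    (fun c f g => bracket_smul π f g c)

theorem brL_apply (f g : SmoothFun d M) : brL π f g = bracket π f g := rfl

theorem brL_self (f : SmoothFun d M) : brL π f f = 0 :=
  (toAlt π).map_eq_zero_of_eq ![f, f] (i := 0) (j := 1) rfl (by simp)

theorem brL_skew (f g : SmoothFun d M) : brL π f g = -brL π g f := by
  have h := brL_self π (f + g)
  simp only [map_add, LinearMap.add_apply, brL_self] at h
  rw [zero_add, add_zero] at h
  exact eq_neg_of_add_eq_zero_right h

theorem brL_mul (f g h : SmoothFun d M) :
    brL π f (g * h) = g * brL π f h + h * brL π f g := by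
  have e : ∀ u : SmoothFun d M, brL π f u = toAlt π (Function.update ![f, 0] 1 u) := by
    intro u
    rw [brL_apply, bracket_eq_toAlt]
    congr 1
    funext i
    fin_cases i <;> simp
  rw [e, e, e]
  exact isMultiDer_toAlt π _ _ _ _

theorem brL_mul_left (f g h : SmoothFun d M) :
    brL π (f * g) h = f * brL π g h + g * brL π f h := by
  rw [brL_skew, brL_mul, brL_skew π h g, brL_skew π h f]; ring

theorem schouten_eq_ceSum {k : ℕ} (w : MultiVec d M k) (f : Fin (k + 1) → SmoothFun d M) :
    schouten π k w f = ceSum (brL π) (brL π) (toAlt w) f := rfl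

variable {π}

/-- Two applications of Cartan's formula show that `[π, π]` evaluated on three functions is twice
the Jacobiator. -/
theorem IsPoisson.jacobi (h : IsPoisson π) (f g u : SmoothFun d M) :
    brL π f (brL π g u) = brL π (brL π f g) u + brL π g (brL π f u) := by
  have h1 : schouten π 2 π ![f, g, u] = 0 := by
    have h1 : schouten π 2 π = 0 := h
    rw [h1]; rfl
  rw [schouten_eq_ceSum, show (![f, g, u] : Fin 3 → SmoothFun d M) = Fin.cons f ![g, u] from rfl,
    ceSum_cons, show (![g, u] : Fin 2 → SmoothFun d M) = Fin.cons g ![u] from rfl, ceSum_cons,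
    ceSum_zero, ceLie_apply, ceLie_apply, Fin.sum_univ_two, Fin.sum_univ_one] at h1
  have e1 : ∀ a b, toAlt π ![a, b] = brL π a b := fun a b => rfl
  have e2 : toAlt π (Fin.cons g ![u]) = brL π g u := rfl
  have e3 : toAlt π (Function.update (Fin.cons g ![u] : Fin 2 → SmoothFun d M) 0
      (brL π f ((Fin.cons g ![u] : Fin 2 → SmoothFun d M) 0))) = brL π (brL π f g) u := by
    refine Eq.trans (congrArg (toAlt π) ?_) (e1 _ _); funext i; fin_cases i <;> simp
  have e4 : toAlt π (Function.update (Fin.cons g ![u] : Fin 2 → SmoothFun d M) 1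
      (brL π f ((Fin.cons g ![u] : Fin 2 → SmoothFun d M) 1))) = brL π g (brL π f u) := by
    refine Eq.trans (congrArg (toAlt π) ?_) (e1 _ _); funext i; fin_cases i <;> rfl
  have e5 : (toAlt π).curryLeft f ![u] = brL π f u := rfl
  have e6 : (toAlt π).curryLeft f (Function.update (![u] : Fin 1 → SmoothFun d M) 0
      (brL π g ((![u] : Fin 1 → SmoothFun d M) 0))) = brL π f (brL π g u) := by
    refine Eq.trans (congrArg (toAlt π) ?_) (e1 _ _); funext i; fin_cases i <;> rfl
  have e7 : ((toAlt π).curryLeft f).curryLeft g ![] = brL π f g := rfl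
  have e8 : (![u] : Fin 1 → SmoothFun d M) 0 = u := rfl
  rw [e2, e3, e4, e5, e6, e7, e8, brL_skew π u] at h1
  have h2 : (2 : ℝ) • (brL π f (brL π g u) - (brL π (brL π f g) u + brL π g (brL π f u))) = 0 := by
    rw [two_smul, ← h1]; abel
  exact sub_eq_zero.1 ((smul_eq_zero.1 h2).resolve_left two_ne_zero)

theorem IsPoisson.brL_brL (h : IsPoisson π) (f g u : SmoothFun d M) :
    brL π (brL π f g) u = brL π f (brL π g u) - brL π g (brL π f u) := by
  rw [h.jacobi f g u]; abel

variable (π)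
variable [T2Space M]

theorem pointDer_brL (q : M) (f g h : SmoothFun d M) :
    (evalAt q ∘ₗ brL π f) (g * h) = g q * (evalAt q ∘ₗ brL π f) h +
      h q * (evalAt q ∘ₗ brL π f) g := by
  simp only [LinearMap.comp_apply, brL_mul]; rfl

theorem brL_eq_sum {y : Fin d → SmoothFun d M} {q : M} (hy : IsCoord y q)
    (f g : SmoothFun d M) : brL π f g q = ∑ i, pd y i g q * brL π f (y i) q :=
  pointDer_eq_sum hy (pointDer_brL π q f) g

theorem brL_eq_sum_left {y : Fin d → SmoothFun d M} {q : M} (hy : IsCoord y q)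
    (f g : SmoothFun d M) : brL π f g q = ∑ i, pd y i f q * brL π (y i) g q := by
  rw [brL_skew, smoothFun_neg_apply, brL_eq_sum π hy, ← Finset.sum_neg_distrib]
  refine Finset.sum_congr rfl fun i _ => ?_
  rw [brL_skew π g, smoothFun_neg_apply, mul_neg, neg_neg]

theorem brL_congr {q : M} (f : SmoothFun d M) {g g' : SmoothFun d M} (h : g =ᶠ[nhds q] g') :
    brL π f g q = brL π f g' q :=
  pointDer_congr (pointDer_brL π q f) h

theorem brL_eventuallyEq {q : M} (f : SmoothFun d M) {g g' : SmoothFun d M}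
    (h : g =ᶠ[nhds q] g') : brL π f g =ᶠ[nhds q] brL π f g' := by
  filter_upwards [h.eventually_nhds] with x hx
  exact brL_congr π f hx

theorem exists_ham (f : SmoothFun d M) : ∃ V : VecField d M, IsHamiltonian π f V :=
  exists_vecField (D := brL π f) (brL_mul π f)

/-- The Hamiltonian vector field of a function. -/
def ham (f : SmoothFun d M) : VecField d M := (exists_ham π f).choose

theorem lieDeriv_ham (f g : SmoothFun d M) : lieDeriv (ham π f) g = brL π f g :=
  (exists_ham π f).choose_spec g

theorem dAt_ham (f g : SmoothFun d M) (q : M) : dAt q g (ham π f q) = brL π f g q :=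
  DFunLike.congr_fun (lieDeriv_ham π f g) q

theorem ham_add (f g : SmoothFun d M) : ham π (f + g) = ham π f + ham π g :=
  vecField_ext fun u => by
    rw [lieDeriv_add_left]; simp only [lieDeriv_ham, map_add, LinearMap.add_apply]

theorem ham_smul (c : ℝ) (f : SmoothFun d M) : ham π (c • f) = c • ham π f :=
  vecField_ext fun u => by
    rw [lieDeriv_smul_left]; simp only [lieDeriv_ham, map_smul, LinearMap.smul_apply]

theorem ham_mul (f g : SmoothFun d M) : ham π (f * g) = f • ham π g + g • ham π f :=
  vecField_ext fun u => by
    rw [lieDeriv_add_left, lieDeriv_mul_left, lieDeriv_mul_left]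
    simp only [lieDeriv_ham, brL_mul_left]

variable {π} in
theorem lieBracket_ham (h : IsPoisson π) (f g : SmoothFun d M) :
    lieBracket (ham π f) (ham π g) = ham π (brL π f g) :=
  vecField_ext fun u => by
    rw [lieDeriv_lieBracket]; simp only [lieDeriv_ham, h.brL_brL]

end PoissonBracket

/-! ### The singular locus -/

section ExteriorPowerOfBivector

open Matrix

theorem ofFn_prod_pairs {n : ℕ} {N : Type*} [Monoid N] (g : Fin (2 * n) → N) :
    (List.ofFn g).prod =
      (List.ofFn fun i : Fin n => g (pairIdx n (i, 0)) * g (pairIdx n (i, 1))).prod := by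
  rw [List.ofFn_mul', List.prod_flatten, List.map_ofFn]
  congr 2
  funext i
  simp only [Function.comp, List.ofFn_succ, List.ofFn_zero, List.prod_cons, List.prod_nil, mul_one]
  congr 2 <;> simp [pairIdx, Fin.ext_iff, add_comm]

/-- The `n`-th power is expanded as a multilinear product, and `n` wedges of pairs concatenate to
one wedge of length `2n`. The powers of `2` arise because `hb` sums over ordered pairs. -/
theorem two_pow_smul_pow {n : ℕ} {V : Type*} [AddCommGroup V] [Module ℝ V] (e : Fin (2 * n) → V)
    (P : Matrix (Fin (2 * n)) (Fin (2 * n)) ℝ) (b : ExteriorAlgebra ℝ V)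
    (hb : (2 : ℝ) • b = ∑ J : Fin 2 → Fin (2 * n),
      P (J 0) (J 1) • ExteriorAlgebra.ιMulti ℝ 2 (e ∘ J)) :
    (2 : ℝ) ^ n • b ^ n = ∑ κ : Fin (2 * n) → Fin (2 * n),
      (∏ i : Fin n, P (κ (pairIdx n (i, 0))) (κ (pairIdx n (i, 1)))) •
        ExteriorAlgebra.ιMulti ℝ (2 * n) (e ∘ κ) := by
  rw [← smul_pow, hb, ← MultilinearMap.mkPiAlgebraFin_apply_const (R := ℝ) (n := n),
    MultilinearMap.map_sum, ← (tuplePairs n _).sum_comp]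
  refine Finset.sum_congr rfl fun r _ => ?_
  rw [MultilinearMap.map_smul_univ, MultilinearMap.mkPiAlgebraFin_apply,
    ExteriorAlgebra.ιMulti_apply, ofFn_prod_pairs]
  simp only [tuplePairs_apply, Function.comp, ExteriorAlgebra.ιMulti_apply, List.ofFn_succ,
    List.ofFn_zero, List.prod_cons, List.prod_nil, mul_one]
  rfl

/-- In dual frames the pairing of `a` with `e ∘ κ` is the determinant of columns of the identity
matrix, so this is `sum_det_submatrix` for `T = 1`. -/
theorem two_pow_mul_toDual_eq_pfaff {n : ℕ} {V : Type*} [AddCommGroup V] [Module ℝ V]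
    {e : Fin (2 * n) → V} {a : Fin (2 * n) → Module.Dual ℝ V}
    (ha : ∀ i j, a i (e j) = if i = j then 1 else 0)
    {P : Matrix (Fin (2 * n)) (Fin (2 * n)) ℝ} {b : ⋀[ℝ]^2 V}
    (hb : (2 : ℝ) • b = ∑ J : Fin 2 → Fin (2 * n), P (J 0) (J 1) •
      exteriorPower.ιMulti ℝ 2 (e ∘ J))
    (ξ : ⋀[ℝ]^(2 * n) V) (hξ : (ξ : ExteriorAlgebra ℝ V) = (b : ExteriorAlgebra ℝ V) ^ n) :
    (2 : ℝ) ^ n * exteriorPower.alternatingMapToDual ℝ V (2 * n) a ξ = pfaff P := by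
  have hb' : (2 : ℝ) • (b : ExteriorAlgebra ℝ V) = ∑ J : Fin 2 → Fin (2 * n),
      P (J 0) (J 1) • ExteriorAlgebra.ιMulti ℝ 2 (e ∘ J) := by
    have h := congrArg Subtype.val hb
    simpa only [Submodule.coe_smul, Submodule.coe_sum, exteriorPower.ιMulti_apply_coe] using h
  have h2 := two_pow_smul_pow e P _ hb'
  rw [← hξ] at h2
  have h3 : (2 : ℝ) ^ n • ξ = ∑ κ : Fin (2 * n) → Fin (2 * n),
      (∏ i : Fin n, P (κ (pairIdx n (i, 0))) (κ (pairIdx n (i, 1)))) •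
        exteriorPower.ιMulti ℝ (2 * n) (e ∘ κ) := by
    refine Subtype.ext ?_
    simpa only [Submodule.coe_smul, Submodule.coe_sum, exteriorPower.ιMulti_apply_coe] using h2
  rw [← smul_eq_mul, ← map_smul, h3, map_sum, ← one_mul (pfaff P),
    ← Matrix.det_one (n := Fin (2 * n)), ← sum_det_submatrix]
  refine Finset.sum_congr rfl fun κ _ => ?_
  rw [map_smul, exteriorPower.alternatingMapToDual_apply_ιMulti, smul_eq_mul, mul_comm]
  congr 1
  rw [← Matrix.det_transpose]
  congr 1
  ext i j
  simp only [Matrix.transpose_apply, Matrix.of_apply, Function.comp, Matrix.submatrix_apply, id,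
    Matrix.one_apply]
  exact ha i (κ j)

end ExteriorPowerOfBivector

/-! ### The Pfaffian as defining function, and coordinates adapted to it -/

section SingularLocus

set_option linter.unusedSectionVars false

open Matrix

variable {n : ℕ} {M : Type*} [TopologicalSpace M] [T2Space M]
  [ChartedSpace (EuclideanSpace ℝ (Fin (2 * n))) M] [IsManifold (𝓡 (2 * n)) ∞ M]
  (π : MultiVec (2 * n) M 2)

/-- The matrix of brackets of the functions `y_i`. -/
def brMat (y : Fin (2 * n) → SmoothFun (2 * n) M) :
    Matrix (Fin (2 * n)) (Fin (2 * n)) (SmoothFun (2 * n) M) :=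
  Matrix.of fun i j => brL π (y i) (y j)

theorem pfaff_apply (B : Matrix (Fin (2 * n)) (Fin (2 * n)) (SmoothFun (2 * n) M)) (q : M) :
    pfaff B q = pfaff (B.map (evalHom q)) := map_pfaff (evalHom q) B

theorem topPower_eval {y : Fin (2 * n) → SmoothFun (2 * n) M} {q : M} (hy : IsCoord y q) :
    (2 : ℝ) ^ n * exteriorPower.alternatingMapToDual ℝ (TangentSpace (𝓡 (2 * n)) q) (2 * n)
      (fun i => dAt q (y i)) (topPower π q) = pfaff (brMat π y) q := by
  have hb := exteriorPower_eq_sum (f := fun i => dAt q (y i)) hy.eq_sum_coordFrame (π.1 q)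
  rw [pfaff_apply]
  refine two_pow_mul_toDual_eq_pfaff (fun i j => hy.mvfderiv_coordFrame i j) (b := π.1 q) ?_ _ rfl
  rw [show ((Nat.factorial 2 : ℕ) : ℝ) = 2 by norm_num] at hb
  exact hb

/-- The top exterior power is a line: in the frame expansion, index tuples with a repetition vanish
and permutations give the same coefficient up to sign. Thus the Pfaffian in any coordinates detects
the singular locus. -/
theorem mem_singularLocus_iff {y : Fin (2 * n) → SmoothFun (2 * n) M} {q : M}
    (hy : IsCoord y q) : q ∈ singularLocus π ↔ pfaff (brMat π y) q = 0 := by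
  have h2 : (2 : ℝ) ^ n ≠ 0 := by positivity
  constructor
  · intro hq
    rw [← topPower_eval π hy, show topPower π q = 0 from hq, map_zero, mul_zero]
  · intro hq
    have h0 := topPower_eval π hy
    rw [hq, mul_eq_zero, or_iff_right h2] at h0
    have hb := exteriorPower_eq_sum (f := fun i => dAt q (y i)) hy.eq_sum_coordFrame (topPower π q)
    have hk : ((2 * n).factorial : ℝ) ≠ 0 := by exact_mod_cast (2 * n).factorial_ne_zero
    refine (smul_eq_zero.1 (hb.trans (Finset.sum_eq_zero fun J _ => ?_))).resolve_left hk
    by_cases hJ : Function.Injective J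
    · let σ := Equiv.ofBijective J (Finite.injective_iff_bijective.1 hJ)
      have : ((fun i => dAt q (y i)) ∘ J) = (fun i => dAt q (y i)) ∘ σ := rfl
      rw [this, AlternatingMap.map_perm]
      rcases Int.units_eq_one_or (Equiv.Perm.sign σ) with h | h <;> rw [h] <;> simp [h0]
    · simp only [Function.Injective, not_forall] at hJ
      obtain ⟨i, j, hij, hne⟩ := hJ
      rw [AlternatingMap.map_eq_zero_of_eq _ _ (i := i) (j := j) (by simp [hij]) hne]
      simp

variable {π}

/-- By the Jacobi identity `{f, ·}` changes the matrix `P = ({y_i, y_j})` by the infinitesimal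
congruence `A P + P Aᵀ` with `A_{ik} = ∂{f, y_i}/∂y_k`, hence its Pfaffian by the factor `tr A`.
Consequently Hamiltonian vector fields are tangent to the zero set. -/
theorem IsPoisson.brL_pfaff (h : IsPoisson π) {y : Fin (2 * n) → SmoothFun (2 * n) M} {q : M}
    (hy : IsCoord y q) (f : SmoothFun (2 * n) M) :
    ∃ t : ℝ, brL π f (pfaff (brMat π y)) q = t * pfaff (brMat π y) q := by
  -- The map `g ↦ g(q) + ε {f, g}(q)` is multiplicative because `{f, ·}` is a derivation.
  let φ : SmoothFun (2 * n) M →+* DualNumber ℝ :=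
    { toFun := fun g => TrivSqZeroExt.inl (g q) + TrivSqZeroExt.inr (brL π f g q)
      map_one' := by
        have h1 : brL π f 1 = 0 := by
          have := brL_mul π f 1 1
          rw [mul_one, one_mul] at this
          exact left_eq_add.1 this
        rw [h1]; ext <;> simp [smoothFun_one_apply, smoothFun_zero_apply]
      map_zero' := by rw [map_zero]; ext <;> simp [smoothFun_zero_apply]
      map_add' := fun a b => by
        rw [map_add]; ext <;> simp [smoothFun_add_apply]
      map_mul' := fun a b => by
        rw [brL_mul]
        ext
        · simp [smoothFun_mul_apply]
        · simp [smoothFun_add_apply, smoothFun_mul_apply]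
          ring }
  refine ⟨_, (snd_pfaff φ (brMat π y) (Matrix.of fun i k => pd y k (brL π f (y i)) q)
    ((brMat π y).map (evalHom q)) ?_ ?_).trans (congrArg _ (pfaff_apply _ q).symm) |> Eq.trans ?_⟩
  · simp [φ]
  · intro i j
    simp [φ, evalHom_apply]
  · intro i j
    have e : TrivSqZeroExt.snd (φ (brMat π y i j)) = brL π f (brL π (y i) (y j)) q := by
      simp [φ, brMat]
    rw [e, h.jacobi, smoothFun_add_apply, brL_eq_sum_left π hy, brL_eq_sum π hy (y i)]
    simp only [Matrix.add_apply, Matrix.mul_apply, Matrix.of_apply, Matrix.map_apply,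
      Matrix.transpose_apply, brMat, evalHom_apply]
    congr 1
    exact Finset.sum_congr rfl fun k _ => mul_comm _ _

/-- The functions vanishing on the singular locus near `q`. -/
def VanishesNear (π : MultiVec (2 * n) M 2) (q : M) (f : SmoothFun (2 * n) M) : Prop :=
  ∀ᶠ x in nhds q, x ∈ singularLocus π → f x = 0

theorem eventually_notMem {q : M} (hq : q ∉ singularLocus π) :
    ∀ᶠ x in nhds q, x ∉ singularLocus π := by
  obtain ⟨y, hy, -⟩ := exists_isCoord (2 * n) q
  rw [mem_singularLocus_iff π hy] at hq
  have hc : ContinuousAt (⇑(pfaff (brMat π y) : SmoothFun (2 * n) M)) q :=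
    (pfaff (brMat π y)).contMDiff.continuous.continuousAt
  filter_upwards [hy.eventually, hc.eventually_ne hq] with x hx hx'
  rwa [mem_singularLocus_iff π hx]

/-- Near `z` the local representative of `∧ⁿπ` in the preferred chart is `2⁻ⁿ` times the Pfaffian,
so transversality says that the Pfaffian has nonzero differential. -/
theorem IsLogSymplectic.exists_pfaff (h : IsLogSymplectic π) {z : M} (hz : z ∈ singularLocus π) :
    ∃ y : Fin (2 * n) → SmoothFun (2 * n) M, IsCoord y z ∧ dAt z (pfaff (brMat π y)) ≠ 0 := by
  obtain ⟨y, hy, hyc⟩ := exists_isCoord (2 * n) z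
  refine ⟨y, hy, fun h0 => h.transverse z hz ?_⟩
  have hev : topCoeff π z =ᶠ[nhds z] (((2 : ℝ) ^ n)⁻¹ • pfaff (brMat π y) : SmoothFun (2 * n) M) := by
    filter_upwards [hy.eventually, Filter.eventually_all.2 fun i => (hyc i).eventually_nhds]
      with x hx hx'
    rw [smoothFun_smul_apply, ← topPower_eval π hx, inv_mul_cancel_left₀ (by positivity)]
    unfold topCoeff evalCovec
    congr 2
    funext i
    have e : (y i : M → ℝ) =ᶠ[nhds x] coord z i := hx' i
    ext v
    change mvfderiv (𝓡 (2 * n)) (coord z i) x v = mvfderiv (𝓡 (2 * n)) (y i) x v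
    rw [mvfderiv, mvfderiv, e.mfderiv_eq, e.self_of_nhds]
  have h1 : dAt z (((2 : ℝ) ^ n)⁻¹ • pfaff (brMat π y) : SmoothFun (2 * n) M) = 0 := by
    rw [map_smul, h0, smul_zero]
  ext v
  have h2 := LinearMap.congr_fun h1 v
  rw [dAt_apply] at h2
  rw [mvfderiv, hev.mfderiv_eq, hev.self_of_nhds]
  exact h2

/-- Were a neighbourhood of `q` contained in the singular locus, the Pfaffian would vanish there
identically, against transversality. By this density, identities between continuous functions need
only be checked where `π` is nondegenerate. -/
theorem IsLogSymplectic.frequently_notMem (h : IsLogSymplectic π) (q : M) :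
    ∃ᶠ x in nhds q, x ∉ singularLocus π := by
  by_cases hq : q ∈ singularLocus π
  · obtain ⟨y, hy, hd⟩ := h.exists_pfaff hq
    intro hev
    refine hd ?_
    have : ⇑(pfaff (brMat π y) : SmoothFun (2 * n) M) =ᶠ[nhds q] (0 : SmoothFun (2 * n) M) := by
      filter_upwards [hev, hy.eventually] with x hx hx'
      rw [not_not, mem_singularLocus_iff π hx'] at hx
      rw [hx]; rfl
    rw [dAt_congr this, map_zero]
  · exact (eventually_notMem hq).frequently

theorem IsLogSymplectic.eq_of_eventually (h : IsLogSymplectic π) {q : M} {f g : M → ℝ}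
    (hf : ContinuousAt f q) (hg : ContinuousAt g q)
    (hfg : ∀ᶠ x in nhds q, x ∉ singularLocus π → f x = g x) : f q = g q := by
  by_contra hne
  have h1 : ∀ᶠ x in nhds q, f x ≠ g x := by
    have : ContinuousAt (fun x => f x - g x) q := hf.sub hg
    filter_upwards [this.eventually_ne (sub_ne_zero.2 hne)] with x hx hx'
    exact hx (sub_eq_zero.2 hx')
  obtain ⟨x, hx, hx1, hx2⟩ := ((h.frequently_notMem q).and_eventually (hfg.and h1)).exists
  exact hx2 (hx1 hx)

theorem continuousAt_smoothFun (f : SmoothFun (2 * n) M) (q : M) : ContinuousAt f q :=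
  f.contMDiff.continuous.continuousAt

theorem IsLogSymplectic.smoothFun_ext (h : IsLogSymplectic π) {f g : SmoothFun (2 * n) M}
    (hfg : ∀ x, x ∉ singularLocus π → f x = g x) : f = g := by
  ext x
  exact h.eq_of_eventually (continuousAt_smoothFun f x) (continuousAt_smoothFun g x)
    (Filter.Eventually.of_forall hfg)

/-- The factor `x` at the singular index, and `1` at the other indices. -/
def frameFactor (y : Fin (2 * n) → SmoothFun (2 * n) M) (s : Option (Fin (2 * n)))
    (i : Fin (2 * n)) : SmoothFun (2 * n) M := if s = some i then y i else 1

/-- Coordinates near `p` adapted to the singular locus. -/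
structure BFrame (π : MultiVec (2 * n) M 2) (p : M) where
  /-- the coordinates -/
  y : Fin (2 * n) → SmoothFun (2 * n) M
  /-- the index of the coordinate that defines the singular locus, if `p` lies on it -/
  sing : Option (Fin (2 * n))
  /-- the matrix of the bivector field in the b-cotangent frame -/
  B : Matrix (Fin (2 * n)) (Fin (2 * n)) (SmoothFun (2 * n) M)
  coord : IsCoord y p
  -- The `dy_i` divided by their factors, that is `dx / x` and the other `dy_j`, form a frame of the
  -- b-cotangent bundle. In it `π` has matrix `B`, and `det_ne` is its nondegeneracy as a
  -- b-bivector.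
  fac : ∀ᶠ q in nhds p, ∀ i j, brL π (y i) (y j) q =
    frameFactor y sing i q * B i j q * frameFactor y sing j q
  skew : ∀ i j, B i j = -B j i
  det_ne : (B.map (evalHom p)).det ≠ 0
  zero : ∀ i, sing = some i → ∀ᶠ q in nhds p, q ∈ singularLocus π ↔ y i q = 0
  notMem : sing = none → p ∉ singularLocus π
  mem : ∀ i, sing = some i → p ∈ singularLocus π

theorem exists_bFrame_of_notMem {p : M} (hp : p ∉ singularLocus π) : Nonempty (BFrame π p) := by
  obtain ⟨y, hy, -⟩ := exists_isCoord (2 * n) p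
  refine ⟨⟨y, none, brMat π y, hy, ?_, fun i j => brL_skew π _ _, ?_, by simp, fun _ => hp,
    by simp⟩⟩
  · exact Filter.Eventually.of_forall fun q i j => by
      simp [frameFactor, brMat, smoothFun_one_apply]
  · refine det_ne_zero_of_pfaff_ne_zero ?_ ?_
    · ext i j
      simp only [Matrix.transpose_apply, Matrix.map_apply, Matrix.neg_apply, brMat,
        Matrix.of_apply]
      rw [brL_skew, map_neg]
    · rw [← pfaff_apply]
      exact fun h0 => hp ((mem_singularLocus_iff π hy).2 h0)

theorem IsPoisson.brL_eq_zero_of_mem (h : IsPoisson π) {y : Fin (2 * n) → SmoothFun (2 * n) M}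
    {q : M} (hy : IsCoord y q) (hq : q ∈ singularLocus π) (f : SmoothFun (2 * n) M) :
    brL π f (pfaff (brMat π y)) q = 0 := by
  obtain ⟨t, ht⟩ := h.brL_pfaff hy f
  rw [ht, (mem_singularLocus_iff π hy).1 hq, mul_zero]

/-- The Pfaffian `x` replaces a coordinate `y'_{i₀}` in whose direction its derivative is nonzero.
Each `{x, y_j}` vanishes on `{x = 0}` and is therefore divisible by `x`, which defines `B`. For
nondegeneracy the Pfaffian of `({y_i, y_j})` is computed twice: it is `x det J`, with `J` the
Jacobian of the coordinate change, and also `x pfaff B`. Hence `pfaff B = det J` off `Z`, and at `z`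
by density. -/
theorem IsLogSymplectic.exists_bFrame_of_mem (h : IsLogSymplectic π) {z : M}
    (hz : z ∈ singularLocus π) : Nonempty (BFrame π z) := by
  obtain ⟨y', hy', hd⟩ := h.exists_pfaff hz
  set x := pfaff (brMat π y') with hx
  have hi : ∃ i₀, pd y' i₀ x z ≠ 0 := by
    by_contra! hno
    refine hd ?_
    ext v
    rw [dAt_apply, hy'.mvfderiv_eq]
    simp [hno]
  obtain ⟨i₀, hi₀⟩ := hi
  let y : Fin (2 * n) → SmoothFun (2 * n) M := Function.update y' i₀ x
  have hyi : y i₀ = x := Function.update_self ..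
  have hyj : ∀ j, j ≠ i₀ → y j = y' j := fun j hj => Function.update_of_ne hj ..
  have hy : IsCoord y z := by
    refine Fintype.linearIndependent_iff.2 fun c hc => ?_
    have hev : ∀ j, ∑ i, c i * pd y' j (y i) z = 0 := by
      intro j
      have := LinearMap.congr_fun hc (coordFrame y' z j)
      simpa [LinearMap.sum_apply, pd] using this
    have hc0 : c i₀ = 0 := by
      have h1 := hev i₀
      rw [Finset.sum_eq_single i₀ (fun j _ hj => by
        rw [hyj j hj, hy'.pd_coord, if_neg hj, mul_zero]) (by simp), hyi] at h1
      exact (mul_eq_zero.1 h1).resolve_right hi₀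
    intro j
    by_cases hj : j = i₀
    · rw [hj, hc0]
    · have h1 := hev j
      rw [Finset.sum_eq_single j (fun l _ hl => by
        by_cases hl' : l = i₀
        · rw [hl', hc0, zero_mul]
        · rw [hyj l hl', hy'.pd_coord, if_neg hl, mul_zero]) (by simp), hyj j hj, hy'.pd_coord,
        if_pos rfl, mul_one] at h1
      exact h1
  have hzero : ∀ᶠ q in nhds z, q ∈ singularLocus π ↔ x q = 0 := by
    filter_upwards [hy'.eventually] with q hq
    exact mem_singularLocus_iff π hq
  have hxz : y i₀ z = 0 := by rw [hyi]; exact hzero.self_of_nhds.1 hz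
  have hdiv : ∀ j, ∃ c : SmoothFun (2 * n) M, ∀ᶠ q in nhds z, brL π x (y j) q = x q * c q := by
    intro j
    have := hy.exists_eq_mul i₀ hxz (brL π x (y j)) (by
      filter_upwards [hzero, hy'.eventually] with q hq hq' hq0
      rw [hyi] at hq0
      rw [brL_skew, smoothFun_neg_apply, h.isPoisson.brL_eq_zero_of_mem hq' (hq.2 hq0), neg_zero])
    rwa [hyi] at this
  choose c hc using hdiv
  let B : Matrix (Fin (2 * n)) (Fin (2 * n)) (SmoothFun (2 * n) M) := Matrix.of fun i j =>
    if i = i₀ then (if j = i₀ then 0 else c j) else if j = i₀ then -c i else brL π (y i) (y j)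
  have hskew : ∀ i j, B i j = -B j i := by
    intro i j
    simp only [B, Matrix.of_apply]
    by_cases h1 : i = i₀ <;> by_cases h2 : j = i₀ <;> simp [h1, h2]
    exact brL_skew π _ _
  have hm : ∀ i, frameFactor y (some i₀) i = if i = i₀ then x else 1 := by
    intro i
    by_cases h1 : i = i₀
    · subst h1; simp [frameFactor, hyi]
    · simp [frameFactor, h1, Ne.symm h1]
  have hfac : ∀ᶠ q in nhds z, ∀ i j, brL π (y i) (y j) q =
      frameFactor y (some i₀) i q * B i j q * frameFactor y (some i₀) j q := by
    filter_upwards [Filter.eventually_all.2 hc] with q hq i j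
    rw [hm, hm]
    simp only [B, Matrix.of_apply]
    by_cases h1 : i = i₀ <;> by_cases h2 : j = i₀
    · subst h1; subst h2
      rw [brL_self]; simp [smoothFun_zero_apply]
    · subst h1
      rw [hyi, hq j]; simp [h2, smoothFun_one_apply]
    · subst h2
      rw [hyi, brL_skew, smoothFun_neg_apply, hq i]
      simp [h1, smoothFun_one_apply, smoothFun_neg_apply, mul_comm]
    · simp [h1, h2, smoothFun_one_apply]
  refine ⟨⟨y, some i₀, B, hy, hfac, hskew, ?_, ?_, by simp, fun i hi => hz⟩⟩
  · refine det_ne_zero_of_pfaff_ne_zero ?_ ?_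
    · ext i j
      simp only [Matrix.transpose_apply, Matrix.map_apply, Matrix.neg_apply]
      rw [hskew, map_neg]
    · let J : M → Matrix (Fin (2 * n)) (Fin (2 * n)) ℝ := fun q =>
        Matrix.of fun i k => pd y' k (y i) q
      have hJc : ContinuousAt (fun q => (J q).det) z := by
        have : ContinuousAt J z := by
          refine continuousAt_pi.2 fun i => continuousAt_pi.2 fun k => ?_
          exact (hy'.contMDiffAt_pd ((y i).contMDiff z) k).continuousAt
        exact (Continuous.matrix_det continuous_id).continuousAt.comp this
      have hJz : (J z).det = pd y' i₀ x z := by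
        have : J z = (1 : Matrix (Fin (2 * n)) (Fin (2 * n)) ℝ).updateRow i₀
            (fun k => pd y' k x z) := by
          ext i k
          by_cases h1 : i = i₀
          · subst h1; simp [J, hyi]
          · simp [J, h1, hyj i h1, hy'.pd_coord, Matrix.one_apply]
        rw [this, det_one_updateRow]
      have key : ∀ᶠ q in nhds z, q ∉ singularLocus π → pfaff B q = (J q).det := by
        filter_upwards [hzero, hy'.eventually, hfac] with q hq hq' hq2 hqs
        have hxq : x q ≠ 0 := fun h0 => hqs (hq.2 h0)
        have e1 : (brMat π y).map (evalHom q) = J q * (brMat π y').map (evalHom q) * (J q)ᵀ := by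
          ext i j
          simp only [Matrix.map_apply, brMat, Matrix.of_apply, evalHom_apply, Matrix.mul_apply,
            Matrix.transpose_apply, J]
          rw [brL_eq_sum π hq']
          refine Finset.sum_congr rfl fun k _ => ?_
          rw [brL_eq_sum_left π hq', mul_comm]
        have e2 : (brMat π y).map (evalHom q) =
            (Matrix.diagonal fun i => if i = i₀ then x q else 1) * B.map (evalHom q) *
              (Matrix.diagonal fun i => if i = i₀ then x q else 1)ᵀ := by
          ext i j
          rw [Matrix.diagonal_transpose, Matrix.mul_diagonal, Matrix.diagonal_mul]
          simp only [Matrix.map_apply, brMat, Matrix.of_apply, evalHom_apply]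
          rw [hq2, hm, hm]
          by_cases h1 : i = i₀ <;> by_cases h2 : j = i₀ <;> simp [h1, h2, smoothFun_one_apply]
        have e3 : (Matrix.diagonal fun i : Fin (2 * n) => if i = i₀ then x q else 1).det = x q := by
          rw [Matrix.det_diagonal, Finset.prod_ite_eq' Finset.univ i₀]
          simp
        have e4 := congrArg pfaff (e1.symm.trans e2)
        rw [pfaff_conj, pfaff_conj, e3, ← pfaff_apply, ← pfaff_apply, ← hx, mul_comm] at e4
        exact (mul_left_cancel₀ hxq e4).symm
      have hfin := h.eq_of_eventually (continuousAt_smoothFun (pfaff B) z) hJc key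
      rw [← pfaff_apply, hfin, hJz]
      exact hi₀
  · intro i hi
    obtain rfl : i₀ = i := by simpa using hi
    rw [hyi]
    exact hzero

theorem IsLogSymplectic.exists_bFrame (h : IsLogSymplectic π) (p : M) : Nonempty (BFrame π p) := by
  by_cases hp : p ∈ singularLocus π
  · exact h.exists_bFrame_of_mem hp
  · exact exists_bFrame_of_notMem hp

end SingularLocus

/-! ### Hamiltonian vector fields as b-vector fields -/

section BFrames

set_option linter.unusedSectionVars false

open Matrix

variable {n : ℕ} {M : Type*} [TopologicalSpace M] [T2Space M]
  [ChartedSpace (EuclideanSpace ℝ (Fin (2 * n))) M] [IsManifold (𝓡 (2 * n)) ∞ M]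
  {π : MultiVec (2 * n) M 2}

theorem exists_eventually_mul_eq_one {p : M} {f : SmoothFun (2 * n) M} (hf : f p ≠ 0) :
    ∃ r : SmoothFun (2 * n) M, ∀ᶠ q in nhds p, r q * f q = 1 := by
  have hne : ∀ᶠ q in nhds p, f q ≠ 0 := (continuousAt_smoothFun f p).eventually_ne hf
  obtain ⟨r, hr⟩ := exists_smoothFun_eventuallyEq (d := 2 * n) (p := p) (f := fun q => (f q)⁻¹)
    (by
      filter_upwards [hne] with q hq
      exact (f.contMDiff q).inv₀ hq)
  refine ⟨r, ?_⟩
  filter_upwards [hr, hne] with q hq hq'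
  rw [hq, inv_mul_cancel₀ hq']

theorem exists_matrix_mul_eq_one {p : M}
    {B : Matrix (Fin (2 * n)) (Fin (2 * n)) (SmoothFun (2 * n) M)}
    (hB : (B.map (evalHom p)).det ≠ 0) :
    ∃ C : Matrix (Fin (2 * n)) (Fin (2 * n)) (SmoothFun (2 * n) M), ∀ᶠ q in nhds p,
      C.map (evalHom q) * B.map (evalHom q) = 1 := by
  have hd : ∀ q, (B.map (evalHom q)).det = B.det q := fun q =>
    (RingHom.map_det (evalHom q) B).symm
  rw [hd] at hB
  obtain ⟨r, hr⟩ := exists_eventually_mul_eq_one hB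
  refine ⟨r • B.adjugate, ?_⟩
  filter_upwards [hr] with q hq
  have h1 : (B.adjugate.map (evalHom q)) * B.map (evalHom q) =
      (B.det q) • (1 : Matrix (Fin (2 * n)) (Fin (2 * n)) ℝ) := by
    rw [← hd, ← Matrix.adjugate_mul]
    congr 1
    exact RingHom.map_adjugate (evalHom q) B
  have h2 : (r • B.adjugate).map (evalHom q) = r q • B.adjugate.map (evalHom q) := by
    ext i j
    simp [evalHom_apply, smoothFun_mul_apply]
  rw [h2, Matrix.smul_mul, h1, smul_smul, hq, one_smul]

namespace BFrame

variable {p : M} (φ : BFrame π p)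

/-- The factors of the frame. -/
abbrev fct (i : Fin (2 * n)) : SmoothFun (2 * n) M := frameFactor φ.y φ.sing i

theorem fct_of_eq {i : Fin (2 * n)} (h : φ.sing = some i) : φ.fct i = φ.y i := if_pos h

theorem fct_of_ne {i : Fin (2 * n)} (h : φ.sing ≠ some i) : φ.fct i = 1 := if_neg h

theorem exists_sing (hp : p ∈ singularLocus π) : ∃ i, φ.sing = some i :=
  Option.ne_none_iff_exists'.1 fun h => φ.notMem h hp

theorem y_eq_zero {i : Fin (2 * n)} (h : φ.sing = some i) : φ.y i p = 0 :=
  (φ.zero i h).self_of_nhds.1 (φ.mem i h)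

theorem eventually_fct_ne_zero :
    ∀ᶠ q in nhds p, q ∉ singularLocus π → ∀ i, φ.fct i q ≠ 0 := by
  have h : ∀ᶠ q in nhds p, ∀ i, φ.sing = some i → (q ∈ singularLocus π ↔ φ.y i q = 0) :=
    Filter.eventually_all.2 fun i => by
      by_cases hi : φ.sing = some i
      · filter_upwards [φ.zero i hi] with q hq _ using hq
      · exact Filter.Eventually.of_forall fun q hq => absurd hq hi
  filter_upwards [h] with q hq hqZ i
  by_cases hi : φ.sing = some i
  · rw [φ.fct_of_eq hi]
    exact fun h0 => hqZ ((hq i hi).2 h0)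
  · rw [φ.fct_of_ne hi, smoothFun_one_apply]
    exact one_ne_zero

theorem eventually_vanishesNear {i : Fin (2 * n)} (h : φ.sing = some i) :
    ∀ᶠ q in nhds p, VanishesNear π q (φ.y i) := by
  filter_upwards [(φ.zero i h).eventually_nhds] with q hq
  exact hq.mono fun x hx hx' => hx.1 hx'

theorem exists_eq_mul {i : Fin (2 * n)} (h : φ.sing = some i) {f : SmoothFun (2 * n) M}
    (hf : VanishesNear π p f) : ∃ c : SmoothFun (2 * n) M, f =ᶠ[nhds p] (φ.y i * c : _) := by
  refine φ.coord.exists_eq_mul i (φ.y_eq_zero h) f ?_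
  filter_upwards [hf, φ.zero i h] with q hq hq' hq0 using hq (hq'.2 hq0)

theorem exists_inv : ∃ C : Matrix (Fin (2 * n)) (Fin (2 * n)) (SmoothFun (2 * n) M),
    ∀ᶠ q in nhds p, C.map (evalHom q) * φ.B.map (evalHom q) = 1 :=
  exists_matrix_mul_eq_one φ.det_ne

theorem brL_y_eq_zero {i : Fin (2 * n)} (h : φ.sing = some i) (g : SmoothFun (2 * n) M) :
    brL π g (φ.y i) p = 0 := by
  rw [brL_eq_sum_left π φ.coord]
  refine Finset.sum_eq_zero fun j _ => ?_
  rw [φ.fac.self_of_nhds, show frameFactor φ.y φ.sing i = φ.y i from φ.fct_of_eq h,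
    φ.y_eq_zero h, mul_zero, mul_zero]

end BFrame

/-- The functions vanishing on the singular locus near `z` are multiples of the singular coordinate,
for which the factorization in the frame shows the claim. -/
theorem VanishesNear.brL_eq_zero (hπ : IsLogSymplectic π) {z : M} (hz : z ∈ singularLocus π)
    {f : SmoothFun (2 * n) M} (hf : VanishesNear π z f) (g : SmoothFun (2 * n) M) :
    brL π g f z = 0 := by
  obtain ⟨φ⟩ := hπ.exists_bFrame z
  obtain ⟨i, hi⟩ := φ.exists_sing hz
  obtain ⟨c, hc⟩ := φ.exists_eq_mul hi hf
  rw [brL_congr π g hc, brL_mul, smoothFun_add_apply, smoothFun_mul_apply, smoothFun_mul_apply,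
    φ.y_eq_zero hi, φ.brL_y_eq_zero hi, zero_mul, mul_zero, add_zero]

/-- Hamiltonian vector fields are tangent to the singular locus. -/
def hamB (hπ : IsLogSymplectic π) (f : SmoothFun (2 * n) M) :
    bVecField (d := 2 * n) (singularLocus π) :=
  ⟨ham π f, fun _ hz g hg => (dAt_ham π f g _).trans
    (VanishesNear.brL_eq_zero hπ hz (Filter.Eventually.of_forall hg) f)⟩

theorem IsCoord.tangent_ext {y : Fin (2 * n) → SmoothFun (2 * n) M} {q : M} (hy : IsCoord y q)
    {v w : TangentSpace (𝓡 (2 * n)) q} (h : ∀ i, dAt q (y i) v = dAt q (y i) w) : v = w := by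
  rw [hy.eq_sum_coordFrame v, hy.eq_sum_coordFrame w]
  exact Finset.sum_congr rfl fun i _ => by
    rw [show mvfderiv (𝓡 (2 * n)) (y i) q v = mvfderiv (𝓡 (2 * n)) (y i) q w from h i]

/-- A b-vector field annihilates along the singular locus the functions that vanish there. -/
theorem lieDeriv_vanishesNear (V : bVecField (d := 2 * n) (singularLocus π)) {q : M}
    {f : SmoothFun (2 * n) M} (hf : VanishesNear π q f) : VanishesNear π q (lieDeriv V.1 f) := by
  obtain ⟨χ, hχ1, hχ2, -⟩ := exists_bump (d := 2 * n) hf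
  filter_upwards [hχ1.eventually_nhds] with x hx hxZ
  have h1 := V.2 x hxZ (χ * f) fun z hz => by
    rw [smoothFun_mul_apply]
    by_cases hz0 : χ z = 0
    · rw [hz0, zero_mul]
    · rw [hχ2 z hz0 hz, mul_zero]
  have h2 : dAt x (χ * f) = dAt x f := dAt_congr <| by
    filter_upwards [hx] with t ht
    rw [smoothFun_mul_apply, ht, one_mul]
  rw [lieDeriv_apply, ← h2]
  exact h1

/-- The coefficients of a b-vector field in the frame of Hamiltonian vector fields. -/
theorem BFrame.exists_coeff {p : M} (φ : BFrame π p)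
    (V : bVecField (d := 2 * n) (singularLocus π)) :
    ∃ e : Fin (2 * n) → SmoothFun (2 * n) M, ∀ᶠ q in nhds p, q ∉ singularLocus π →
      V.1 q = ∑ j, (e j q / φ.fct j q) • ham π (φ.y j) q := by
  -- By tangency `V(y_l)` is divisible by the factor of index `l`; the quotients `v l` are the
  -- components of `V` in the b-frame. The field `X_{y_j}` divided by its factor has the components
  -- `B j l`, so multiplication by the inverse `C` of `B` gives coefficients that are smooth across
  -- the singular locus.
  have hv : ∀ l, ∃ v : SmoothFun (2 * n) M,
      ∀ᶠ q in nhds p, lieDeriv V.1 (φ.y l) q = φ.fct l q * v q := by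
    intro l
    by_cases hl : φ.sing = some l
    · obtain ⟨c, hc⟩ := φ.exists_eq_mul hl
        (lieDeriv_vanishesNear V (φ.eventually_vanishesNear hl).self_of_nhds)
      exact ⟨c, by rw [φ.fct_of_eq hl]; exact hc⟩
    · exact ⟨lieDeriv V.1 (φ.y l), Filter.Eventually.of_forall fun q => by
        rw [φ.fct_of_ne hl, smoothFun_one_apply, one_mul]⟩
  choose v hv using hv
  obtain ⟨C, hC⟩ := φ.exists_inv
  refine ⟨fun j => ∑ l, v l * C l j, ?_⟩
  filter_upwards [Filter.eventually_all.2 hv, hC, φ.eventually_fct_ne_zero, φ.fac,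
    φ.coord.eventually] with q h1 h2 h3 h4 h5 hq
  have h3 := h3 hq
  refine h5.tangent_ext fun l => ?_
  rw [← lieDeriv_apply, h1 l, map_sum]
  have h6 : ∀ j, dAt q (φ.y l) (((∑ l, v l * C l j) q / φ.fct j q) • ham π (φ.y j) q) =
      φ.fct l q * ∑ k, v k q * (C k j q * φ.B j l q) := by
    intro j
    rw [map_smul, dAt_ham, h4, smoothFun_sum_apply, smul_eq_mul]
    have := h3 j
    field_simp
    rw [Finset.sum_mul, mul_comm]
    refine congrArg _ (Finset.sum_congr rfl fun k _ => ?_)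
    rw [smoothFun_mul_apply]; ring
  rw [Finset.sum_congr rfl fun j _ => h6 j, ← Finset.mul_sum, Finset.sum_comm]
  congr 1
  have h7 : ∀ k, ∑ j, C k j q * φ.B j l q = if k = l then 1 else 0 := fun k => by
    have := congrFun (congrFun h2 k) l
    simpa [Matrix.mul_apply, Matrix.one_apply, evalHom_apply] using this
  simp only [← Finset.mul_sum, h7]
  simp

/-- Off the singular locus `π` is nondegenerate, and a linear combination of coordinates, with
coefficients from the inverse matrix, has the required Hamiltonian vector. -/
theorem exists_ham_eq {q : M} (hq : q ∉ singularLocus π) (v : TangentSpace (𝓡 (2 * n)) q) :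
    ∃ f : SmoothFun (2 * n) M, ham π f q = v := by
  obtain ⟨φ⟩ := exists_bFrame_of_notMem hq
  obtain ⟨C, hC⟩ := φ.exists_inv
  have h2 := hC.self_of_nhds
  have h3 := φ.eventually_fct_ne_zero.self_of_nhds hq
  have hs : φ.sing = none := by
    by_contra h
    obtain ⟨i, hi⟩ := Option.ne_none_iff_exists'.1 h
    exact hq (φ.mem i hi)
  refine ⟨∑ j, (∑ k, dAt q (φ.y k) v * C k j q) • φ.y j, φ.coord.tangent_ext fun l => ?_⟩
  rw [dAt_ham, map_sum, LinearMap.sum_apply, smoothFun_sum_apply]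
  have h1 : ∀ i, frameFactor φ.y φ.sing i q = 1 := fun i => by
    rw [show frameFactor φ.y φ.sing i = 1 from φ.fct_of_ne (by simp [hs]), smoothFun_one_apply]
  have h6 : ∀ j, (brL π ((∑ k, dAt q (φ.y k) v * C k j q) • φ.y j)) (φ.y l) q =
      ∑ k, dAt q (φ.y k) v * (C k j q * φ.B j l q) := by
    intro j
    rw [map_smul, LinearMap.smul_apply, smoothFun_smul_apply, φ.fac.self_of_nhds, h1, h1,
      Finset.sum_mul]
    exact Finset.sum_congr rfl fun k _ => by ring
  rw [Finset.sum_congr rfl fun j _ => h6 j, Finset.sum_comm]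
  have h7 : ∀ k, ∑ j, C k j q * φ.B j l q = if k = l then 1 else 0 := fun k => by
    have := congrFun (congrFun h2 k) l
    simpa [Matrix.mul_apply, Matrix.one_apply, evalHom_apply] using this
  simp only [← Finset.mul_sum, h7]
  simp

/-- By skewness `df(X_u) = -du(X_f)`, and the vectors `X_u` exhaust the tangent space at `q`. -/
theorem dAt_eq_of_ham_eq {q : M} (hq : q ∉ singularLocus π) {f g : SmoothFun (2 * n) M}
    (h : ham π f q = ham π g q) : dAt q f = dAt q g := by
  ext v
  obtain ⟨u, rfl⟩ := exists_ham_eq hq v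
  rw [dAt_ham, dAt_ham, brL_skew π u, brL_skew π u, smoothFun_neg_apply, smoothFun_neg_apply,
    ← dAt_ham, ← dAt_ham, h]

end BFrames

/-! ### b-forms -/

section LieRinehart

set_option linter.unusedSectionVars false

variable {d : ℕ} {M : Type*} [TopologicalSpace M]
  [ChartedSpace (EuclideanSpace ℝ (Fin d)) M] [IsManifold (𝓡 d) ∞ M]

instance : IsScalarTower ℝ (SmoothFun d M) (VecField d M) where
  smul_assoc c f V := by
    ext q : 1
    exact mul_smul c (f q) (V q)

variable (Z : Set M)

/-- The action of b-vector fields on functions. -/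
def bAnchor : bVecField (d := d) Z →ₗ[ℝ] SmoothFun d M →ₗ[ℝ] SmoothFun d M :=
  LinearMap.mk₂ ℝ (fun V f => lieDeriv V.1 f) (fun V W f => lieDeriv_add_left V.1 W.1 f)
    (fun c V f => lieDeriv_smul_left c V.1 f) (fun V => lieDeriv_add V.1)
    (fun c V f => lieDeriv_const_smul V.1 c f)

theorem bAnchor_apply (V : bVecField (d := d) Z) (f : SmoothFun d M) :
    bAnchor Z V f = lieDeriv V.1 f := rfl

variable [T2Space M]

theorem bVecField_ext {V W : bVecField (d := d) Z} (h : ∀ f, lieDeriv V.1 f = lieDeriv W.1 f) :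
    V = W := Subtype.ext (vecField_ext h)

theorem lieDeriv_bLieBracket (V W : bVecField (d := d) Z) (f : SmoothFun d M) :
    lieDeriv (bLieBracket V W).1 f =
      lieDeriv V.1 (lieDeriv W.1 f) - lieDeriv W.1 (lieDeriv V.1 f) :=
  lieDeriv_lieBracket V.1 W.1 f

theorem coe_add_bVecField (V W : bVecField (d := d) Z) : (V + W).1 = V.1 + W.1 := rfl

theorem coe_smul_bVecField (c : ℝ) (V : bVecField (d := d) Z) : (c • V).1 = c • V.1 := rfl

theorem coe_mul_bVecField (f : SmoothFun d M) (V : bVecField (d := d) Z) :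
    (f • V).1 = f • V.1 := rfl

/-- The Lie bracket of b-vector fields as a bilinear map. -/
def bBr : bVecField (d := d) Z →ₗ[ℝ] bVecField (d := d) Z →ₗ[ℝ] bVecField (d := d) Z :=
  LinearMap.mk₂ ℝ bLieBracket
    (fun V V' W => bVecField_ext Z fun f => by
      simp only [coe_add_bVecField, lieDeriv_add_left, lieDeriv_bLieBracket, lieDeriv_add]; abel)
    (fun c V W => bVecField_ext Z fun f => by
      simp only [coe_smul_bVecField, lieDeriv_smul_left, lieDeriv_bLieBracket,
        lieDeriv_const_smul, smul_sub])
    (fun V W W' => bVecField_ext Z fun f => by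
      simp only [coe_add_bVecField, lieDeriv_add_left, lieDeriv_bLieBracket, lieDeriv_add]; abel)
    (fun c V W => bVecField_ext Z fun f => by
      simp only [coe_smul_bVecField, lieDeriv_smul_left, lieDeriv_bLieBracket,
        lieDeriv_const_smul, smul_sub])

theorem bBr_apply (V W : bVecField (d := d) Z) : bBr Z V W = bLieBracket V W := rfl

/-- The exterior differential of a b-form. -/
def bDiff {k : ℕ} (α : BForm d Z k) : BForm d Z (k + 1) :=
  rinehartD (bBr Z) (bAnchor Z) (fun V => lieDeriv_mul V.1)
    (fun f V g => lieDeriv_mul_left f V.1 g)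
    (fun f V W => bVecField_ext Z fun g => by
      rw [bBr_apply, bBr_apply, lieDeriv_bLieBracket, sub_eq_add_neg (f • bLieBracket V W),
        ← neg_smul, coe_add_bVecField, lieDeriv_add_left]
      simp only [coe_mul_bVecField, lieDeriv_mul_left, lieDeriv_mul, lieDeriv_bLieBracket,
        bAnchor_apply]
      ring)
    (fun V => bVecField_ext Z fun f => by
      rw [bBr_apply, lieDeriv_bLieBracket, sub_self]
      ext q
      exact (map_zero (dAt q f)).symm) α

theorem bDiff_apply {k : ℕ} (α : BForm d Z k) (V : Fin (k + 1) → bVecField (d := d) Z) :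
    bDiff Z α V = bDifferential Z k α V := rfl

variable {Z}

theorem BForm.ext {k : ℕ} {α β : BForm d Z k} (h : ∀ V, α V = β V) : α = β :=
  DFunLike.ext α β h

theorem BForm.map_smul_univ {k : ℕ} (α : BForm d Z k) (c : Fin k → SmoothFun d M)
    (V : Fin k → bVecField (d := d) Z) : α (fun i => c i • V i) = (∏ i, c i) * α V :=
  MultilinearMap.map_smul_univ (AlternatingMap.toMultilinearMap α) c V

theorem BForm.map_sum {k : ℕ} (α : BForm d Z k) {ι : Type*} [Fintype ι] [DecidableEq ι]
    (V : Fin k → ι → bVecField (d := d) Z) :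
    α (fun i => ∑ j, V i j) = ∑ J : Fin k → ι, α (fun i => V i (J i)) :=
  MultilinearMap.map_sum (AlternatingMap.toMultilinearMap α) V

/-- b-forms are local. -/
theorem BForm.congr {k : ℕ} (α : BForm d Z k) {q : M} {V W : Fin k → bVecField (d := d) Z}
    (h : ∀ i, ∀ᶠ x in nhds q, (V i).1 x = (W i).1 x) : α V q = α W q := by
  obtain ⟨χ, hχ1, hχ2, -⟩ := exists_bump (d := d) (Filter.eventually_all.2 h)
  have e : (fun i => χ • V i) = fun i => χ • W i := by
    funext i
    refine Subtype.ext ?_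
    ext x : 1
    change χ x • (V i).1 x = χ x • (W i).1 x
    by_cases hx : χ x = 0
    · rw [hx, zero_smul, zero_smul]
    · rw [hχ2 x hx i]
  have h1 := congrArg (fun F : SmoothFun d M => F q) (congrArg α e)
  simp only [BForm.map_smul_univ α, Finset.prod_const, smoothFun_mul_apply] at h1
  have h2 : ((χ ^ (Finset.univ : Finset (Fin k)).card : SmoothFun d M)) q = 1 := by
    rw [← evalHom_apply, map_pow, evalHom_apply, hχ1.self_of_nhds, one_pow]
  rwa [h2, one_mul, one_mul] at h1

end LieRinehart

/-! ### The chain map from b-forms to multivector fields -/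

section Sharp

set_option linter.unusedSectionVars false

variable {n : ℕ} {M : Type*} [TopologicalSpace M] [T2Space M]
  [ChartedSpace (EuclideanSpace ℝ (Fin (2 * n))) M] [IsManifold (𝓡 (2 * n)) ∞ M]
  {π : MultiVec (2 * n) M 2} (hπ : IsLogSymplectic π)

theorem lieDeriv_hamB (f g : SmoothFun (2 * n) M) : lieDeriv (hamB hπ f).1 g = brL π f g :=
  lieDeriv_ham π f g

theorem hamB_mul (f g : SmoothFun (2 * n) M) :
    hamB hπ (f * g) = f • hamB hπ g + g • hamB hπ f := Subtype.ext (ham_mul π f g)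

theorem hamB_brL (f g : SmoothFun (2 * n) M) :
    hamB hπ (brL π f g) = bLieBracket (hamB hπ f) (hamB hπ g) :=
  Subtype.ext (lieBracket_ham hπ.isPoisson f g).symm

/-- The linear map from functions to Hamiltonian vector fields. -/
def hamL : SmoothFun (2 * n) M →ₗ[ℝ] bVecField (d := 2 * n) (singularLocus π) where
  toFun := hamB hπ
  map_add' f g := Subtype.ext (ham_add π f g)
  map_smul' c f := Subtype.ext (ham_smul π c f)

/-- The alternating map on functions defined by a b-form. -/
def sharpAlt {k : ℕ} (α : BForm (2 * n) (singularLocus π) k) :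
    SmoothFun (2 * n) M [⋀^Fin k]→ₗ[ℝ] SmoothFun (2 * n) M :=
  (restrictReal α).compLinearMap (hamL hπ)

theorem sharpAlt_apply {k : ℕ} (α : BForm (2 * n) (singularLocus π) k)
    (f : Fin k → SmoothFun (2 * n) M) : sharpAlt hπ α f = α (fun i => hamB hπ (f i)) := rfl

theorem isMultiDer_sharpAlt {k : ℕ} (α : BForm (2 * n) (singularLocus π) k) :
    IsMultiDer (sharpAlt hπ α) := by
  intro v i f g
  have e : ∀ u, sharpAlt hπ α (Function.update v i u) =
      α (Function.update (fun j => hamB hπ (v j)) i (hamB hπ u)) := by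
    intro u
    rw [sharpAlt_apply]
    congr 1
    funext j
    exact Function.apply_update (fun _ => hamB hπ) v i u j
  rw [e, e, e, hamB_mul]
  have h1 := AlternatingMap.map_update_add (show bVecField (d := 2 * n) (singularLocus π)
    [⋀^Fin k]→ₗ[SmoothFun (2 * n) M] SmoothFun (2 * n) M from α) (fun j => hamB hπ (v j)) i
    (f • hamB hπ g) (g • hamB hπ f)
  rw [AlternatingMap.map_update_smul, AlternatingMap.map_update_smul] at h1
  exact h1

theorem exists_sharp {k : ℕ} (α : BForm (2 * n) (singularLocus π) k) :
    ∃ w : MultiVec (2 * n) M k, toAlt w = sharpAlt hπ α :=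
  exists_multiVec (isMultiDer_sharpAlt hπ α)

/-- The multivector field `∧^k π^♯ α`. -/
def sharp {k : ℕ} : BForm (2 * n) (singularLocus π) k →ₗ[ℝ] MultiVec (2 * n) M k where
  toFun α := (exists_sharp hπ α).choose
  map_add' α β := toAlt_injective <| by
    rw [(exists_sharp hπ (α + β)).choose_spec]
    ext f : 1
    rw [toAlt_apply, map_add, ← toAlt_apply, ← toAlt_apply, (exists_sharp hπ α).choose_spec,
      (exists_sharp hπ β).choose_spec]
    rfl
  map_smul' c α := toAlt_injective <| by
    rw [(exists_sharp hπ (c • α)).choose_spec]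
    ext f : 1
    rw [toAlt_apply, RingHom.id_apply, map_smul, ← toAlt_apply, (exists_sharp hπ α).choose_spec]
    rfl

theorem toAlt_sharp {k : ℕ} (α : BForm (2 * n) (singularLocus π) k) :
    toAlt (sharp hπ α) = sharpAlt hπ α := (exists_sharp hπ α).choose_spec

theorem evalFun_sharp {k : ℕ} (α : BForm (2 * n) (singularLocus π) k)
    (f : Fin k → SmoothFun (2 * n) M) :
    evalFun f (sharp hπ α) = α (fun i => hamB hπ (f i)) :=
  congrArg (fun w => w f) (toAlt_sharp hπ α)

theorem isSharp_sharp {k : ℕ} (α : BForm (2 * n) (singularLocus π) k) :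
    IsSharp π α (sharp hπ α) := fun f =>
  ⟨fun i => hamB hπ (f i), fun i => lieDeriv_hamB hπ (f i), evalFun_sharp hπ α f⟩

/-- The two differentials are given by the same formula, and its ingredients correspond: `X_f` acts
as `{f, ·}`, and `X_{{f,g}} = [X_f, X_g]`. -/
theorem schouten_sharp {k : ℕ} (α : BForm (2 * n) (singularLocus π) k)
    (f : Fin (k + 1) → SmoothFun (2 * n) M) :
    schouten π k (sharp hπ α) f = bDifferential (singularLocus π) k α (fun i => hamB hπ (f i)) := by
  change ceSum (brL π) (brL π) (toAlt (sharp hπ α)) f = _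
  rw [toAlt_sharp]
  change (∑ i : Fin (k + 1), (-1 : ℝ) ^ (i : ℕ) •
      brL π (f i) (α fun j => hamB hπ (f (i.succAbove j)))) +
    ∑ j : Fin (k + 1), ∑ i ∈ Finset.univ.filter (· < j), (-1 : ℝ) ^ (j : ℕ) •
      α (fun l => hamB hπ (Function.update f i (brL π (f i) (f j)) (j.succAbove l))) =
    (∑ i : Fin (k + 1), (-1 : ℝ) ^ (i : ℕ) •
      lieDeriv (hamB hπ (f i)).1 (α fun j => hamB hπ (f (i.succAbove j)))) +
    ∑ j : Fin (k + 1), ∑ i ∈ Finset.univ.filter (· < j), (-1 : ℝ) ^ (j : ℕ) •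
      α (fun l => Function.update (fun i => hamB hπ (f i)) i
        (bLieBracket (hamB hπ (f i)) (hamB hπ (f j))) (j.succAbove l))
  simp only [lieDeriv_hamB, ← hamB_brL, Function.apply_update (fun _ => hamB hπ)]

include hπ in
/-- A b-form is determined by its values on Hamiltonian vector fields. -/
theorem bForm_ext_hamB {k : ℕ} {α β : BForm (2 * n) (singularLocus π) k}
    (h : ∀ f : Fin k → SmoothFun (2 * n) M,
      α (fun i => hamB hπ (f i)) = β (fun i => hamB hπ (f i))) : α = β := by
  -- By density it suffices to compare off the singular locus, where the Hamiltonian vector fields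
  -- of coordinates form a local frame.
  refine BForm.ext fun V => hπ.smoothFun_ext fun q hq => ?_
  obtain ⟨φ⟩ := exists_bFrame_of_notMem hq
  choose e he using fun i => φ.exists_coeff (V i)
  have hs : ∀ j, φ.fct j = 1 := fun j => φ.fct_of_ne fun h => hq (φ.mem j h)
  have hV : ∀ i, ∀ᶠ x in nhds q, (V i).1 x = (∑ j, e i j • hamB hπ (φ.y j) :
      bVecField (d := 2 * n) (singularLocus π)).1 x := by
    intro i
    filter_upwards [he i, eventually_notMem hq] with x hx hxZ
    rw [hx hxZ, Submodule.coe_sum]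
    have : ∀ W : Fin (2 * n) → VecField (2 * n) M, (∑ j, W j) x = ∑ j, W j x := fun W => by
      exact (congrFun (map_sum (ContMDiffSection.coeAddHom (𝓡 (2 * n))
        (EuclideanSpace ℝ (Fin (2 * n))) ∞ (TangentSpace (𝓡 (2 * n)) : M → Type _)) W
        Finset.univ) x).trans (Finset.sum_apply _ _ _)
    rw [this]
    refine Finset.sum_congr rfl fun j _ => ?_
    rw [hs j, smoothFun_one_apply, div_one]
    rfl
  rw [α.congr hV, β.congr hV, α.map_sum, β.map_sum]
  simp only [BForm.map_smul_univ, fun J : Fin k → Fin (2 * n) => h fun i => φ.y (J i)]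

end Sharp

/-! ### Multivector fields that come from b-forms -/

section SharpRange

set_option linter.unusedSectionVars false

variable {n : ℕ} {M : Type*} [TopologicalSpace M] [T2Space M]
  [ChartedSpace (EuclideanSpace ℝ (Fin (2 * n))) M] [IsManifold (𝓡 (2 * n)) ∞ M]
  {π : MultiVec (2 * n) M 2}

/-- An alternating map on functions that vanishes along the singular locus as soon as one of its
arguments does. -/
def IsB (π : MultiVec (2 * n) M 2) {k : ℕ}
    (w : SmoothFun (2 * n) M [⋀^Fin k]→ₗ[ℝ] SmoothFun (2 * n) M) : Prop :=
  ∀ z ∈ singularLocus π, ∀ (f : Fin k → SmoothFun (2 * n) M) (i : Fin k),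
    VanishesNear π z (f i) → w f z = 0

/-- The Hamiltonian vector field of the defining function of the singular locus is divisible by
this function. -/
theorem BFrame.exists_ham_eq_smul (hπ : IsLogSymplectic π) {z : M} (φ : BFrame π z)
    {i : Fin (2 * n)} (hi : φ.sing = some i) :
    ∃ W : bVecField (d := 2 * n) (singularLocus π),
      ∀ᶠ q in nhds z, ham π (φ.y i) q = φ.y i q • W.1 q := by
  -- The field sought is `∑_j B_{ij} fct_j ∂/∂y_j`, cut off by `χ` in order to be global. After the
  -- cutoff, `y_i W = χ X_{y_i}` wherever the coordinates and the factorization are valid.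
  obtain ⟨χ, hχ1, hχ2, hχ3⟩ := exists_bump (d := 2 * n)
    ((φ.coord.eventually.and (φ.fac.and (φ.zero i hi))).eventually_nhds)
  have hsm : ∀ g : SmoothFun (2 * n) M, ContMDiff (𝓡 (2 * n)) 𝓘(ℝ, ℝ) ∞
      (fun q => χ q * ∑ j, (φ.B i j q * φ.fct j q) * pd φ.y j g q) := by
    intro g
    refine contMDiff_of_tsupport fun q hq => ?_
    have hq' : q ∈ tsupport χ := tsupport_smul_subset_left χ
      (fun q => ∑ j, (φ.B i j q * φ.fct j q) * pd φ.y j g q) hq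
    have hc := (hχ3 hq').self_of_nhds.1
    refine (χ.contMDiff q).mul (ContMDiffAt.sum fun j _ => ?_)
    exact (((φ.B i j).contMDiff q).mul ((φ.fct j).contMDiff q)).mul
      (hc.contMDiffAt_pd (g.contMDiff q) j)
  have hpd : ∀ j (g : SmoothFun (2 * n) M) q, pd φ.y j g q = dAt q g (coordFrame φ.y q j) := fun _ _ _ => rfl
  let D : SmoothFun (2 * n) M →ₗ[ℝ] SmoothFun (2 * n) M :=
    { toFun := fun g => ⟨_, hsm g⟩
      map_add' := fun f g => by
        ext q
        change χ q * _ = χ q * _ + χ q * _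
        simp only [hpd, map_add, LinearMap.add_apply, mul_add, Finset.sum_add_distrib]
      map_smul' := fun c g => by
        ext q
        change χ q * _ = c * (χ q * _)
        simp only [hpd, map_smul, LinearMap.smul_apply, smul_eq_mul, Finset.mul_sum]
        exact Finset.sum_congr rfl fun j _ => by ring }
  have hD : ∀ g q, D g q = χ q * ∑ j, (φ.B i j q * φ.fct j q) * pd φ.y j g q := fun _ _ => rfl
  obtain ⟨W, hW⟩ := exists_vecField (D := D) fun f g => by
    ext q
    rw [smoothFun_add_apply, smoothFun_mul_apply, smoothFun_mul_apply]
    simp only [hD, hpd, dAt_mul, LinearMap.add_apply, LinearMap.smul_apply, smul_eq_mul, mul_add,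
      Finset.mul_sum, ← Finset.sum_add_distrib]
    exact Finset.sum_congr rfl fun j _ => by ring
  have hxD : ∀ g q, IsCoord φ.y q → (∀ i j, brL π (φ.y i) (φ.y j) q =
      frameFactor φ.y φ.sing i q * φ.B i j q * frameFactor φ.y φ.sing j q) →
      φ.y i q * D g q = χ q * brL π (φ.y i) g q := by
    intro g q h1 h2
    rw [brL_eq_sum π h1, hD, mul_left_comm, Finset.mul_sum]
    refine congrArg _ (Finset.sum_congr rfl fun j _ => ?_)
    rw [h2, show frameFactor φ.y φ.sing i = φ.y i from φ.fct_of_eq hi]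
    ring
  -- Tangency has to be checked at all points of the singular locus where `χ` does not vanish. There
  -- `g = y_i c` locally, so `W g = χ {y_i, c}` off the locus and hence at `q` by density, and this
  -- bracket vanishes at `q`.
  refine ⟨⟨W, fun q hq g hg => ?_⟩, ?_⟩
  · have e : mvfderiv (𝓡 (2 * n)) g q (W q) = D g q := DFunLike.congr_fun (hW g) q
    rw [e]
    by_cases h0 : χ q = 0
    · rw [hD, h0, zero_mul]
    have hev := hχ2 q h0
    have hyq : φ.y i q = 0 := hev.self_of_nhds.2.2.1 hq
    obtain ⟨c, hc⟩ := hev.self_of_nhds.1.exists_eq_mul i hyq g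
      (hev.mono fun x hx hx0 => hg x (hx.2.2.2 hx0))
    have hc' : g =ᶠ[nhds q] (φ.y i * c : SmoothFun (2 * n) M) := hc
    have h1 : D g q = (χ * brL π (φ.y i) c : SmoothFun (2 * n) M) q := by
      refine hπ.eq_of_eventually (continuousAt_smoothFun _ q) (continuousAt_smoothFun _ q) ?_
      filter_upwards [hev, brL_eventuallyEq π (φ.y i) hc'] with x hx hx' hxZ
      have hx0 : φ.y i x ≠ 0 := fun h => hxZ (hx.2.2.2 h)
      refine mul_left_cancel₀ hx0 ?_
      rw [hxD g x hx.1 hx.2.1, hx', brL_mul, brL_self, mul_zero, add_zero, smoothFun_mul_apply,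
        smoothFun_mul_apply]
      ring
    have h2 : VanishesNear π q (φ.y i) := hev.mono fun x hx hx' => hx.2.2.1 hx'
    rw [h1, smoothFun_mul_apply, brL_skew, smoothFun_neg_apply, h2.brL_eq_zero hπ hq, neg_zero,
      mul_zero]
  · filter_upwards [hχ1, φ.coord.eventually, φ.fac] with q h1 h2 h3
    refine tangent_ext fun g => ?_
    rw [dAt_ham, map_smul, smul_eq_mul, ← lieDeriv_apply, hW, hxD g q h2 h3, h1, one_mul]

/-- If `f` vanishes on the singular locus then `f = y_i c` near `z` and `X_f = y_i (X_c + c W)` with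
a b-vector field `W`. The divisibility holds within b-vector fields, so linearity of `α` over
functions brings out a factor that vanishes at `z`. -/
theorem isB_sharpAlt (hπ : IsLogSymplectic π) {k : ℕ} (α : BForm (2 * n) (singularLocus π) k) :
    IsB π (sharpAlt hπ α) := by
  intro z hz f a hf
  obtain ⟨φ⟩ := hπ.exists_bFrame z
  obtain ⟨i, hi⟩ := φ.exists_sing hz
  obtain ⟨c, hc⟩ := φ.exists_eq_mul hi hf
  obtain ⟨W, hW⟩ := φ.exists_ham_eq_smul hπ hi
  let V : Fin k → bVecField (d := 2 * n) (singularLocus π) := fun j => hamB hπ (f j)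
  have h1 : ∀ j, ∀ᶠ x in nhds z, (V j).1 x =
      (Function.update V a (φ.y i • (hamB hπ c + c • W)) j).1 x := by
    intro j
    by_cases hj : j = a
    · subst hj
      filter_upwards [hW, hc.eventually_nhds] with x hx hx'
      rw [Function.update_self]
      change ham π (f j) x = φ.y i x • (ham π c x + c x • W.1 x)
      have e : ham π (f j) x = ham π (φ.y i * c) x := tangent_ext fun g => by
        rw [dAt_ham, dAt_ham, brL_skew, brL_skew π _ g, smoothFun_neg_apply, smoothFun_neg_apply,
          brL_congr π g hx']
      rw [e, ham_mul]
      change φ.y i x • ham π c x + c x • ham π (φ.y i) x = _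
      rw [hx, smul_add, smul_comm (c x)]
    · exact Filter.Eventually.of_forall fun x => by rw [Function.update_of_ne hj]
  rw [sharpAlt_apply, α.congr h1]
  have h2 := AlternatingMap.map_update_smul (show bVecField (d := 2 * n) (singularLocus π)
    [⋀^Fin k]→ₗ[SmoothFun (2 * n) M] SmoothFun (2 * n) M from α) V a (φ.y i) (hamB hπ c + c • W)
  refine (DFunLike.congr_fun h2 z).trans ?_
  rw [smul_eq_mul, smoothFun_mul_apply, φ.y_eq_zero hi, zero_mul]

/-- At most one factor in the product differs from `1` unless `J` repeats an index, in which case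
the coefficient is zero. When the singular index occurs, `IsB` provides the divisibility. -/
theorem BFrame.exists_coeff_isB {p : M} (φ : BFrame π p) {k : ℕ}
    {w : SmoothFun (2 * n) M [⋀^Fin k]→ₗ[ℝ] SmoothFun (2 * n) M} (hw : IsB π w)
    (J : Fin k → Fin (2 * n)) :
    ∃ u : SmoothFun (2 * n) M, ∀ᶠ q in nhds p, w (φ.y ∘ J) q = (∏ a, φ.fct (J a) q) * u q := by
  by_cases hJ : Function.Injective J
  · by_cases hs : ∃ a, φ.sing = some (J a)
    · obtain ⟨a, ha⟩ := hs
      obtain ⟨u, hu⟩ := φ.exists_eq_mul ha (f := w (φ.y ∘ J)) (by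
        filter_upwards [φ.eventually_vanishesNear ha] with q hq hqZ
        exact hw q hqZ _ a hq)
      refine ⟨u, ?_⟩
      filter_upwards [hu] with q hq
      rw [hq, Finset.prod_eq_single a (fun b _ hb => by
        rw [φ.fct_of_ne fun h => hb (hJ (Option.some_injective _ (h.symm.trans ha))),
          smoothFun_one_apply]) (by simp), φ.fct_of_eq ha, smoothFun_mul_apply]
    · refine ⟨w (φ.y ∘ J), Filter.Eventually.of_forall fun q => ?_⟩
      rw [Finset.prod_eq_one fun a _ => by
        rw [φ.fct_of_ne fun h => hs ⟨a, h⟩, smoothFun_one_apply], one_mul]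
  · refine ⟨0, Filter.Eventually.of_forall fun q => ?_⟩
    simp only [Function.Injective, not_forall] at hJ
    obtain ⟨a, b, hab, hne⟩ := hJ
    rw [w.map_eq_zero_of_eq (φ.y ∘ J) (i := a) (j := b) (by simp [hab]) hne,
      smoothFun_zero_apply, mul_zero]

/-- Gluing of smooth functions that are uniquely determined off the singular locus. -/
theorem IsLogSymplectic.exists_smoothFun_of_local (hπ : IsLogSymplectic π) {P : M → ℝ → Prop}
    (huniq : ∀ q ∉ singularLocus π, ∀ a b, P q a → P q b → a = b)
    (hloc : ∀ p, ∃ G : SmoothFun (2 * n) M, ∀ᶠ q in nhds p, q ∉ singularLocus π → P q (G q)) :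
    ∃ G : SmoothFun (2 * n) M, ∀ q ∉ singularLocus π, P q (G q) := by
  choose G hG using hloc
  have hev : ∀ p, (fun q => G q q) =ᶠ[nhds p] G p := by
    intro p
    filter_upwards [(hG p).eventually_nhds] with q hq
    refine hπ.eq_of_eventually (continuousAt_smoothFun _ q) (continuousAt_smoothFun _ q) ?_
    filter_upwards [hq, hG q] with x h1 h2 hx
    exact huniq x hx _ _ (h2 hx) (h1 hx)
  refine ⟨⟨fun q => G q q, fun p => ((G p).contMDiff p).congr_of_eventuallyEq (hev p)⟩,
    fun q hq => (hG q).self_of_nhds hq⟩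

/-- The value of the future b-form on `V` is forced off the singular locus, where each `V i` is
Hamiltonian at the point. Locally, writing `V i` through the fields `X_{y_j}` introduces the
denominators `fct j`; these cancel against the divisible coefficients of `w`, which leaves an
expression smooth across the locus. -/
theorem IsB.exists_eval (hπ : IsLogSymplectic π) {k : ℕ}
    {w : SmoothFun (2 * n) M [⋀^Fin k]→ₗ[ℝ] SmoothFun (2 * n) M} (hw : IsB π w)
    (hder : IsMultiDer w) (V : Fin k → bVecField (d := 2 * n) (singularLocus π)) :
    ∃ G : SmoothFun (2 * n) M, ∀ q ∉ singularLocus π, ∀ f : Fin k → SmoothFun (2 * n) M,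
      (∀ i, ham π (f i) q = (V i).1 q) → G q = w f q := by
  refine hπ.exists_smoothFun_of_local (P := fun q a => ∀ f : Fin k → SmoothFun (2 * n) M,
      (∀ i, ham π (f i) q = (V i).1 q) → a = w f q) (fun q hq a b ha hb => ?_) fun p => ?_
  · choose f hf using fun i => exists_ham_eq hq ((V i).1 q)
    rw [ha f hf, hb f hf]
  · obtain ⟨φ⟩ := hπ.exists_bFrame p
    choose e he using fun i => φ.exists_coeff (V i)
    choose u hu using fun J => φ.exists_coeff_isB hw J
    refine ⟨∑ J : Fin k → Fin (2 * n), (∏ i, e i (J i)) * u J, ?_⟩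
    filter_upwards [Filter.eventually_all.2 he, Filter.eventually_all.2 hu,
      φ.eventually_fct_ne_zero] with q h1 h2 h3 hq f hf
    have h4 : ∀ i, dAt q (f i) = dAt q (∑ j, (e i j q / φ.fct j q) • φ.y j) := fun i => by
      refine dAt_eq_of_ham_eq hq ?_
      rw [hf, h1 i hq]
      refine tangent_ext fun g => ?_
      rw [dAt_ham, map_sum, map_sum, LinearMap.sum_apply, smoothFun_sum_apply]
      refine Finset.sum_congr rfl fun j _ => ?_
      rw [map_smul, map_smul, LinearMap.smul_apply, smoothFun_smul_apply, dAt_ham, smul_eq_mul]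
    have h5 : w (fun i => ∑ j, (e i j q / φ.fct j q) • φ.y j) =
        ∑ J : Fin k → Fin (2 * n), (∏ i, (e i (J i) q / φ.fct (J i) q)) • w (φ.y ∘ J) := by
      have := w.toMultilinearMap.map_sum fun i j => (e i j q / φ.fct j q) • φ.y j
      refine this.trans (Finset.sum_congr rfl fun J _ => ?_)
      exact w.toMultilinearMap.map_smul_univ _ _
    rw [hder.congr_dAt h4, h5, smoothFun_sum_apply, smoothFun_sum_apply]
    refine Finset.sum_congr rfl fun J _ => ?_
    rw [smoothFun_smul_apply, smoothFun_mul_apply, h2 J, Finset.prod_div_distrib,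
      ← evalHom_apply, map_prod, ← mul_assoc,
      div_mul_cancel₀ _ (Finset.prod_ne_zero_iff.2 fun a _ => h3 hq (J a))]
    rfl

/-- The values on b-vector fields come from `IsB.exists_eval`. Being alternating and linear over
functions is checked at points off the singular locus; there only the Hamiltonian vectors at the
point matter, so a function multiplier can be replaced by its value. -/
theorem IsB.exists_bForm (hπ : IsLogSymplectic π) {k : ℕ}
    {w : SmoothFun (2 * n) M [⋀^Fin k]→ₗ[ℝ] SmoothFun (2 * n) M} (hw : IsB π w)
    (hder : IsMultiDer w) : ∃ α : BForm (2 * n) (singularLocus π) k, sharpAlt hπ α = w := by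
  choose G hG using hw.exists_eval hπ hder
  choose h hh using fun (q : M) (hq : q ∉ singularLocus π) (v : TangentSpace (𝓡 (2 * n)) q) =>
    exists_ham_eq hq v
  have hupd : ∀ (V : Fin k → bVecField (d := 2 * n) (singularLocus π)) (i : Fin k)
      (X : bVecField (d := 2 * n) (singularLocus π)) (q : M) (hq : q ∉ singularLocus π)
      (f : SmoothFun (2 * n) M), ham π f q = X.1 q → G (Function.update V i X) q =
        w (Function.update (fun j => h q hq ((V j).1 q)) i f) q := by
    intro V i X q hq f hf
    refine hG _ q hq _ fun j => ?_
    by_cases hj : j = i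
    · subst hj; rw [Function.update_self, Function.update_self, hf]
    · rw [Function.update_of_ne hj, Function.update_of_ne hj, hh]
  let α : bVecField (d := 2 * n) (singularLocus π) [⋀^Fin k]→ₗ[SmoothFun (2 * n) M]
      SmoothFun (2 * n) M :=
    { toFun := G
      map_update_add' := fun {_} V i X Y => by
        have hd : ∀ (i : DecidableEq (Fin k)), i = instDecidableEqFin k := fun i =>
          Subsingleton.elim _ _
        cases hd ‹_›
        refine hπ.smoothFun_ext fun q hq => ?_
        rw [smoothFun_add_apply, hupd V i X q hq _ (hh q hq _), hupd V i Y q hq _ (hh q hq _),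
          hupd V i (X + Y) q hq (h q hq (X.1 q) + h q hq (Y.1 q)) (by
            rw [ham_add]; change ham π _ q + ham π _ q = _; rw [hh, hh]; rfl),
          w.map_update_add, smoothFun_add_apply]
      map_update_smul' := fun {_} V i c X => by
        have hd : ∀ (i : DecidableEq (Fin k)), i = instDecidableEqFin k := fun i =>
          Subsingleton.elim _ _
        cases hd ‹_›
        refine hπ.smoothFun_ext fun q hq => ?_
        rw [smul_eq_mul, smoothFun_mul_apply, hupd V i X q hq _ (hh q hq _),
          hupd V i (c • X) q hq (c q • h q hq (X.1 q)) (by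
            rw [ham_smul]; change c q • ham π _ q = _; rw [hh]; rfl),
          w.map_update_smul, smoothFun_smul_apply]
      map_eq_zero_of_eq' := fun V i j hV hij => by
        refine hπ.smoothFun_ext fun q hq => ?_
        rw [hG V q hq (fun l => h q hq ((V l).1 q)) fun l => hh q hq _,
          w.map_eq_zero_of_eq _ (i := i) (j := j) (by rw [hV]) hij] }
  refine ⟨α, AlternatingMap.ext fun f => hπ.smoothFun_ext fun q hq => ?_⟩
  exact hG (fun i => hamB hπ (f i)) q hq f fun i => rfl

end SharpRange

/-! ### The Euler vector field of the singular locus -/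

section Euler

set_option linter.unusedSectionVars false

variable {n : ℕ} {M : Type*} [TopologicalSpace M] [T2Space M]
  [ChartedSpace (EuclideanSpace ℝ (Fin (2 * n))) M] [IsManifold (𝓡 (2 * n)) ∞ M]
  {π : MultiVec (2 * n) M 2} {ι : Type*}

/-- The derivation `∑ a_s {f_s, ·}`, i.e. the vector field `π^♯(∑ a_s df_s)`. -/
def contrDer (π : MultiVec (2 * n) M 2) (T : Finset ι) (a f : ι → SmoothFun (2 * n) M) :
    SmoothFun (2 * n) M →ₗ[ℝ] SmoothFun (2 * n) M :=
  ∑ s ∈ T, LinearMap.mulLeft ℝ (a s) ∘ₗ brL π (f s)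

theorem contrDer_apply (T : Finset ι) (a f : ι → SmoothFun (2 * n) M) (g : SmoothFun (2 * n) M) :
    contrDer π T a f g = ∑ s ∈ T, a s * brL π (f s) g := by
  simp [contrDer, LinearMap.sum_apply]

theorem contrDer_mul (T : Finset ι) (a f : ι → SmoothFun (2 * n) M) (g h : SmoothFun (2 * n) M) :
    contrDer π T a f (g * h) = g * contrDer π T a f h + h * contrDer π T a f g := by
  simp only [contrDer_apply, brL_mul, Finset.mul_sum, ← Finset.sum_add_distrib]
  exact Finset.sum_congr rfl fun s _ => by ring

theorem contrDer_eventuallyEq (T : Finset ι) (a f : ι → SmoothFun (2 * n) M) {q : M}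
    {g h : SmoothFun (2 * n) M} (hgh : g =ᶠ[nhds q] h) :
    contrDer π T a f g =ᶠ[nhds q] contrDer π T a f h := by
  filter_upwards [hgh.eventually_nhds] with x hx
  simp only [contrDer_apply, smoothFun_sum_apply, smoothFun_mul_apply, brL_congr π _ hx]

/-- At `q` the vector field `π^♯(∑ a_s df_s)` is an Euler vector field of the singular locus. -/
def IsEulerAt (π : MultiVec (2 * n) M 2) (T : Finset ι) (a f : ι → SmoothFun (2 * n) M)
    (q : M) : Prop :=
  q ∈ singularLocus π → (∀ g, contrDer π T a f g q = 0) ∧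
    ∀ g, VanishesNear π q g → dAt q (contrDer π T a f g) = -dAt q g

theorem matrix_apply_self_eq_zero_of_mul_eq_one {m : Type*} [Fintype m] [DecidableEq m]
    {B C : Matrix m m ℝ} (hCB : C * B = 1) (hB : B.transpose = -B) (i : m) : C i i = 0 := by
  have h1 : B * (-C.transpose) = 1 := by
    have h := congrArg Matrix.transpose hCB
    rw [Matrix.transpose_mul, hB, Matrix.transpose_one] at h
    rw [Matrix.mul_neg, ← Matrix.neg_mul, h]
  have h2 : C i i = (-C.transpose) i i :=
    congrArg (fun X : Matrix m m ℝ => X i i) (left_inv_eq_right_inv hCB h1)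
  simp only [Matrix.neg_apply, Matrix.transpose_apply] at h2
  linarith

/-- The field wanted is `-y_i ∂/∂y_i`, for the singular index `i`. Inverting `π` in the b-frame
gives for its one-form the coefficients `-C i j` relative to `dy_j / fct_j`. The inverse of a skew
matrix has zero diagonal, so the only coefficient with a pole, `j = i`, vanishes, and the one-form
is smooth on `M`. -/
theorem BFrame.exists_isEulerAt {p : M} (φ : BFrame π p) :
    ∃ a : Fin (2 * n) → SmoothFun (2 * n) M,
      ∀ᶠ q in nhds p, IsEulerAt π Finset.univ a φ.y q := by
  rcases hs : φ.sing with _ | i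
  · refine ⟨0, ?_⟩
    filter_upwards [eventually_notMem (φ.notMem hs)] with q hq hq'
    exact absurd hq' hq
  obtain ⟨C, hC⟩ := φ.exists_inv
  let E := contrDer π Finset.univ (fun j => -C i j) φ.y
  have hE : ∀ᶠ q in nhds p, ∀ l, E (φ.y l) q = if l = i then -φ.y i q else 0 := by
    filter_upwards [hC, φ.fac] with q h1 h2 l
    have hCi : C i i q = 0 := matrix_apply_self_eq_zero_of_mul_eq_one h1 (by
      ext r s
      simp only [Matrix.transpose_apply, Matrix.map_apply, Matrix.neg_apply]
      rw [φ.skew, map_neg]) i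
    have h3 : ∀ j, C i j q * φ.fct j q = C i j q := fun j => by
      by_cases hj : j = i
      · rw [hj, hCi, zero_mul]
      · rw [φ.fct_of_ne (by rw [hs]; simpa using Ne.symm hj), smoothFun_one_apply, mul_one]
    have h4 : ∑ j, C i j q * φ.B j l q = if i = l then 1 else 0 := by
      have := congrFun (congrFun h1 i) l
      simpa [Matrix.mul_apply, Matrix.one_apply, evalHom_apply] using this
    have h5 : E (φ.y l) q = -(∑ j, C i j q * φ.B j l q) * φ.fct l q := by
      simp only [E, contrDer_apply, smoothFun_sum_apply, smoothFun_mul_apply, smoothFun_neg_apply]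
      rw [neg_mul, Finset.sum_mul, ← Finset.sum_neg_distrib]
      refine Finset.sum_congr rfl fun j _ => ?_
      rw [h2, ← h3 j]
      by_cases hj : φ.sing = some j
      · have hji : j = i := Option.some_injective _ (hj.symm.trans hs)
        subst hji
        rw [hCi]; ring
      · rw [φ.fct_of_ne hj, show frameFactor φ.y φ.sing j = 1 from φ.fct_of_ne hj,
          smoothFun_one_apply]
        ring
    rw [h5, h4]
    by_cases hl : l = i
    · subst hl; rw [if_pos rfl, if_pos rfl, φ.fct_of_eq hs, neg_mul, one_mul]
    · rw [if_neg (Ne.symm hl), if_neg hl]; ring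
  have hE0 : ∀ q, IsCoord φ.y q → φ.y i q = 0 →
      (∀ l, E (φ.y l) q = if l = i then -φ.y i q else 0) → ∀ g, E g q = 0 := by
    intro q h1 h2 h3 g
    have h4 := pointDer_eq_sum h1 (δ := evalAt q ∘ₗ E) (fun f g => by
      simp only [LinearMap.comp_apply, E, contrDer_mul]; rfl) g
    refine h4.trans (Finset.sum_eq_zero fun l _ => ?_)
    rw [LinearMap.comp_apply, evalAt_apply, h3, h2]
    simp
  refine ⟨fun j => -C i j, ?_⟩
  filter_upwards [hE.eventually_nhds, (φ.zero i hs).eventually_nhds, φ.coord.eventually]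
    with q h1 h2 h3 hq
  have hyq : φ.y i q = 0 := h2.self_of_nhds.1 hq
  have hEq : ∀ g, E g q = 0 := hE0 q h3 hyq h1.self_of_nhds
  refine ⟨hEq, fun g hg => ?_⟩
  obtain ⟨c, hc⟩ := h3.exists_eq_mul i hyq g (by
    filter_upwards [hg, h2] with x hx hx' h0 using hx (hx'.2 h0))
  have hc' : g =ᶠ[nhds q] (φ.y i * c : SmoothFun (2 * n) M) := hc
  have h4 : E g =ᶠ[nhds q] (φ.y i * E c + c * (-φ.y i) : SmoothFun (2 * n) M) := by
    refine (contrDer_eventuallyEq _ _ _ hc').trans ?_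
    filter_upwards [h1] with x hx
    have := hx i
    rw [if_pos rfl] at this
    rw [contrDer_mul]
    change φ.y i x * E c x + c x * E (φ.y i) x = φ.y i x * E c x + c x * -φ.y i x
    rw [this]
  rw [dAt_congr h4, dAt_congr hc', map_add, dAt_mul, dAt_mul, dAt_mul, smoothFun_neg_apply, hyq,
    hEq c, map_neg]
  simp

variable {z : M} {T : Finset ι} {a f : ι → SmoothFun (2 * n) M}

/-- The sum is the Koszul bracket `[Θ, dh]` paired with `δ`, where `Θ = ∑ a_s df_s`. As `h` vanishes
on the singular locus, all its brackets vanish at `z`, so both this sum and `δ(E h)` reduce to `∑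
a_s δ({f_s, h})`; and `E h` has differential `-dh` at `z`. -/
theorem VanishesNear.pointDer_eq (hπ : IsLogSymplectic π) (hz : z ∈ singularLocus π)
    (hE : IsEulerAt π T a f z) {δ : SmoothFun (2 * n) M →ₗ[ℝ] ℝ}
    (hδ : ∀ f g, δ (f * g) = f z * δ g + g z * δ f) {h : SmoothFun (2 * n) M}
    (hh : VanishesNear π z h) :
    ∑ s ∈ T, (a s z * δ (brL π (f s) h) - brL π h (a s) z * δ (f s)) = -δ h := by
  have h1 : dAt z (contrDer π T a f h) = dAt z (-h) := by rw [(hE hz).2 h hh, map_neg]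
  rw [← map_neg, ← pointDer_congr_dAt hδ h1, contrDer_apply, map_sum]
  refine Finset.sum_congr rfl fun s _ => ?_
  rw [hδ, hh.brL_eq_zero hπ hz, brL_skew π h, smoothFun_neg_apply, hh.brL_eq_zero hπ hz]
  ring

/-- Compatibility of `π^♯` with brackets, `π^♯[Θ, dh] = [E, X_h]`, paired with `dg`; it is the
Jacobi identity applied to each summand. -/
theorem sum_brL_eq (hπ : IsLogSymplectic π) (g h : SmoothFun (2 * n) M) :
    ∑ s ∈ T, (a s * brL π g (brL π (f s) h) - brL π h (a s) * brL π g (f s)) =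
      contrDer π T a f (brL π g h) + brL π h (contrDer π T a f g) := by
  simp only [contrDer_apply, map_sum, ← Finset.sum_add_distrib]
  refine Finset.sum_congr rfl fun s _ => ?_
  rw [hπ.isPoisson.jacobi g, brL_mul, brL_skew π h (brL π (f s) g), brL_skew π (f s) g, map_neg,
    LinearMap.neg_apply]
  ring

/-- `π^♯(∑ a_s df_s)` preserves brackets up to higher order along the singular locus. -/
theorem IsEulerAt.exists_eq_mul (hπ : IsLogSymplectic π) (hz : z ∈ singularLocus π)
    (hE : ∀ᶠ q in nhds z, IsEulerAt π T a f q) (φ : BFrame π z) (l : Fin (2 * n))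
    (h : SmoothFun (2 * n) M) :
    ∃ r : SmoothFun (2 * n) M, r z = 0 ∧ ∀ᶠ q in nhds z, (contrDer π T a f (brL π (φ.y l) h) +
      brL π h (contrDer π T a f (φ.y l)) : SmoothFun (2 * n) M) q = φ.fct l q * r q := by
  have hEv : ∀ g, VanishesNear π z (contrDer π T a f g) := fun g =>
    hE.mono fun q hq hqZ => (hq hqZ).1 g
  by_cases hl : φ.sing = some l
  · have hx := φ.eventually_vanishesNear hl
    obtain ⟨c, hc⟩ := φ.exists_eq_mul hl (f := brL π (φ.y l) h) (by
      filter_upwards [hx] with q hq hqZ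
      rw [brL_skew, smoothFun_neg_apply, hq.brL_eq_zero hπ hqZ, neg_zero])
    -- With `y = y_l`, `{y, h} = y c` and `E y = y e`, the terms `y c e` cancel and the quotient by
    -- `y` is `E c + {h, e}`. The Euler condition forces `e = -1` on the singular locus, so `{h, e}
    -- = {h, e + 1}` vanishes at `z`, as does `E c`.
    obtain ⟨e, he⟩ := φ.exists_eq_mul hl (hEv (φ.y l))
    have he1 : VanishesNear π z (e + 1) := by
      filter_upwards [hx, hE, he.eventually_nhds, φ.zero l hl, φ.coord.eventually]
        with q h1 h2 h3 h4 h5 hqZ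
      have h6 := (h2 hqZ).2 _ h1
      rw [dAt_congr h3, dAt_mul, h4.1 hqZ, zero_smul, zero_add] at h6
      have h7 := LinearMap.congr_fun h6 (coordFrame φ.y q l)
      have h8 : dAt q (φ.y l) (coordFrame φ.y q l) = 1 := (h5.pd_coord l l).trans (if_pos rfl)
      rw [LinearMap.smul_apply, LinearMap.neg_apply, h8, smul_eq_mul, mul_one] at h7
      rw [smoothFun_add_apply, h7, smoothFun_one_apply]
      ring
    refine ⟨contrDer π T a f c + brL π h (e + 1), ?_, ?_⟩
    · rw [smoothFun_add_apply, (hE.self_of_nhds hz).1, he1.brL_eq_zero hπ hz, add_zero]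
    · have h1 : brL π h 1 = 0 := by
        have := brL_mul π h 1 1
        rw [mul_one, one_mul] at this
        exact left_eq_add.1 this
      filter_upwards [contrDer_eventuallyEq T a f hc, brL_eventuallyEq π h he, hc, he]
        with q h2 h3 h4 h5
      rw [smoothFun_add_apply, h2, h3, contrDer_mul, brL_mul, φ.fct_of_eq hl, map_add, h1,
        add_zero, brL_skew π h (φ.y l)]
      rw [smoothFun_mul_apply] at h4 h5
      simp only [smoothFun_add_apply, smoothFun_mul_apply, smoothFun_neg_apply, h4, h5]
      ring
  · refine ⟨contrDer π T a f (brL π (φ.y l) h) + brL π h (contrDer π T a f (φ.y l)), ?_,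
      Filter.Eventually.of_forall fun q => by
      rw [φ.fct_of_ne hl, smoothFun_one_apply, one_mul]⟩
    rw [smoothFun_add_apply, (hE.self_of_nhds hz).1, (hEv _).brL_eq_zero hπ hz, add_zero]

/-- The claim is that at `z` the one-form `[Θ, dh]` is a multiple of the conormal `dy_i`. Off the
singular locus, the pairing of its components `lam` with `X_{y_l}` is known from `sum_brL_eq`, and
after division by `fct l` it tends to `0` at `z`. Nondegeneracy of `B` then gives `fct j * lam j =
0` at `z`, and `fct j = 1` for every `j ≠ i`. This makes closedness of `Θ` unnecessary. -/
theorem IsEulerAt.sum_pointDer_eq_zero (hπ : IsLogSymplectic π) (hz : z ∈ singularLocus π)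
    (hE : ∀ᶠ q in nhds z, IsEulerAt π T a f q) (φ : BFrame π z) {i : Fin (2 * n)}
    (hi : φ.sing = some i) {δ : SmoothFun (2 * n) M →ₗ[ℝ] ℝ}
    (hδ : ∀ f g, δ (f * g) = f z * δ g + g z * δ f) (hδi : δ (φ.y i) = 0)
    (h : SmoothFun (2 * n) M) :
    ∑ s ∈ T, (a s z * δ (brL π (f s) h) - brL π h (a s) z * δ (f s)) = 0 := by
  let lam : Fin (2 * n) → M → ℝ := fun j q => ∑ s ∈ T,
    (a s q * pd φ.y j (brL π (f s) h) q - brL π h (a s) q * pd φ.y j (f s) q)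
  have hsum : ∀ q, IsCoord φ.y q → ∀ ε : SmoothFun (2 * n) M →ₗ[ℝ] ℝ,
      (∀ f g, ε (f * g) = f q * ε g + g q * ε f) →
      ∑ s ∈ T, (a s q * ε (brL π (f s) h) - brL π h (a s) q * ε (f s)) =
        ∑ j, lam j q * ε (φ.y j) := by
    intro q hq ε hε
    simp only [lam, Finset.sum_mul]
    rw [Finset.sum_comm]
    refine Finset.sum_congr rfl fun s _ => ?_
    rw [pointDer_eq_sum hq hε (brL π (f s) h), pointDer_eq_sum hq hε (f s), Finset.mul_sum,
      Finset.mul_sum, ← Finset.sum_sub_distrib]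
    exact Finset.sum_congr rfl fun j _ => by ring
  have hcont : ∀ j, ContinuousAt (lam j) z := by
    intro j
    refine tendsto_finsetSum _ fun s _ => ?_
    refine ((continuousAt_smoothFun (a s) z).mul ?_).sub
      ((continuousAt_smoothFun (brL π h (a s)) z).mul ?_)
    · exact (φ.coord.contMDiffAt_pd ((brL π (f s) h).contMDiff z) j).continuousAt
    · exact (φ.coord.contMDiffAt_pd ((f s).contMDiff z) j).continuousAt
  have hzero : ∀ l, ∑ j, φ.B l j z * (φ.fct j z * lam j z) = 0 := by
    intro l
    obtain ⟨r, hr0, hr⟩ := IsEulerAt.exists_eq_mul hπ hz hE φ l h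
    rw [← hr0]
    refine hπ.eq_of_eventually (f := fun q => ∑ j, φ.B l j q * (φ.fct j q * lam j q)) ?_
      (continuousAt_smoothFun r z) ?_
    · refine tendsto_finsetSum _ fun j _ => ?_
      exact (continuousAt_smoothFun _ z).mul ((continuousAt_smoothFun _ z).mul (hcont j))
    · filter_upwards [hr, φ.coord.eventually, φ.fac, φ.eventually_fct_ne_zero] with q h1 h2 h3 h4 hq
      refine mul_left_cancel₀ (h4 hq l) ?_
      rw [← h1, ← sum_brL_eq hπ, smoothFun_sum_apply]
      have h5 := hsum q h2 (evalAt q ∘ₗ brL π (φ.y l)) (pointDer_brL π q _)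
      refine Eq.trans ?_ h5.symm
      rw [Finset.mul_sum]
      refine Finset.sum_congr rfl fun j _ => ?_
      rw [LinearMap.comp_apply, evalAt_apply, h3]
      ring
  have hlam : ∀ j, φ.fct j z * lam j z = 0 := by
    obtain ⟨C, hC⟩ := φ.exists_inv
    have h1 : (φ.B.map (evalHom z)).mulVec (fun j => φ.fct j z * lam j z) = 0 := by
      funext l
      exact hzero l
    have h2 := congrArg (C.map (evalHom z)).mulVec h1
    rw [Matrix.mulVec_mulVec, hC.self_of_nhds, Matrix.one_mulVec, Matrix.mulVec_zero] at h2
    exact fun j => congrFun h2 j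
  rw [hsum z φ.coord δ hδ]
  refine Finset.sum_eq_zero fun j _ => ?_
  by_cases hj : φ.sing = some j
  · rw [Option.some_injective _ (hj.symm.trans hi), hδi, mul_zero]
  · have := hlam j
    rw [φ.fct_of_ne hj, smoothFun_one_apply, one_mul] at this
    rw [this, zero_mul]

end Euler

/-! ### The homotopy -/

section Homotopy

set_option linter.unusedSectionVars false

variable {n : ℕ} {M : Type*} [TopologicalSpace M] [T2Space M]
  [ChartedSpace (EuclideanSpace ℝ (Fin (2 * n))) M] [IsManifold (𝓡 (2 * n)) ∞ M]
  {π : MultiVec (2 * n) M 2} {ι : Type*} {k : ℕ}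

theorem ceSum_finset_sum {L A : Type*} [AddCommGroup L] [Module ℝ L] [AddCommGroup A] [Module ℝ A]
    (br : L →ₗ[ℝ] L →ₗ[ℝ] L) (ρ : L →ₗ[ℝ] A →ₗ[ℝ] A) (T : Finset ι) (w : ι → (Fin k → L) → A)
    (v : Fin (k + 1) → L) : ceSum br ρ (∑ s ∈ T, w s) v = ∑ s ∈ T, ceSum br ρ (w s) v := by
  classical
  induction T using Finset.induction_on with
  | empty => simp [ceSum]
  | insert s T hs ih => rw [Finset.sum_insert hs, Finset.sum_insert hs, ceSum_add, ih]

/-- The Cartan formula for the contraction with `a df`. -/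
theorem ceSum_mul_cons_add (a f : SmoothFun (2 * n) M)
    (w : SmoothFun (2 * n) M [⋀^Fin (k + 1)]→ₗ[ℝ] SmoothFun (2 * n) M)
    (h : Fin (k + 1) → SmoothFun (2 * n) M) :
    ceSum (brL π) (brL π) (fun g => a * w (Fin.cons f g)) h +
        a * ceSum (brL π) (brL π) w (Fin.cons f h) =
      a * brL π f (w h) - ∑ j, (a * w (Function.update h j (brL π f (h j))) -
        brL π (h j) a * w (Function.update h j f)) := by
  have e : ∀ j : Fin (k + 1), (-1 : ℝ) ^ (j : ℕ) • (brL π (h j) a * w (Fin.cons f (h ∘ j.succAbove))) =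
      brL π (h j) a * w (Function.update h j f) := fun j => by
    rw [map_update_eq_neg_one_pow, mul_smul_comm]
  rw [ceSum_mul _ _ (brL_mul π) a (fun g => w (Fin.cons f g)), ceSum_cons, ceLie_apply]
  simp only [e, Finset.sum_sub_distrib, ← Finset.mul_sum]
  change a * ceSum (brL π) (brL π) (w.curryLeft f) h + _ + _ = _
  ring

theorem ceSum_congr_eventuallyEq {u u' : (Fin k → SmoothFun (2 * n) M) → SmoothFun (2 * n) M}
    {z : M} (hu : ∀ g, u g =ᶠ[nhds z] u' g) (h : Fin (k + 1) → SmoothFun (2 * n) M) :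
    ceSum (brL π) (brL π) u h z = ceSum (brL π) (brL π) u' h z := by
  simp only [ceSum, smoothFun_add_apply, smoothFun_sum_apply, smoothFun_smul_apply,
    brL_congr π _ (hu _), (hu _).self_of_nhds]

/-- If `d_π w` comes from a b-form, then so does `w - d_π (i_Θ w)`, where `Θ = ∑ a_s df_s`. -/
theorem IsEulerAt.ceSum_eq (hπ : IsLogSymplectic π) {z : M} (hz : z ∈ singularLocus π)
    {T : Finset ι} {a f : ι → SmoothFun (2 * n) M} (hE : ∀ᶠ q in nhds z, IsEulerAt π T a f q)
    {w : SmoothFun (2 * n) M [⋀^Fin (k + 1)]→ₗ[ℝ] SmoothFun (2 * n) M} (hw : IsMultiDer w)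
    (hdw : IsB π (ceD (brL π) (brL π) (brL_self π) w)) (h : Fin (k + 1) → SmoothFun (2 * n) M)
    (b : Fin (k + 1)) (hb : VanishesNear π z (h b)) :
    ceSum (brL π) (brL π) (fun g => ∑ s ∈ T, a s * w (Fin.cons (f s) g)) h z = w h z := by
  obtain ⟨φ⟩ := hπ.exists_bFrame z
  obtain ⟨i, hi⟩ := φ.exists_sing hz
  obtain ⟨c, hc⟩ := φ.exists_eq_mul hi hb
  have e1 : (fun g => ∑ s ∈ T, a s * w (Fin.cons (f s) g)) =
      ∑ s ∈ T, fun g => a s * w (Fin.cons (f s) g) := by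
    funext g; rw [Finset.sum_apply]
  -- The term `i_Θ d_π w` of Cartan's formula vanishes at `z` by `hdw`: the argument vanishing on
  -- the singular locus is still present, shifted by one place.
  have h1 : ∀ s, ceSum (brL π) (brL π) w (Fin.cons (f s) h) z = 0 := fun s =>
    hdw z hz (Fin.cons (f s) h) b.succ (by rwa [Fin.cons_succ])
  have h2 : ∀ s, ceSum (brL π) (brL π) (fun g => a s * w (Fin.cons (f s) g)) h z =
      a s z * brL π (f s) (w h) z - ∑ j, (a s z * slotAt w h j z (brL π (f s) (h j)) -
        brL π (h j) (a s) z * slotAt w h j z (f s)) := by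
    intro s
    have := DFunLike.congr_fun (ceSum_mul_cons_add (π := π) (a s) (f s) w h) z
    rw [smoothFun_add_apply, smoothFun_mul_apply, h1, mul_zero, add_zero] at this
    rw [this, smoothFun_sub_apply, smoothFun_sum_apply]
    rfl
  rw [e1, ceSum_finset_sum, smoothFun_sum_apply, Finset.sum_congr rfl fun s _ => h2 s,
    Finset.sum_sub_distrib, Finset.sum_comm]
  have h3 : ∑ s ∈ T, a s z * brL π (f s) (w h) z = 0 := by
    have := (hE.self_of_nhds hz).1 (w h)
    rw [contrDer_apply, smoothFun_sum_apply] at this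
    exact this
  -- The derivation in slot `j` kills `y_i`, because slot `b` already holds a function whose
  -- differential at `z` is a multiple of `dy_i`, and `w` is alternating. Only slot `b` is left; it
  -- contributes `-w(h)`, and the sign in front turns this into `w(h)`.
  have h4 : ∀ j, j ≠ b → ∑ s ∈ T, (a s z * slotAt w h j z (brL π (f s) (h j)) -
      brL π (h j) (a s) z * slotAt w h j z (f s)) = 0 := by
    intro j hj
    refine IsEulerAt.sum_pointDer_eq_zero hπ hz hE φ hi (hw.slotAt_mul h j z) ?_ (h j)
    have h5 := hw.congr_dAt (q := z) (f := Function.update h j (φ.y i))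
      (g := Function.update (Function.update h j (φ.y i)) b (c z • φ.y i)) (fun l => by
        by_cases hl : l = b
        · subst hl
          rw [Function.update_self, Function.update_of_ne (Ne.symm hj), dAt_congr hc, dAt_mul,
            φ.y_eq_zero hi, zero_smul, zero_add, map_smul]
        · rw [Function.update_of_ne hl])
    rw [slotAt_apply, h5, w.map_update_smul, smoothFun_smul_apply,
      w.map_eq_zero_of_eq _ (i := b) (j := j) (by
        rw [Function.update_self, Function.update_of_ne hj, Function.update_self]) (Ne.symm hj),
      smoothFun_zero_apply, mul_zero]
  rw [h3, Finset.sum_eq_single b (fun j _ hj => h4 j hj) (by simp),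
    hb.pointDer_eq hπ hz hE.self_of_nhds (hw.slotAt_mul h b z), slotAt_apply,
    Function.update_eq_self]
  ring

/-- Contraction with a locally finite sum `∑ a_s df_s`. -/
theorem exists_contraction {a f : ι → SmoothFun (2 * n) M}
    (ha : ∀ z, ∃ T : Finset ι, ∀ᶠ q in nhds z, ∀ s ∉ T, a s q = 0)
    {w : SmoothFun (2 * n) M [⋀^Fin (k + 1)]→ₗ[ℝ] SmoothFun (2 * n) M} (hw : IsMultiDer w) :
    ∃ u : SmoothFun (2 * n) M [⋀^Fin k]→ₗ[ℝ] SmoothFun (2 * n) M, IsMultiDer u ∧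
      ∀ (q : M) (T : Finset ι), (∀ s ∉ T, a s q = 0) →
        ∀ g, u g q = ∑ s ∈ T, a s q * w (Fin.cons (f s) g) q := by
  let U : (Fin k → SmoothFun (2 * n) M) → M → ℝ := fun g q => ∑ᶠ s, a s q * w (Fin.cons (f s) g) q
  have hU : ∀ (q : M) (T : Finset ι), (∀ s ∉ T, a s q = 0) →
      ∀ g, U g q = ∑ s ∈ T, a s q * w.curryLeft (f s) g q := by
    intro q T hT g
    refine finsum_eq_sum_of_support_subset _ fun s hs => ?_
    by_contra hsT
    exact hs (by simp only [hT s hsT, zero_mul])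
  have hsm : ∀ g, ContMDiff (𝓡 (2 * n)) 𝓘(ℝ, ℝ) ∞ (U g) := by
    intro g z
    obtain ⟨T, hT⟩ := ha z
    refine ((∑ s ∈ T, a s * w (Fin.cons (f s) g)).contMDiff z).congr_of_eventuallyEq ?_
    filter_upwards [hT] with q hq
    rw [hU q T hq, smoothFun_sum_apply]
    rfl
  have hex : ∀ q, ∃ T : Finset ι, ∀ s ∉ T, a s q = 0 := fun q =>
    (ha q).imp fun T hT => hT.self_of_nhds
  let u : SmoothFun (2 * n) M [⋀^Fin k]→ₗ[ℝ] SmoothFun (2 * n) M :=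
    { toFun := fun g => ⟨U g, hsm g⟩
      map_update_add' := fun {_} v i x y => by
        ext q
        obtain ⟨T, hT⟩ := hex q
        change U _ q = U _ q + U _ q
        simp only [hU q T hT, AlternatingMap.map_update_add, smoothFun_add_apply, mul_add,
          Finset.sum_add_distrib]
      map_update_smul' := fun {_} v i c x => by
        ext q
        obtain ⟨T, hT⟩ := hex q
        change U _ q = c * U _ q
        simp only [hU q T hT, AlternatingMap.map_update_smul, smoothFun_smul_apply, Finset.mul_sum,
          mul_left_comm c]
      map_eq_zero_of_eq' := fun v i j hv hij => by
        ext q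
        obtain ⟨T, hT⟩ := hex q
        change U v q = 0
        rw [hU q T hT]
        refine Finset.sum_eq_zero fun s _ => ?_
        rw [AlternatingMap.map_eq_zero_of_eq _ v hv hij, smoothFun_zero_apply, mul_zero] }
  refine ⟨u, fun v i x y => ?_, hU⟩
  ext q
  obtain ⟨T, hT⟩ := hex q
  change U _ q = x q * U _ q + y q * U _ q
  simp only [hU q T hT, Finset.mul_sum, ← Finset.sum_add_distrib]
  refine Finset.sum_congr rfl fun s _ => ?_
  change a s q * w (Fin.cons (f s) _) q = x q * (a s q * w (Fin.cons (f s) _) q) +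
    y q * (a s q * w (Fin.cons (f s) _) q)
  rw [Fin.cons_update, Fin.cons_update, Fin.cons_update, hw, smoothFun_add_apply,
    smoothFun_mul_apply, smoothFun_mul_apply]
  ring

/-- There is a global one-form whose image under `π^♯` is an Euler vector field of the singular
locus. -/
theorem IsLogSymplectic.exists_euler [SecondCountableTopology M] (hπ : IsLogSymplectic π) :
    ∃ a f : M × Fin (2 * n) → SmoothFun (2 * n) M, ∀ z, ∃ T : Finset (M × Fin (2 * n)),
      (∀ᶠ q in nhds z, ∀ s ∉ T, a s q = 0) ∧ ∀ᶠ q in nhds z, IsEulerAt π T a f q := by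
  have hφ : ∀ p, ∃ A Y : Fin (2 * n) → SmoothFun (2 * n) M,
      ∀ᶠ q in nhds p, IsEulerAt π Finset.univ A Y q := fun p => by
    obtain ⟨φ⟩ := hπ.exists_bFrame p
    obtain ⟨A, hA⟩ := φ.exists_isEulerAt
    exact ⟨A, φ.y, hA⟩
  choose A Y hAY using hφ
  have : LocallyCompactSpace M :=
    ChartedSpace.locallyCompactSpace (EuclideanSpace ℝ (Fin (2 * n))) M
  -- The Euler condition is affine in the one-form: since each local `E g` vanishes on the singular
  -- locus, the derivatives of `χ` do not contribute to the differential there, and the weights sum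
  -- to one.
  obtain ⟨χ, hχ⟩ := SmoothPartitionOfUnity.exists_isSubordinate (𝓡 (2 * n)) (s := Set.univ)
    isClosed_univ (fun p : M => interior {q | IsEulerAt π Finset.univ (A p) (Y p) q})
    (fun p => isOpen_interior)
    (fun p _ => Set.mem_iUnion.2 ⟨p, mem_interior_iff_mem_nhds.2 (hAY p)⟩)
  refine ⟨fun s => χ s.1 * A s.1 s.2, fun s => Y s.1 s.2, fun z => ?_⟩
  obtain ⟨N, hN, hfin⟩ := χ.locallyFinite z
  have hS : ∀ᶠ q in nhds z, ∀ p ∉ hfin.toFinset, χ p q = 0 := by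
    filter_upwards [hN] with q hq p hp
    by_contra h0
    exact hp (hfin.mem_toFinset.2 ⟨q, h0, hq⟩)
  set S := hfin.toFinset
  refine ⟨S ×ˢ Finset.univ, ?_, ?_⟩
  · filter_upwards [hS] with q hq s hs
    rw [smoothFun_mul_apply, hq s.1 (by simpa using hs), zero_mul]
  · filter_upwards [hS] with q hq hqZ
    have hE : ∀ g, contrDer π (S ×ˢ Finset.univ) (fun s => χ s.1 * A s.1 s.2)
        (fun s => Y s.1 s.2) g = ∑ p ∈ S, χ p * contrDer π Finset.univ (A p) (Y p) g := by
      intro g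
      rw [contrDer_apply, Finset.sum_product]
      refine Finset.sum_congr rfl fun p _ => ?_
      rw [contrDer_apply, Finset.mul_sum]
      exact Finset.sum_congr rfl fun j _ => by ring
    have hp : ∀ p, q ∈ tsupport (χ p) → IsEulerAt π Finset.univ (A p) (Y p) q := fun p h =>
      interior_subset (hχ p h)
    have h0 : ∀ p, q ∉ tsupport (χ p) → (χ p : M → ℝ) =ᶠ[nhds q] (0 : SmoothFun (2 * n) M) :=
      fun p h => notMem_tsupport_iff_eventuallyEq.1 h
    have hsum : ∑ p ∈ S, χ p q = 1 := by
      rw [← χ.sum_eq_one (Set.mem_univ q)]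
      refine (finsum_eq_sum_of_support_subset _ fun p hp => ?_).symm
      by_contra h
      exact hp (hq p h)
    refine ⟨fun g => ?_, fun g hg => ?_⟩
    · rw [hE, smoothFun_sum_apply]
      refine Finset.sum_eq_zero fun p _ => ?_
      rw [smoothFun_mul_apply]
      by_cases h : q ∈ tsupport (χ p)
      · rw [(hp p h hqZ).1, mul_zero]
      · rw [(h0 p h).self_of_nhds, smoothFun_zero_apply, zero_mul]
    · rw [hE, map_sum, ← one_smul ℝ (dAt q g), ← hsum, Finset.sum_smul, ← Finset.sum_neg_distrib]
      refine Finset.sum_congr rfl fun p _ => ?_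
      rw [dAt_mul]
      by_cases h : q ∈ tsupport (χ p)
      · rw [(hp p h hqZ).1, zero_smul, add_zero, (hp p h hqZ).2 g hg, smul_neg]
      · rw [dAt_congr (h0 p h), (h0 p h).self_of_nhds, map_zero, smoothFun_zero_apply, zero_smul,
          zero_smul, smul_zero, add_zero, neg_zero]

/-- A multivector field whose differential comes from a b-form comes from a b-form up to a
coboundary. -/
theorem IsLogSymplectic.exists_isB_sub [SecondCountableTopology M] (hπ : IsLogSymplectic π)
    {w : SmoothFun (2 * n) M [⋀^Fin (k + 1)]→ₗ[ℝ] SmoothFun (2 * n) M} (hw : IsMultiDer w)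
    (hdw : IsB π (ceD (brL π) (brL π) (brL_self π) w)) :
    ∃ u : SmoothFun (2 * n) M [⋀^Fin k]→ₗ[ℝ] SmoothFun (2 * n) M, IsMultiDer u ∧
      IsB π (w - ceD (brL π) (brL π) (brL_self π) u) := by
  obtain ⟨a, f, haf⟩ := hπ.exists_euler
  obtain ⟨u, hu, hu'⟩ := exists_contraction (a := a) (f := f)
    (fun z => (haf z).imp fun T hT => hT.1) hw
  refine ⟨u, hu, fun z hz h b hb => ?_⟩
  obtain ⟨T, hT, hE⟩ := haf z
  rw [AlternatingMap.sub_apply, smoothFun_sub_apply, ceD_apply,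
    ceSum_congr_eventuallyEq (u' := fun g => ∑ s ∈ T, a s * w (Fin.cons (f s) g)) (fun g => by
      filter_upwards [hT] with q hq
      rw [hu' q T hq, smoothFun_sum_apply]
      rfl) h, IsEulerAt.ceSum_eq hπ hz hE hw hdw h b hb, sub_self]

end Homotopy

/-! ### The isomorphism in cohomology -/

theorem Cohomology.exists_equiv {X Y : Type*} [AddCommGroup X] [Module ℝ X] [AddCommGroup Y]
    [Module ℝ Y] {C B : Submodule ℝ X} {C' B' : Submodule ℝ Y} (L : X →ₗ[ℝ] Y)
    (hC : ∀ x ∈ C, L x ∈ C') (hB : ∀ x ∈ B, L x ∈ B') (hinj : ∀ x ∈ C, L x ∈ B' → x ∈ B)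
    (hsurj : ∀ y ∈ C', ∃ x ∈ C, y - L x ∈ B') :
    ∃ e : Cohomology C B ≃ₗ[ℝ] Cohomology C' B',
      ∀ x : C, e (Cohomology.mk C B x) = Cohomology.mk C' B' ⟨L x.1, hC x.1 x.2⟩ := by
  let φ : (C ⧸ B.submoduleOf C) →ₗ[ℝ] (C' ⧸ B'.submoduleOf C') :=
    Submodule.mapQ _ _ (L.restrict hC) fun x hx => hB x.1 hx
  have hφ : Function.Bijective φ := by
    constructor
    · refine (injective_iff_map_eq_zero φ).2 fun x hx => ?_
      obtain ⟨x, rfl⟩ := Submodule.mkQ_surjective _ x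
      exact (Submodule.Quotient.mk_eq_zero _).2
        (hinj x.1 x.2 ((Submodule.Quotient.mk_eq_zero (B'.submoduleOf C')).1 hx))
    · intro y
      obtain ⟨y, rfl⟩ := Submodule.mkQ_surjective _ y
      obtain ⟨x, hx, hxy⟩ := hsurj y.1 y.2
      exact ⟨Submodule.Quotient.mk ⟨x, hx⟩, ((Submodule.Quotient.eq (B'.submoduleOf C')).2 hxy).symm⟩
  exact ⟨LinearEquiv.ofBijective φ hφ, fun x => rfl⟩

section Isomorphism

set_option linter.unusedSectionVars false

variable {n : ℕ} {M : Type*} [TopologicalSpace M] [T2Space M]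
  [ChartedSpace (EuclideanSpace ℝ (Fin (2 * n))) M] [IsManifold (𝓡 (2 * n)) ∞ M]
  {π : MultiVec (2 * n) M 2} {k : ℕ}

theorem IsMultiDer.sub {C : Type*} [CommRing C] [Algebra ℝ C] {w w' : C [⋀^Fin k]→ₗ[ℝ] C}
    (h : IsMultiDer w) (h' : IsMultiDer w') : IsMultiDer (w - w') := by
  intro v i f g
  simp only [AlternatingMap.sub_apply, h v i f g, h' v i f g]
  ring

theorem schouten_eq_ceD (w : MultiVec (2 * n) M k) (f : Fin (k + 1) → SmoothFun (2 * n) M) :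
    schouten π k w f = ceD (brL π) (brL π) (brL_self π) (toAlt w) f := rfl

theorem IsPoisson.mem_poissonCocycles (h : IsPoisson π) {w : MultiVec (2 * n) M k}
    (hw : w ∈ poissonCoboundaries π k) : w ∈ poissonCocycles π k := by
  cases k with
  | zero =>
    rw [(Submodule.mem_bot ℝ).1 hw]
    exact Submodule.zero_mem _
  | succ k =>
    obtain ⟨u, hu⟩ := hw
    have h1 : toAlt w = ceD (brL π) (brL π) (brL_self π) (toAlt u) := by
      ext f : 1
      exact (hu f).symm
    refine LinearMap.mem_ker.2 (funext fun f => ?_)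
    rw [schouten_eq_ceD, h1, ceD_ceD _ _ _ h.brL_brL h.jacobi]
    rfl

variable (hπ : IsLogSymplectic π)

theorem schouten_sharp_eq_bDiff (α : BForm (2 * n) (singularLocus π) k)
    (f : Fin (k + 1) → SmoothFun (2 * n) M) :
    schouten π k (sharp hπ α) f = evalFun f (sharp hπ (bDiff (singularLocus π) α)) := by
  rw [schouten_sharp, evalFun_sharp, bDiff_apply]

theorem sharp_injective : Function.Injective (sharp hπ (k := k)) := fun α β h =>
  bForm_ext_hamB hπ fun f => by rw [← evalFun_sharp, ← evalFun_sharp, h]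

/-- The reflection of cocycles works because `dα` is itself a b-form, hence determined by its values
on Hamiltonian vector fields. -/
theorem sharp_mem_poissonCocycles_iff {α : BForm (2 * n) (singularLocus π) k} :
    sharp hπ α ∈ poissonCocycles π k ↔ α ∈ bClosed (2 * n) (singularLocus π) k := by
  constructor
  · intro h
    have h1 : bDiff (singularLocus π) α = 0 := bForm_ext_hamB hπ fun f => by
      rw [← evalFun_sharp, ← schouten_sharp_eq_bDiff, LinearMap.mem_ker.1 h, BForm.zero_apply]
      rfl
    refine LinearMap.mem_ker.2 (funext fun V => ?_)
    rw [← bDiff_apply, h1, BForm.zero_apply]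
    rfl
  · intro h
    refine LinearMap.mem_ker.2 (funext fun f => ?_)
    rw [schouten_sharp, LinearMap.mem_ker.1 h]
    rfl

theorem sharp_mem_poissonCoboundaries {α : BForm (2 * n) (singularLocus π) k}
    (hα : α ∈ bExact (2 * n) (singularLocus π) k) : sharp hπ α ∈ poissonCoboundaries π k := by
  cases k with
  | zero =>
    rw [(Submodule.mem_bot ℝ).1 hα, map_zero]
    exact Submodule.zero_mem _
  | succ k =>
    obtain ⟨β, hβ⟩ := hα
    exact ⟨sharp hπ β, fun f => by rw [schouten_sharp, hβ, evalFun_sharp]⟩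

variable [SecondCountableTopology M]

/-- Acyclicity of the quotient complex, in the form that serves both injectivity and surjectivity.
In degree zero `IsB` is an empty condition, so every function comes from a b-form without
correction. -/
theorem exists_sub_sharp_mem {w : MultiVec (2 * n) M k}
    (hw : IsB π (ceD (brL π) (brL π) (brL_self π) (toAlt w))) :
    ∃ α : BForm (2 * n) (singularLocus π) k, w - sharp hπ α ∈ poissonCoboundaries π k := by
  cases k with
  | zero =>
    have hB : IsB π (toAlt w) := fun z _ f i => i.elim0
    obtain ⟨α, hα⟩ := hB.exists_bForm hπ (isMultiDer_toAlt w)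
    have : sharp hπ α = w := toAlt_injective ((toAlt_sharp hπ α).trans hα)
    exact ⟨α, by rw [this, sub_self]; exact Submodule.zero_mem _⟩
  | succ k =>
    obtain ⟨u, hu, hB⟩ := hπ.exists_isB_sub (isMultiDer_toAlt w) hw
    obtain ⟨α, hα⟩ := hB.exists_bForm hπ
      ((isMultiDer_toAlt w).sub (isMultiDer_ceD _ (brL_self π) (brL_mul π) hu))
    obtain ⟨v, rfl⟩ := exists_multiVec hu
    refine ⟨α, v, fun f => ?_⟩
    rw [map_sub, evalFun_sharp, ← sharpAlt_apply, hα, AlternatingMap.sub_apply, toAlt_apply,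
      sub_sub_cancel, schouten_eq_ceD]

theorem exists_mem_bClosed {w : MultiVec (2 * n) M k} (hw : w ∈ poissonCocycles π k) :
    ∃ α ∈ bClosed (2 * n) (singularLocus π) k, w - sharp hπ α ∈ poissonCoboundaries π k := by
  obtain ⟨α, hα⟩ := exists_sub_sharp_mem hπ (w := w) (fun z _ f i _ => by
    rw [← schouten_eq_ceD, LinearMap.mem_ker.1 hw]; rfl)
  refine ⟨α, (sharp_mem_poissonCocycles_iff hπ).1 ?_, hα⟩
  have := Submodule.sub_mem _ hw (hπ.isPoisson.mem_poissonCocycles hα)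
  rwa [sub_sub_cancel] at this

/-- A primitive `u` of `sharp α` has its differential in the image, so it differs from some `sharp
β` by a coboundary. Then `sharp (dβ) = d_π u = sharp α`, and injectivity gives `dβ = α`. -/
theorem mem_bExact_of_sharp_mem {α : BForm (2 * n) (singularLocus π) k}
    (hα : sharp hπ α ∈ poissonCoboundaries π k) : α ∈ bExact (2 * n) (singularLocus π) k := by
  cases k with
  | zero =>
    have : sharp hπ α = sharp hπ 0 := by rw [map_zero]; exact (Submodule.mem_bot ℝ).1 hα
    rw [sharp_injective hπ this]
    exact Submodule.zero_mem _
  | succ k =>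
    obtain ⟨u, hu⟩ := hα
    have h1 : ceD (brL π) (brL π) (brL_self π) (toAlt u) = sharpAlt hπ α := by
      ext f : 1
      exact (hu f).trans (evalFun_sharp hπ α f)
    obtain ⟨β, hβ⟩ := exists_sub_sharp_mem hπ (w := u) (by rw [h1]; exact isB_sharpAlt hπ α)
    have h2 := LinearMap.mem_ker.1 (hπ.isPoisson.mem_poissonCocycles hβ)
    rw [map_sub, sub_eq_zero] at h2
    have h3 : bDiff (singularLocus π) β = α := bForm_ext_hamB hπ fun f => by
      rw [← evalFun_sharp, ← schouten_sharp_eq_bDiff, ← h2, hu, evalFun_sharp]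
    exact ⟨β, fun V => by rw [← bDiff_apply, h3]⟩

end Isomorphism

end LogSymplectic
end

/-! ### The main theorem -/

open LogSymplectic in
theorem mainTheorem2 (n : ℕ) (M : Type*) [TopologicalSpace M] [T2Space M]
    [SecondCountableTopology M] [ChartedSpace (EuclideanSpace ℝ (Fin (2 * n))) M]
    [IsManifold (𝓡 (2 * n)) ∞ M] (π : MultiVec (2 * n) M 2) (hπ : IsLogSymplectic π) :
    ∃ e : ∀ k : ℕ, BCohomology (2 * n) (singularLocus π) k ≃ₗ[ℝ] PoissonCohomology π k,
      ∀ (k : ℕ) (α : bClosed (2 * n) (singularLocus π) k),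
        ∃ w : poissonCocycles π k, IsSharp π α.1 w.1 ∧
          e k (Cohomology.mk _ _ α) = Cohomology.mk _ _ w := by
  choose e he using fun k : ℕ => Cohomology.exists_equiv (sharp hπ (k := k))
    (fun _ => (sharp_mem_poissonCocycles_iff hπ).2) (fun _ => sharp_mem_poissonCoboundaries hπ)
    (fun _ _ => mem_bExact_of_sharp_mem hπ) (fun _ => exists_mem_bClosed hπ)
  exact ⟨e, fun k α => ⟨⟨sharp hπ α.1, (sharp_mem_poissonCocycles_iff hπ).2 α.2⟩,
    isSharp_sharp hπ α.1, he k α⟩⟩
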